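/- Let $n\ge 1$, $D=n+5$, $L>0$, $r_m\ge 0$, $f(r)=1-\frac{r_m^{D-3}}{r^{D-3}}-\frac{r^2}{L^2}$, and suppose that $f$ is positive somewhere on the static range, i.e. on $I=\{r>0: f(r)>0\}$ (together with $r=0$ if $r_m=0$). A conformally flat radial coordinate is an increasing parametrisation $r=R(\tilde r)$, $\tilde r\in J$, of $I$ together with $h>0$ on $J$ such that $r^2=h(\tilde r)^{-1}\tilde r^2$ and $f(r)^{-1}dr^2=h(\tilde r)^{-1}d\tilde r^2$; in it the $D$-dimensional (Schwarzschild–)de Sitter metric is $$ds^2=-f(R(\tilde r))\,dt^2+h(\tilde r)^{-1}\sum_{q=1}^{D-1}(dx^q)^2,\qquad \tilde r^2=\sum_q (x^q)^2\in J^2 .$$ Let $Y:U\to\mathbb R^3$ ($U\subset\mathbb R^2$ open) be a smooth immersed surface. Its Type I embedding is $t=\tau$, $x^q=Y^q(\sigma)$ for $q\le 3$, $x^q=0$ for $q>3$, required to lie in the coordinate domain. For a field $\mathbf k=\partial_\tau+\chi^a(\sigma)\partial_a$ on the worldvolume write $\mathbf k^2=-\gamma_{ab}\mathbf k^a\mathbf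 k^b$ ($\gamma$ the induced metric) and, where $\mathbf k^2>0$, $u^a=\mathbf k^a/\mathbf k$. The blackfold equations are $$\text{(i)}\quad K^i=n\,u^au^bK_{ab}{}^i \ \text{ for every normal direction } i,\qquad \text{(ii)}\quad \mathbf k\to0 \text{ at the boundary of the worldvolume},$$ where $K_{ab}{}^i$ is the extrinsic curvature, $K^i=\gamma^{ab}K_{ab}{}^i$, and boundary points are the limit points of the worldvolume in coordinate space that do not belong to it. A *stationary minimal Type I surface* is such an embedding with $U$ connected and nonempty, $Y$ minimal in Euclidean $\mathbb R^3$, $\mathbf k^2>0$, and $\mathbf k$ the restriction of a background Killing field $\partial_t+\xi^q(x)\partial_q$ (the static case $\chi=0$ is included). **Theorem.** Conformally flat coordinates exist. In any such coordinates: 1. A stationary minimal Type I surface satisfies (i) if and only if $Y(U)$ lies in a plane of $\mathbb R^3$ through the origin. 2. If it satisfies (i) and (ii), then there are a plane $P\subset\mathbb R^3$ through the origin and $\Omega\in\mathbb R$ such that $Y(U)=\{x\in P:\ |x|\in J,\ f(R(|x|))-\Omega^2R(|x|)^2>0\}$. 3. Conversely, for each plane through the origin and each $\Omega\in\mathbb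 R$ for which the set in 2 is nonempty, this set, parametrised by Cartesian coordinates of the plane and with $\mathbf k=\partial_\tau+\Omega\,\partial_\phi$ ($\partial_\phi$ the rotation of the plane about the origin), is a stationary minimal Type I surface and satisfies (i) and (ii). 4. Let $a\neq0$, $c>0$, $0\le\lambda\le1$, $\Omega\in\mathbb R$, and let $$Y(\rho,\phi)=\begin{pmatrix}\lambda c\sinh\frac{\rho}{c}\sin a\phi+\sqrt{1-\lambda^2}\,c\cosh\frac{\rho}{c}\cos a\phi\\ -\lambda c\sinh\frac{\rho}{c}\cos a\phi+\sqrt{1-\lambda^2}\,c\cosh\frac{\rho}{c}\sin a\phi\\ \lambda ca\phi+\sqrt{1-\lambda^2}\,\rho\end{pmatrix}$$ (the catenoid for $\lambda=0$, the helicoid for $\lambda=1$, Scherk's second surfaces in between), with $\mathbf k=\partial_\tau+\Omega\,\partial_\phi$. Then (i) does not hold identically on any nonempty open set of parameters on which the Type I embedding lies in the coordinate domain and $\mathbf k^2>0$ (whether or not $\mathbf k$ is the restriction of a background Killing field). -/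

import Mathlib

open scoped ContDiff Topology

noncomputable section

namespace Blackfold

/-! ## Submanifolds of a coordinate domain with a pseudo-Riemannian metric -/

/-- Partial derivative `∂F/∂xⁱ` at `x`. -/
def pd {ι : Type} [Fintype ι] [DecidableEq ι] (F : (ι → ℝ) → ℝ) (i : ι) (x : ι → ℝ) : ℝ :=
  fderiv ℝ F x (Pi.single i 1)

/-- Christoffel symbols `Γ^ρ_{μν}` of the metric `g`, given by its component matrix. -/
def christoffel {ι : Type} [Fintype ι] [DecidableEq ι] (g : (ι → ℝ) → Matrix ι ι ℝ)
    (x : ι → ℝ) (ρ μ ν : ι) : ℝ :=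
  (1 / 2) * ∑ κ, (g x)⁻¹ ρ κ *
    (pd (fun y => g y κ ν) μ x + pd (fun y => g y κ μ) ν x - pd (fun y => g y μ ν) κ x)

/-- `K` is a Killing vector field of `g` on `V`: it is smooth and the Lie derivative of `g`
along `K` vanishes. -/
def IsKilling {ι : Type} [Fintype ι] [DecidableEq ι] (g : (ι → ℝ) → Matrix ι ι ℝ)
    (V : Set (ι → ℝ)) (K : (ι → ℝ) → ι → ℝ) : Prop :=
  ContDiffOn ℝ ∞ K V ∧
  ∀ x ∈ V, ∀ μ ν : ι,
    ∑ κ, (K x κ * pd (fun y => g y μ ν) κ x + g x κ ν * pd (fun y => K y κ) μ x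
      + g x μ κ * pd (fun y => K y κ) ν x) = 0

/-- Tangent vectors `∂_a X^μ` of a parametrised submanifold. -/
def tangent {ι α : Type} [Fintype α] [DecidableEq α]
    (X : (α → ℝ) → ι → ℝ) (s : α → ℝ) (a : α) (μ : ι) : ℝ :=
  pd (fun y => X y μ) a s

/-- Induced metric `γ_{ab} = g_{μν} ∂_a X^μ ∂_b X^ν`. -/
def induced {ι α : Type} [Fintype ι] [Fintype α] [DecidableEq α]
    (g : (ι → ℝ) → Matrix ι ι ℝ) (X : (α → ℝ) → ι → ℝ) (s : α → ℝ) : Matrix α α ℝ :=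
  Matrix.of fun a b => ∑ μ, ∑ ν, g (X s) μ ν * tangent X s a μ * tangent X s b ν

/-- `m` is a normal covector of the submanifold at parameter `s`: `m_μ ∂_a X^μ = 0`. -/
def IsNormal {ι α : Type} [Fintype ι] [Fintype α] [DecidableEq α]
    (X : (α → ℝ) → ι → ℝ) (s : α → ℝ) (m : ι → ℝ) : Prop :=
  ∀ a, ∑ μ, m μ * tangent X s a μ = 0

/-- Extrinsic curvature along the normal covector `m`:
`K_{ab} = m_μ ∂_a ∂_b X^μ + m_ρ Γ^ρ_{μν} ∂_a X^μ ∂_b X^ν`. -/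
def extrinsic {ι α : Type} [Fintype ι] [DecidableEq ι] [Fintype α] [DecidableEq α]
    (g : (ι → ℝ) → Matrix ι ι ℝ) (X : (α → ℝ) → ι → ℝ) (s : α → ℝ) (m : ι → ℝ) (a b : α) : ℝ :=
  ∑ μ, m μ * pd (fun y => tangent X y b μ) a s
    + ∑ ρ, ∑ μ, ∑ ν,
        m ρ * christoffel g (X s) ρ μ ν * tangent X s a μ * tangent X s b ν

/-- Mean extrinsic curvature `γ^{ab} K_{ab}` along the normal covector `m`. -/
def meanCurv {ι α : Type} [Fintype ι] [DecidableEq ι] [Fintype α] [DecidableEq α]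
    (g : (ι → ℝ) → Matrix ι ι ℝ) (X : (α → ℝ) → ι → ℝ) (s : α → ℝ) (m : ι → ℝ) : ℝ :=
  ∑ a, ∑ b, (induced g X s)⁻¹ a b * extrinsic g X s m a b

/-- Minimal submanifold: the mean extrinsic curvature vanishes along every normal direction. -/
def IsMinimal {ι α : Type} [Fintype ι] [DecidableEq ι] [Fintype α] [DecidableEq α]
    (g : (ι → ℝ) → Matrix ι ι ℝ) (X : (α → ℝ) → ι → ℝ) (W : Set (α → ℝ)) : Prop :=
  ∀ s ∈ W, ∀ m, IsNormal X s m → meanCurv g X s m = 0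

/-! ## The blackfold equations -/

/-- `𝐤² = -γ_{ab} 𝐤^a 𝐤^b` for a worldvolume vector field `k`. -/
def kSq {ι α : Type} [Fintype ι] [Fintype α] [DecidableEq α]
    (g : (ι → ℝ) → Matrix ι ι ℝ) (X : (α → ℝ) → ι → ℝ) (k : (α → ℝ) → α → ℝ) (s : α → ℝ) : ℝ :=
  -∑ a, ∑ b, induced g X s a b * k s a * k s b

/-- Fluid velocity `u^a = 𝐤^a / 𝐤`. -/
def velocity {ι α : Type} [Fintype ι] [Fintype α] [DecidableEq α]
    (g : (ι → ℝ) → Matrix ι ι ℝ) (X : (α → ℝ) → ι → ℝ) (k : (α → ℝ) → α → ℝ)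
    (s : α → ℝ) (a : α) : ℝ :=
  k s a / Real.sqrt (kSq g X k s)

/-- The extrinsic blackfold equation `K^i = n u^a u^b K_{ab}^i` on the worldvolume `W`,
for every transverse direction. -/
def ExtrinsicEquation {ι α : Type} [Fintype ι] [DecidableEq ι] [Fintype α] [DecidableEq α]
    (n : ℕ) (g : (ι → ℝ) → Matrix ι ι ℝ) (X : (α → ℝ) → ι → ℝ) (W : Set (α → ℝ))
    (k : (α → ℝ) → α → ℝ) : Prop :=
  ∀ s ∈ W, ∀ m, IsNormal X s m →
    meanCurv g X s m
      = n * ∑ a, ∑ b, velocity g X k s a * velocity g X k s b * extrinsic g X s m a b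

/-- The boundary condition `𝐤 = 0` on the boundary of the worldvolume: `𝐤²` tends to zero
when the worldvolume approaches a limit point that does not belong to it. -/
def BoundaryCondition {ι α : Type} [Fintype ι] [Fintype α] [DecidableEq α]
    (g : (ι → ℝ) → Matrix ι ι ℝ) (X : (α → ℝ) → ι → ℝ) (W : Set (α → ℝ))
    (k : (α → ℝ) → α → ℝ) : Prop :=
  ∀ p ∈ closure (X '' W) \ X '' W,
    Filter.Tendsto (kSq g X k) (Filter.comap X (𝓝 p) ⊓ Filter.principal W) (𝓝 0)

/-- The blackfold equations. -/
def SolvesBlackfold {ι α : Type} [Fintype ι] [DecidableEq ι] [Fintype α] [DecidableEq α]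
    (n : ℕ) (g : (ι → ℝ) → Matrix ι ι ℝ) (X : (α → ℝ) → ι → ℝ) (W : Set (α → ℝ))
    (k : (α → ℝ) → α → ℝ) : Prop :=
  ExtrinsicEquation n g X W k ∧ BoundaryCondition g X W k

/-! ## (Schwarzschild-)de Sitter space-time of dimension `D = n + 5` -/

/-- `f(r) = 1 - r_m^{D-3}/r^{D-3} - r²/L²` with `D - 3 = n + 2`. -/
def fSdS (n : ℕ) (rm L r : ℝ) : ℝ := 1 - rm ^ (n + 2) / r ^ (n + 2) - r ^ 2 / L ^ 2

/-- The static range of the areal radius: `f > 0` (between the two horizons if `r_m > 0`,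
inside the cosmological horizon, with the centre `r = 0`, if `r_m = 0`). -/
def staticRange (n : ℕ) (rm L : ℝ) : Set ℝ :=
  {r | 0 ≤ r ∧ (r = 0 → rm = 0) ∧ 0 < fSdS n rm L r}

/-- A conformally flat radial coordinate `r̃`, increasing with the areal radius `r = R(r̃)` and
ranging over `J`, such that `r² = h(r̃)⁻¹ r̃²` and `f(r)⁻¹ dr² = h(r̃)⁻¹ dr̃²`. -/
structure ConformalRadius (n : ℕ) (rm L : ℝ) where
  J : Set ℝ
  R : ℝ → ℝ
  h : ℝ → ℝ
  interval : J.OrdConnected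
  nonneg : ∀ s ∈ J, 0 ≤ s
  bijOn : Set.BijOn R J (staticRange n rm L)
  h_pos : ∀ s ∈ J, 0 < h s
  sq_eq : ∀ s ∈ J, R s ^ 2 = (h s)⁻¹ * s ^ 2
  deriv_eq : ∀ s ∈ J, HasDerivWithinAt R (Real.sqrt (fSdS n rm L (R s) * (h s)⁻¹)) J s

/-- Euclidean length. -/
def euclid {d : ℕ} (x : Fin d → ℝ) : ℝ := Real.sqrt (∑ q, x q ^ 2)

/-- Space-time coordinates `(t, x^q)`, with `q = 1, …, D - 1 = n + 4`; `none` labels `t`. -/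
abbrev STIndex (n : ℕ) : Type := Option (Fin (n + 4))

/-- Worldvolume coordinates `(τ, σ¹, σ²)`; `none` labels `τ`. -/
abbrev WVIndex : Type := Option (Fin 2)

variable {n : ℕ} {rm L : ℝ}

/-- The coordinate domain of the conformally flat coordinates. -/
def ConformalRadius.domain (C : ConformalRadius n rm L) : Set (STIndex n → ℝ) :=
  {x | euclid (fun q => x (some q)) ∈ C.J}

/-- The metric `-f(r̃) dt² + h(r̃)⁻¹ Σ_q (dx^q)²`. -/
def ConformalRadius.metric (C : ConformalRadius n rm L) (x : STIndex n → ℝ) :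
    Matrix (STIndex n) (STIndex n) ℝ :=
  Matrix.diagonal fun μ => match μ with
    | none => -fSdS n rm L (C.R (euclid fun q => x (some q)))
    | some _ => (C.h (euclid fun q => x (some q)))⁻¹

/-! ## Stationary Type I embeddings -/

/-- The Type I embedding `t = τ`, `x^q = Y^q(σ)` for `q = 1, 2, 3`, and `x^q = 0` for the other
directions. -/
def typeI (n : ℕ) (Y : (Fin 2 → ℝ) → Fin 3 → ℝ) (s : WVIndex → ℝ) : STIndex n → ℝ
  | none => s none
  | some q => if hq : q.val < 3 then Y (fun a => s (some a)) ⟨q.val, hq⟩ else 0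

/-- The worldvolume over the parameter domain `U` of the surface. -/
def worldvolume (U : Set (Fin 2 → ℝ)) : Set (WVIndex → ℝ) := {s | (fun a => s (some a)) ∈ U}

/-- The worldvolume vector field `∂_τ + χ^a(σ) ∂_a`. -/
def wvField (χ : (Fin 2 → ℝ) → Fin 2 → ℝ) (s : WVIndex → ℝ) : WVIndex → ℝ
  | none => 1
  | some a => χ (fun b => s (some b)) a

/-- The space-time vector field `∂_t + ξ^q(x) ∂_q`. -/
def stField (n : ℕ) (ξ : (Fin (n + 4) → ℝ) → Fin (n + 4) → ℝ) (x : STIndex n → ℝ) :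
    STIndex n → ℝ
  | none => 1
  | some q => ξ (fun r => x (some r)) q

/-- The worldvolume field `∂_τ + χ` is the restriction of a background Killing vector field
`∂_t + ξ`. -/
def MapsToKilling (C : ConformalRadius n rm L) (U : Set (Fin 2 → ℝ))
    (Y : (Fin 2 → ℝ) → Fin 3 → ℝ) (χ : (Fin 2 → ℝ) → Fin 2 → ℝ) : Prop :=
  ∃ ξ : (Fin (n + 4) → ℝ) → Fin (n + 4) → ℝ,
    IsKilling C.metric C.domain (stField n ξ) ∧
    ∀ s ∈ worldvolume U, ∀ μ,
      stField n ξ (typeI n Y s) μ = ∑ a, tangent (typeI n Y) s a μ * wvField χ s a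

/-- A stationary Type I embedding: `Y : U → ℝ³` is a connected smooth immersed minimal surface of
Euclidean `ℝ³`, lying in the coordinate domain of the space-time, and `𝐤 = ∂_τ + χ` is timelike on
the worldvolume and maps to a background Killing vector field (the static case is `χ = 0`). -/
structure IsStationaryTypeI (C : ConformalRadius n rm L) (U : Set (Fin 2 → ℝ))
    (Y : (Fin 2 → ℝ) → Fin 3 → ℝ) (χ : (Fin 2 → ℝ) → Fin 2 → ℝ) : Prop where
  isOpen : IsOpen U
  connected : IsConnected U
  smooth : ContDiffOn ℝ ∞ Y U
  immersion : ∀ σ ∈ U, LinearIndependent ℝ (tangent Y σ)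
  minimal : IsMinimal (fun _ => (1 : Matrix (Fin 3) (Fin 3) ℝ)) Y U
  mem_domain : ∀ s ∈ worldvolume U, typeI n Y s ∈ C.domain
  killing : MapsToKilling C U Y χ
  timelike : ∀ s ∈ worldvolume U, 0 < kSq C.metric (typeI n Y) (wvField χ) s

/-! ## The plane and the helicoid-catenoid family -/

/-- The plane through the origin spanned by `e 0` and `e 1`, in Cartesian coordinates. -/
def planeMap (e : Fin 2 → Fin 3 → ℝ) (σ : Fin 2 → ℝ) : Fin 3 → ℝ :=
  fun i => σ 0 * e 0 i + σ 1 * e 1 i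

/-- `Ω ∂_φ` in Cartesian coordinates of the plane. -/
def rotField (Ω : ℝ) (σ : Fin 2 → ℝ) : Fin 2 → ℝ := ![-(Ω * σ 1), Ω * σ 0]

/-- The points of Euclidean `d`-space in the static range where `f - Ω² r² > 0`. -/
def ConformalRadius.ball (C : ConformalRadius n rm L) (d : ℕ) (Ω : ℝ) : Set (Fin d → ℝ) :=
  {x | euclid x ∈ C.J ∧ Ω ^ 2 * C.R (euclid x) ^ 2 < fSdS n rm L (C.R (euclid x))}

/-- The one-parameter family of Scherk's second surfaces in coordinates `(ρ, φ)`; it is the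
catenoid for `l = 0` and the helicoid of pitch `c` for `l = 1`. -/
def scherk (a c l : ℝ) (σ : Fin 2 → ℝ) : Fin 3 → ℝ :=
  ![l * (c * Real.sinh (σ 0 / c)) * Real.sin (a * σ 1)
      + Real.sqrt (1 - l ^ 2) * (c * Real.cosh (σ 0 / c)) * Real.cos (a * σ 1),
    -(l * (c * Real.sinh (σ 0 / c)) * Real.cos (a * σ 1))
      + Real.sqrt (1 - l ^ 2) * (c * Real.cosh (σ 0 / c)) * Real.sin (a * σ 1),
    l * (c * a * σ 1) + Real.sqrt (1 - l ^ 2) * σ 0]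

end Blackfold

end

/-! Write `g = r f'(r)`, `v = √f`, let `T` be the squared spatial velocity, `Q = m · Y` the support
function along a Euclidean normal `m`, and `B` the suitably scaled Euclidean normal acceleration of
the velocity field. When `Y` is minimal in `ℝ³`, the trace of its second fundamental form drops out
of (i), and away from the origin the equation along `m` becomes the scalar relation `Q ((g + 4v² -
4v)(v² - T) + n (g v² - 2T(v² - v))) + 2nBv = 0` (`extrinsic_eq_iff_bf`). In a plane through the
origin `Q = B = 0`, so (i) holds. The work lies in the converse.

The main tool is analytic continuation to a horizon. Since `g` is strictly decreasing in `r`, every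
horizon is a simple zero of `f`, so `v → 0` there while `g` has a nonzero limit. The areal radius is
a real-analytic function of the conformal radius (`analyticAt_R`), hence the relation, once valid on
an interval of an analytic curve, persists up to the horizon. In the limit it degenerates to `Q T =
0` (`mul_eq_zero_of_horizon`). If nothing rotates it reads `(n+1) g + 4v² - 4v = 0` wherever `Q ≠
0`, which contradicts `g ≠ 0` at the cosmological horizon (`not_eventually_static`).

A background Killing field `∂_t + ξ` has `ξ` orthogonal to the position vector, and `ξ` is then an
infinitesimal rotation, so on the surface the velocity is `w × Y` (`exists_cross_of_killing`). If
`Q` vanishes identically, the position vector is tangent, lies in the kernel of a traceless second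
fundamental form, and the surface is flat (`plane_of_tangent`). Otherwise shrink to an open set
where `Q ≠ 0`. The static case is excluded above. In the rotating case with unit axis `e`, the
function `(N · e)(Y · e) - N · Y` is locally constant (`pitch_stationary`): where it is zero the
surface is a plane orthogonal to the axis that misses the origin, elsewhere it is a catenoid about
the axis. For the plane, `Q T = 0` at the horizon is already impossible. The catenoid must have `Q =
0` at the horizon on both sides, that is, meet the horizon sphere orthogonally twice, which forces
it to be centred (`shift_eq_zero`). On a centred catenoid `𝐤²` is positive at the start and negative
near the horizon; at its first zero the relation forces a positive derivative
(`cat_crossing_algebra`), a contradiction.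

With (ii), a planar solution is open in its plane, and closed in the set where `f - Ω² r² > 0`
because `𝐤²` would otherwise have a positive limit at a missing point. That set is connected, so the
surface fills it (`image_eq_ball`). In the Scherk family the catenoid is covered by the argument
above. For `λ > 0`, points at one fixed distance from the origin give a polynomial identity in
`cosh²` whose value at zero is again the static equation (`not_extrinsic_scherk`); no Killing
assumption enters. -/

open scoped ContDiff Topology

noncomputable section

namespace Blackfold

variable {n : ℕ} {rm L : ℝ}

section

/-! ## The static range -/

/-- The logarithmic derivative `r f'(r)` of the lapse function. -/
def fSlope (n : ℕ) (rm L r : ℝ) : ℝ :=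
  (n + 2) * (rm ^ (n + 2) / r ^ (n + 2)) - 2 * (r ^ 2 / L ^ 2)

theorem hasDerivAt_fSdS {r : ℝ} (hr : 0 < r) :
    HasDerivAt (fSdS n rm L) (fSlope n rm L r / r) r := by
  unfold fSdS fSlope
  have h1 : HasDerivAt (fun r : ℝ => r ^ (n + 2)) (((n + 2 : ℕ) : ℝ) * r ^ (n + 1)) r := by
    simpa using hasDerivAt_pow (n + 2) r
  have h2 : HasDerivAt (fun r : ℝ => r ^ 2 / L ^ 2) (2 * r / L ^ 2) r := by
    simpa using (hasDerivAt_pow 2 r).div_const (L ^ 2)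
  have h3 := (((hasDerivAt_const r (1 : ℝ)).sub
    ((hasDerivAt_const r (rm ^ (n + 2))).div h1 (by positivity))).sub h2)
  refine h3.congr_deriv ?_
  push_cast
  field_simp
  ring

theorem fSdS_zero_right (hrm : rm = 0) : fSdS n rm L 0 = 1 := by
  simp [fSdS, hrm]

/-- The mass term does not increase and the cosmological term strictly decreases. All qualitative
information about `f` comes from this: it has at most one critical point, which is a maximum. -/
theorem fSlope_strictAntiOn (hrm : 0 ≤ rm) (hL : 0 < L) :
    StrictAntiOn (fSlope n rm L) (Set.Ioi 0) := by
  intro a ha b hb hab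
  have ha' : 0 < a := ha
  have h1 : rm ^ (n + 2) / b ^ (n + 2) ≤ rm ^ (n + 2) / a ^ (n + 2) := by gcongr
  have h2 : a ^ 2 / L ^ 2 < b ^ 2 / L ^ 2 := by gcongr
  have h3 : ((n : ℝ) + 2) * (rm ^ (n + 2) / b ^ (n + 2))
      ≤ (n + 2) * (rm ^ (n + 2) / a ^ (n + 2)) := by gcongr
  unfold fSlope
  linarith

theorem continuousAt_fSdS {r : ℝ} (hr : 0 < r) : ContinuousAt (fSdS n rm L) r :=
  (hasDerivAt_fSdS hr).continuousAt

theorem continuousAt_fSlope {r : ℝ} (hr : 0 < r) : ContinuousAt (fSlope n rm L) r := by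
  unfold fSlope
  have : r ^ (n + 2) ≠ 0 := by positivity
  fun_prop (disch := assumption)

theorem exists_fSlope_eq {a b : ℝ} (ha : 0 < a) (hab : a < b) :
    ∃ c ∈ Set.Ioo a b, fSlope n rm L c / c = (fSdS n rm L b - fSdS n rm L a) / (b - a) :=
  exists_hasDerivAt_eq_slope _ _ hab
    (fun _ hx => (continuousAt_fSdS (lt_of_lt_of_le ha hx.1)).continuousWithinAt)
    (fun _ hx => hasDerivAt_fSdS (ha.trans hx.1))

/-- Strict quasi-concavity of the lapse function. -/
theorem fSdS_lt_of_le (hrm : 0 ≤ rm) (hL : 0 < L) {a b c : ℝ} (ha : 0 < a) (hab : a < b)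
    (hbc : b < c) (h : fSdS n rm L b ≤ fSdS n rm L a) : fSdS n rm L c < fSdS n rm L b := by
  by_contra! hc
  -- The mean value theorem would give a nonpositive slope at `x` and a nonnegative slope at some
  -- later `y`, against strict monotonicity.
  obtain ⟨x, hx, hx'⟩ := exists_fSlope_eq (n := n) (rm := rm) (L := L) ha hab
  obtain ⟨y, hy, hy'⟩ := exists_fSlope_eq (n := n) (rm := rm) (L := L) (ha.trans hab) hbc
  have hx0 : 0 < x := ha.trans hx.1
  have hy0 : 0 < y := (ha.trans hab).trans hy.1
  have h1 : fSlope n rm L x / x ≤ 0 := by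
    rw [hx']; exact div_nonpos_of_nonpos_of_nonneg (by linarith) (by linarith)
  have h2 : 0 ≤ fSlope n rm L y / y := by
    rw [hy']; exact div_nonneg (by linarith) (by linarith)
  have h3 : fSlope n rm L x ≤ 0 := by
    by_contra! h; exact absurd (div_pos h hx0) (by linarith)
  have h4 : 0 ≤ fSlope n rm L y := by
    by_contra! h; exact absurd (div_neg_of_neg_of_pos h hy0) (by linarith)
  have := fSlope_strictAntiOn (n := n) hrm hL (Set.mem_Ioi.2 hx0) (Set.mem_Ioi.2 hy0)
    (hx.2.trans hy.1)
  linarith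

/-- Used with `b` the cosmological horizon and `a` inside the static range: the zero of `f` at the
horizon is simple. -/
theorem fSlope_neg_of_lt (hrm : 0 ≤ rm) (hL : 0 < L) {a b : ℝ} (ha : 0 < a) (hab : a < b)
    (h : fSdS n rm L b < fSdS n rm L a) : fSlope n rm L b < 0 := by
  obtain ⟨x, hx, hx'⟩ := exists_fSlope_eq (n := n) (rm := rm) (L := L) ha hab
  have hx0 : 0 < x := ha.trans hx.1
  have h1 : fSlope n rm L x / x < 0 := by
    rw [hx']; exact div_neg_of_neg_of_pos (by linarith) (by linarith)
  have h3 : fSlope n rm L x < 0 := by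
    by_contra! h; exact absurd (div_nonneg h hx0.le) (by linarith)
  have := fSlope_strictAntiOn (n := n) hrm hL (Set.mem_Ioi.2 hx0) (Set.mem_Ioi.2 (ha.trans hab))
    hx.2
  linarith

theorem fSlope_pos_of_lt (hrm : 0 ≤ rm) (hL : 0 < L) {a b : ℝ} (ha : 0 < a) (hab : a < b)
    (h : fSdS n rm L a < fSdS n rm L b) : 0 < fSlope n rm L a := by
  obtain ⟨x, hx, hx'⟩ := exists_fSlope_eq (n := n) (rm := rm) (L := L) ha hab
  have hx0 : 0 < x := ha.trans hx.1
  have h1 : 0 < fSlope n rm L x / x := by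
    rw [hx']; exact div_pos (by linarith) (by linarith)
  have h3 : 0 < fSlope n rm L x := by
    by_contra! h; exact absurd (div_nonpos_of_nonpos_of_nonneg h hx0.le) (by linarith)
  have := fSlope_strictAntiOn (n := n) hrm hL (Set.mem_Ioi.2 ha) (Set.mem_Ioi.2 hx0)
    hx.1
  linarith

theorem exists_fSdS_eq_zero {a b : ℝ} (ha : 0 < a) (hab : a < b)
    (h : fSdS n rm L a * fSdS n rm L b ≤ 0) : ∃ c ∈ Set.Icc a b, fSdS n rm L c = 0 := by
  have hc : ContinuousOn (fSdS n rm L) (Set.Icc a b) :=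
    fun x hx => (continuousAt_fSdS (lt_of_lt_of_le ha hx.1)).continuousWithinAt
  rcases le_or_gt (fSdS n rm L a) 0 with h1 | h1
  · rcases le_or_gt 0 (fSdS n rm L b) with h2 | h2
    · exact intermediate_value_Icc hab.le hc ⟨h1, h2⟩
    · rcases h1.lt_or_eq with h3 | h3
      · exact absurd (mul_pos_of_neg_of_neg h3 h2) (by linarith)
      · exact ⟨a, ⟨le_rfl, hab.le⟩, h3⟩
  · have h2 : fSdS n rm L b ≤ 0 := by
      by_contra! h2; exact absurd (mul_pos h1 h2) (by linarith)
    exact intermediate_value_Icc' hab.le hc ⟨h2, h1.le⟩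

/-- The static range is bounded by a cosmological horizon `r₂` where `f` has a simple zero, and,
when `r_m > 0`, by a black hole horizon `r₁`. -/
theorem staticRange_eq (hrm : 0 ≤ rm) (hL : 0 < L) (hne : (staticRange n rm L).Nonempty) :
    ∃ r₁ r₂ : ℝ, 0 ≤ r₁ ∧ r₁ < r₂ ∧ fSdS n rm L r₂ = 0 ∧ fSlope n rm L r₂ < 0 ∧
      ((0 < rm ∧ 0 < r₁ ∧ fSdS n rm L r₁ = 0 ∧ 0 < fSlope n rm L r₁ ∧
          staticRange n rm L = Set.Ioo r₁ r₂) ∨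
        (rm = 0 ∧ r₁ = 0 ∧ staticRange n rm L = Set.Ico 0 r₂)) := by
  rcases hrm.lt_or_eq with hpos | h0
  · obtain ⟨ra, hra⟩ := hne
    have hra0 : 0 < ra := lt_of_le_of_ne hra.1 fun h => hpos.ne' (hra.2.1 h.symm)
    have hfra := hra.2.2
    -- Each subtracted term alone makes `f` nonpositive at `rm` and at `L`, so these radii bracket
    -- the static range and the horizons follow from the intermediate value theorem.
    have hM : rm < ra := by
      by_contra! h
      have : 1 ≤ rm ^ (n + 2) / ra ^ (n + 2) := by
        rw [one_le_div (by positivity)]; gcongr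
      have h2 : 0 ≤ ra ^ 2 / L ^ 2 := by positivity
      unfold fSdS at hfra
      linarith
    have hl : ra < L := by
      by_contra! h
      have : 1 ≤ ra ^ 2 / L ^ 2 := by
        rw [one_le_div (by positivity)]; gcongr
      have h2 : 0 ≤ rm ^ (n + 2) / ra ^ (n + 2) := by positivity
      unfold fSdS at hfra
      linarith
    have hfrm : fSdS n rm L rm ≤ 0 := by
      have h1 : rm ^ (n + 2) / rm ^ (n + 2) = 1 := div_self (by positivity)
      have h2 : 0 ≤ rm ^ 2 / L ^ 2 := by positivity
      unfold fSdS; rw [h1]; linarith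
    have hfL : fSdS n rm L L ≤ 0 := by
      have h1 : L ^ 2 / L ^ 2 = 1 := div_self (by positivity)
      have h2 : 0 ≤ rm ^ (n + 2) / L ^ (n + 2) := by positivity
      unfold fSdS; rw [h1]; linarith
    obtain ⟨r₁, h1, hf1⟩ := exists_fSdS_eq_zero (n := n) (L := L) hpos hM
      (mul_nonpos_of_nonpos_of_nonneg hfrm hfra.le)
    obtain ⟨r₂, h2, hf2⟩ := exists_fSdS_eq_zero (n := n) (L := L) hra0 hl
      (mul_nonpos_of_nonneg_of_nonpos hfra.le hfL)
    have h1a : r₁ < ra := lt_of_le_of_ne h1.2 fun h => by rw [h] at hf1; linarith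
    have h2a : ra < r₂ := lt_of_le_of_ne h2.1 fun h => by rw [← h] at hf2; linarith
    have h10 : 0 < r₁ := lt_of_lt_of_le hpos h1.1
    refine ⟨r₁, r₂, h10.le, h1a.trans h2a, hf2, fSlope_neg_of_lt hrm hL hra0 h2a (by linarith),
      Or.inl ⟨hpos, h10, hf1, fSlope_pos_of_lt hrm hL h10 h1a (by linarith), ?_⟩⟩
    ext r
    constructor
    · rintro ⟨hr0, hr1, hr⟩
      have hr0' : 0 < r := lt_of_le_of_ne hr0 fun h => hpos.ne' (hr1 h.symm)
      constructor
      · by_contra! h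
        rcases h.lt_or_eq with h | h
        · have := fSdS_lt_of_le hrm hL hr0' h h1a (by linarith)
          linarith
        · rw [h] at hr; linarith
      · by_contra! h
        rcases h.lt_or_eq with h | h
        · have := fSdS_lt_of_le hrm hL hra0 h2a h (by linarith)
          linarith
        · rw [← h] at hr; linarith
    · rintro ⟨hr1, hr2⟩
      refine ⟨(h10.trans hr1).le, fun h => absurd (h10.trans hr1) (by linarith), ?_⟩
      by_contra! h
      rcases lt_trichotomy r ra with h3 | h3 | h3
      · have := fSdS_lt_of_le hrm hL h10 hr1 h3 (by linarith)
        linarith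
      · rw [h3] at h; linarith
      · have := fSdS_lt_of_le hrm hL hra0 h3 hr2 (by linarith)
        linarith
  · have h0' : rm = 0 := h0.symm
    subst h0'
    have hf : ∀ r, fSdS n 0 L r = 1 - r ^ 2 / L ^ 2 := fun r => by simp [fSdS]
    have hLL : L ^ 2 / L ^ 2 = 1 := div_self (by positivity)
    refine ⟨0, L, le_rfl, hL, by rw [hf, hLL]; ring, by simp [fSlope, hLL],
      Or.inr ⟨rfl, rfl, ?_⟩⟩
    ext r
    simp only [staticRange, Set.mem_ofPred_eq, hf, Set.mem_Ico, sub_pos, implies_true, true_and]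
    refine and_congr_right fun hr => ?_
    rw [div_lt_one (by positivity)]
    exact pow_lt_pow_iff_left₀ hr hL.le two_ne_zero

end

section

/-! ## Conformally flat radial coordinates -/

namespace ConformalRadius

variable (C : ConformalRadius n rm L)

/-- The lapse `√f` as a function of the conformal radius. -/
def lapse (s : ℝ) : ℝ := Real.sqrt (fSdS n rm L (C.R s))

/-- `r f'(r)` as a function of the conformal radius. -/
def slope (s : ℝ) : ℝ := fSlope n rm L (C.R s)

variable {C}

theorem R_mem {s : ℝ} (hs : s ∈ C.J) : C.R s ∈ staticRange n rm L := C.bijOn.mapsTo hs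

theorem f_pos {s : ℝ} (hs : s ∈ C.J) : 0 < fSdS n rm L (C.R s) := (R_mem hs).2.2

theorem lapse_pos {s : ℝ} (hs : s ∈ C.J) : 0 < C.lapse s := Real.sqrt_pos.2 (f_pos hs)

theorem lapse_sq {s : ℝ} (hs : s ∈ C.J) : C.lapse s ^ 2 = fSdS n rm L (C.R s) :=
  Real.sq_sqrt (f_pos hs).le

theorem R_nonneg {s : ℝ} (hs : s ∈ C.J) : 0 ≤ C.R s := (R_mem hs).1

theorem R_pos {s : ℝ} (hs : s ∈ C.J) (h0 : 0 < s) : 0 < C.R s := by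
  have h1 : 0 < C.R s ^ 2 := by
    rw [C.sq_eq s hs]; have := C.h_pos s hs; positivity
  exact lt_of_le_of_ne (R_nonneg hs) fun h => by rw [← h] at h1; simp at h1

theorem h_inv {s : ℝ} (hs : s ∈ C.J) (h0 : 0 < s) : (C.h s)⁻¹ = (C.R s / s) ^ 2 := by
  rw [div_pow, C.sq_eq s hs]; field_simp

theorem continuousOn_R : ContinuousOn C.R C.J := fun s hs => (C.deriv_eq s hs).continuousWithinAt

theorem strictMonoOn_R : StrictMonoOn C.R C.J := by
  refine strictMonoOn_of_deriv_pos C.interval.convex continuousOn_R fun s hs => ?_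
  have hsJ := interior_subset hs
  rw [((C.deriv_eq s hsJ).hasDerivAt (mem_interior_iff_mem_nhds.1 hs)).deriv]
  have := C.h_pos s hsJ
  have := f_pos hsJ
  positivity

/-- The static range is open except possibly at the centre, and `R` is an increasing bijection
between `J` and that range, so only a conformal radius zero can fail to be interior. -/
theorem mem_nhds (hrm : 0 ≤ rm) (hL : 0 < L) {s : ℝ} (hs : s ∈ C.J) (h0 : 0 < s) :
    C.J ∈ 𝓝 s := by
  obtain ⟨r₁, r₂, h1, h12, -, -, h⟩ := staticRange_eq (n := n) hrm hL ⟨_, R_mem hs⟩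
  have hR := R_pos hs h0
  have hsub : Set.Ioo r₁ r₂ ⊆ staticRange n rm L := by
    rcases h with ⟨-, -, -, -, h⟩ | ⟨-, h, h'⟩
    · rw [h]
    · rw [h', h]; exact Set.Ioo_subset_Ico_self
  have hmem : C.R s ∈ Set.Ioo r₁ r₂ := by
    have hm := R_mem hs
    rcases h with ⟨-, -, -, -, h⟩ | ⟨-, h, h'⟩
    · rwa [← h]
    · rw [h'] at hm; rw [h]; exact ⟨hR, hm.2⟩
  obtain ⟨a, ha, ha'⟩ := C.bijOn.surjOn
    (hsub (show (r₁ + C.R s) / 2 ∈ Set.Ioo r₁ r₂ from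
      ⟨by linarith [hmem.1], by linarith [hmem.1, hmem.2]⟩))
  obtain ⟨b, hb, hb'⟩ := C.bijOn.surjOn
    (hsub (show (C.R s + r₂) / 2 ∈ Set.Ioo r₁ r₂ from
      ⟨by linarith [hmem.1, hmem.2], by linarith [hmem.2]⟩))
  have h3 : a < s := (strictMonoOn_R.lt_iff_lt ha hs).1 (by rw [ha']; linarith [hmem.1])
  have h4 : s < b := (strictMonoOn_R.lt_iff_lt hs hb).1 (by rw [hb']; linarith [hmem.2])
  exact Filter.mem_of_superset (Icc_mem_nhds h3 h4) (C.interval.out ha hb)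

/-- Away from the centre `h⁻¹ = (R/s)²`, so `h` can be eliminated and every later derivative is
expressed through `R`, `lapse` and `slope`. -/
theorem hasDerivAt_R (hrm : 0 ≤ rm) (hL : 0 < L) {s : ℝ} (hs : s ∈ C.J) (h0 : 0 < s) :
    HasDerivAt C.R (C.R s * C.lapse s / s) s := by
  have h := (C.deriv_eq s hs).hasDerivAt (mem_nhds hrm hL hs h0)
  have hR := R_pos hs h0
  rw [h_inv hs h0, Real.sqrt_mul (f_pos hs).le, Real.sqrt_sq (by positivity)] at h
  exact h.congr_deriv (by unfold lapse; ring)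

theorem hasDerivAt_f (hrm : 0 ≤ rm) (hL : 0 < L) {s : ℝ} (hs : s ∈ C.J) (h0 : 0 < s) :
    HasDerivAt (fun s => fSdS n rm L (C.R s)) (C.slope s * C.lapse s / s) s := by
  have hR := R_pos hs h0
  refine ((hasDerivAt_fSdS hR).comp s (hasDerivAt_R hrm hL hs h0)).congr_deriv ?_
  unfold slope; field_simp

/-- The factor `√f` produced by `dR/ds` cancels the one from differentiating the root, so no
singularity appears as the lapse tends to zero. -/
theorem hasDerivAt_lapse (hrm : 0 ≤ rm) (hL : 0 < L) {s : ℝ} (hs : s ∈ C.J) (h0 : 0 < s) :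
    HasDerivAt C.lapse (C.slope s / (2 * s)) s := by
  have hv := lapse_pos hs
  refine ((hasDerivAt_f hrm hL hs h0).sqrt (f_pos hs).ne').congr_deriv ?_
  change C.slope s * C.lapse s / s / (2 * C.lapse s) = _
  field_simp

theorem hasDerivAt_h_inv (hrm : 0 ≤ rm) (hL : 0 < L) {s : ℝ} (hs : s ∈ C.J) (h0 : 0 < s) :
    HasDerivAt (fun s => (C.h s)⁻¹) (2 * C.R s ^ 2 * (C.lapse s - 1) / s ^ 3) s := by
  have h1 : HasDerivAt (fun s => (C.R s / s) ^ 2) (2 * C.R s ^ 2 * (C.lapse s - 1) / s ^ 3) s := by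
    refine (((hasDerivAt_R hrm hL hs h0).div (hasDerivAt_id s) h0.ne').pow 2).congr_deriv ?_
    simp only [id, Nat.cast_ofNat, Nat.add_one_sub_one, pow_one, Pi.div_apply]
    field_simp
  refine h1.congr_of_eventuallyEq ?_
  filter_upwards [mem_nhds hrm hL hs h0, lt_mem_nhds h0] with t ht ht0 using h_inv ht ht0

/-- The conformal radius cannot vanish in a black hole space-time. -/
theorem rm_eq_zero (h0 : (0 : ℝ) ∈ C.J) : rm = 0 := by
  have h1 := C.sq_eq 0 h0
  have h2 : C.R 0 = 0 := by simpa using h1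
  exact (R_mem h0).2.1 h2

theorem zero_mem (h : rm = 0) : (0 : ℝ) ∈ C.J := by
  have h1 : (0 : ℝ) ∈ staticRange n rm L :=
    ⟨le_rfl, fun _ => h, by rw [fSdS_zero_right h]; norm_num⟩
  obtain ⟨s, hs, hs'⟩ := C.bijOn.surjOn h1
  have h2 := C.sq_eq s hs
  have h3 := C.h_pos s hs
  rw [hs'] at h2
  have h4 : s = 0 := by
    have h5 : (C.h s)⁻¹ * s ^ 2 = 0 := by rw [← h2]; ring
    simpa [h3.ne'] using h5
  rwa [h4] at hs

/-- At an end of the range of the conformal radius the areal radius tends to a horizon. -/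
theorem exists_horizon (hrm : 0 ≤ rm) (hL : 0 < L) {p : ℝ} (hp : p ∈ closure C.J)
    (hpJ : p ∉ C.J) :
    ∃ r : ℝ, 0 < r ∧ fSdS n rm L r = 0 ∧ Filter.Tendsto C.R (𝓝[C.J] p) (𝓝 r) ∧
      (((∀ s ∈ C.J, s < p) ∧ fSlope n rm L r < 0) ∨
        ((∀ s ∈ C.J, p < s) ∧ 0 < fSlope n rm L r)) := by
  have hJne : C.J.Nonempty := closure_nonempty_iff.1 ⟨p, hp⟩
  obtain ⟨s₀, hs₀⟩ := hJne
  have hne : (staticRange n rm L).Nonempty := ⟨_, R_mem hs₀⟩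
  obtain ⟨r₁, r₂, h1, h12, hf2, hg2, h⟩ := staticRange_eq (n := n) hrm hL hne
  have hsub : Set.Ioo r₁ r₂ ⊆ staticRange n rm L := by
    rcases h with ⟨-, -, -, -, h⟩ | ⟨-, h, h'⟩
    · rw [h]
    · rw [h', h]; exact Set.Ioo_subset_Ico_self
  have hlt : ∀ r ∈ staticRange n rm L, r < r₂ := by
    intro r hr
    rcases h with ⟨-, -, -, -, h⟩ | ⟨-, h, h'⟩
    · rw [h] at hr; exact hr.2
    · rw [h'] at hr; exact hr.2
  rcases lt_or_ge s₀ p with hlow | hhigh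
  · have hall : ∀ s ∈ C.J, s < p := by
      intro s hs
      by_contra! hc
      exact hpJ (C.interval.out hs₀ hs ⟨hlow.le, hc⟩)
    refine ⟨r₂, h1.trans_lt h12, hf2, ?_, Or.inl ⟨hall, hg2⟩⟩
    rw [tendsto_order]
    constructor
    · intro a ha
      obtain ⟨b, hb, hb'⟩ := C.bijOn.surjOn (hsub (show (max a r₁ + r₂) / 2 ∈ Set.Ioo r₁ r₂ from
        ⟨by linarith [le_max_right a r₁], by linarith [max_lt ha h12]⟩))
      filter_upwards [self_mem_nhdsWithin, mem_nhdsWithin_of_mem_nhds (lt_mem_nhds (hall b hb))]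
        with s hs hbs
      have := (strictMonoOn_R.lt_iff_lt hb hs).2 hbs
      have := max_lt ha h12
      have := le_max_left a r₁
      linarith
    · intro a ha
      filter_upwards [self_mem_nhdsWithin] with s hs
      exact (hlt _ (R_mem hs)).trans ha
  · have hlow : p < s₀ := lt_of_le_of_ne hhigh fun h => hpJ (h ▸ hs₀)
    have hall : ∀ s ∈ C.J, p < s := by
      intro s hs
      by_contra! hc
      exact hpJ (C.interval.out hs hs₀ ⟨hc, hlow.le⟩)
    rcases h with ⟨-, h10, hf1, hg1, h⟩ | ⟨h0, -, -⟩
    · refine ⟨r₁, h10, hf1, ?_, Or.inr ⟨hall, hg1⟩⟩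
      rw [tendsto_order]
      constructor
      · intro a ha
        filter_upwards [self_mem_nhdsWithin] with s hs
        have := R_mem hs
        rw [h] at this
        exact ha.trans this.1
      · intro a ha
        obtain ⟨b, hb, hb'⟩ := C.bijOn.surjOn (hsub (show (r₁ + min a r₂) / 2 ∈ Set.Ioo r₁ r₂ from
          ⟨by linarith [lt_min ha h12], by linarith [min_le_right a r₂]⟩))
        filter_upwards [self_mem_nhdsWithin, mem_nhdsWithin_of_mem_nhds (gt_mem_nhds (hall b hb))]
          with s hs hbs
        have := (strictMonoOn_R.lt_iff_lt hs hb).2 hbs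
        have := lt_min ha h12
        have := min_le_left a r₂
        linarith
    -- Without a black hole there is no inner horizon: the centre belongs to `J`, so nothing in the
    -- closure lies below all of `J`.
    · have hp0 : 0 ≤ p := closure_minimal (fun s hs => C.nonneg s hs) isClosed_Ici hp
      exact absurd (hall 0 (zero_mem h0)) (by linarith)

theorem tendsto_f_zero (hrm : 0 ≤ rm) (hL : 0 < L) {p : ℝ} (hp : p ∈ closure C.J)
    (hpJ : p ∉ C.J) :
    Filter.Tendsto (fun s => fSdS n rm L (C.R s)) (𝓝[C.J] p) (𝓝 0) := by
  obtain ⟨r, hr, hf, ht, -⟩ := exists_horizon hrm hL hp hpJ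
  rw [← hf]
  exact (continuousAt_fSdS hr).tendsto.comp ht

/-- The cosmological horizon lies at a finite conformal radius. -/
theorem bddAbove (hrm : 0 ≤ rm) (hL : 0 < L) : BddAbove C.J := by
  rcases C.J.eq_empty_or_nonempty with he | ⟨s₀, hs₀⟩
  · rw [he]; exact bddAbove_empty
  obtain ⟨r₁, r₂, h1, h12, hf2, hg2, h⟩ := staticRange_eq (n := n) hrm hL ⟨_, R_mem hs₀⟩
  have hr2 : 0 < r₂ := h1.trans_lt h12
  have hsub : Set.Ioo r₁ r₂ ⊆ staticRange n rm L := by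
    rcases h with ⟨-, -, -, -, h⟩ | ⟨-, h, h'⟩
    · rw [h]
    · rw [h', h]; exact Set.Ioo_subset_Ico_self
  have hev : ∀ᶠ r in 𝓝[<] r₂, fSlope n rm L r < 0 ∧ r ∈ Set.Ioo r₁ r₂ :=
    ((continuousAt_fSlope hr2).eventually_lt_const hg2 |>.filter_mono nhdsWithin_le_nhds).and
      (Ioo_mem_nhdsLT h12)
  obtain ⟨r, hr, hr'⟩ := hev.exists
  obtain ⟨a, ha, ha'⟩ := C.bijOn.surjOn (hsub hr')
  have hr0 : 0 < r := h1.trans_lt hr'.1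
  have ha0 : 0 < a := by
    rcases (C.nonneg a ha).lt_or_eq with h | h
    · exact h
    · exfalso
      have h2 := C.sq_eq a ha
      rw [ha', ← h] at h2
      have : r ^ 2 = 0 := by simpa using h2
      exact hr0.ne' (by simpa using this)
  set γ := -fSlope n rm L r with hγ
  have hγ0 : 0 < γ := by linarith
  refine ⟨a * Real.exp (2 * C.lapse a / γ), fun b hb => ?_⟩
  rcases le_or_gt b a with hba | hab
  · calc b ≤ a * 1 := by linarith
      _ ≤ _ := by
        gcongr
        exact Real.one_le_exp (by have := lapse_pos ha; positivity)
  have hpos : ∀ s ∈ Set.Icc a b, s ∈ C.J ∧ 0 < s := fun s hs =>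
    ⟨C.interval.out ha hb hs, ha0.trans_le hs.1⟩
  -- Beyond `a` the slope stays below `-γ`, so `lapse + (γ/2) log s` decreases. Positivity of the
  -- lapse then bounds `log s`.
  have hd : ∀ s ∈ Set.Icc a b, HasDerivAt (fun s => C.lapse s + γ / 2 * Real.log s)
      (C.slope s / (2 * s) + γ / 2 * s⁻¹) s := fun s hs =>
    (hasDerivAt_lapse hrm hL (hpos s hs).1 (hpos s hs).2).add
      ((Real.hasDerivAt_log (hpos s hs).2.ne').const_mul _)
  obtain ⟨c, hc, hc'⟩ := exists_hasDerivAt_eq_slope _ _ hab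
    (fun s hs => (hd s hs).continuousAt.continuousWithinAt)
    (fun s hs => hd s ⟨hs.1.le, hs.2.le⟩)
  obtain ⟨hcJ, hc0⟩ := hpos c ⟨hc.1.le, hc.2.le⟩
  have hRc : r < C.R c := by rw [← ha']; exact strictMonoOn_R ha hcJ hc.1
  have hsl : C.slope c < -γ := by
    have := fSlope_strictAntiOn (n := n) hrm hL (Set.mem_Ioi.2 hr0)
      (Set.mem_Ioi.2 (hr0.trans hRc)) hRc
    unfold slope
    linarith
  have hle : C.slope c / (2 * c) + γ / 2 * c⁻¹ ≤ 0 := by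
    have : C.slope c / (2 * c) + γ / 2 * c⁻¹ = (C.slope c + γ) / (2 * c) := by
      field_simp
    rw [this]
    exact div_nonpos_of_nonpos_of_nonneg (by linarith) (by positivity)
  rw [hc', div_le_iff₀ (by linarith), zero_mul] at hle
  have hvb := lapse_pos hb
  have hlog : Real.log b ≤ Real.log a + 2 * C.lapse a / γ := by
    have h3 : γ / 2 * (Real.log b - Real.log a) ≤ C.lapse a := by linarith
    have h4 : Real.log b - Real.log a ≤ 2 * C.lapse a / γ := by
      rw [le_div_iff₀ hγ0]; linarith
    linarith
  calc b = Real.exp (Real.log b) := (Real.exp_log (ha0.trans hab)).symm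
    _ ≤ Real.exp (Real.log a + 2 * C.lapse a / γ) := Real.exp_le_exp.2 hlog
    _ = _ := by rw [Real.exp_add, Real.exp_log ha0]

end ConformalRadius

/-! ### Real analyticity of the areal radius in the conformal radius -/

/-- A real function with a holomorphic extension has a real-analytic local primitive. -/
theorem exists_analytic_primitive {F : ℂ → ℂ} {x : ℝ} (hF : AnalyticAt ℂ F x) :
    ∃ φ : ℝ → ℝ, AnalyticAt ℝ φ x ∧ ∀ᶠ y : ℝ in 𝓝 x, HasDerivAt φ (F y).re y := by
  obtain ⟨ε, hε, hb⟩ := Metric.eventually_nhds_iff_ball.1 hF.eventually_analyticAt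
  obtain ⟨G, hG⟩ := (show DifferentiableOn ℂ F (Metric.ball (x : ℂ) ε) from
    fun y hy => (hb y hy).differentiableAt.differentiableWithinAt).isExactOn_ball
  have hGa : AnalyticAt ℂ G x :=
    (show DifferentiableOn ℂ G (Metric.ball (x : ℂ) ε) from
      fun y hy => (hG y hy).differentiableAt.differentiableWithinAt).analyticAt
        (Metric.ball_mem_nhds _ hε)
  refine ⟨fun y => (G y).re, hGa.re_ofReal, ?_⟩
  have hc : Filter.Tendsto (fun y : ℝ => (y : ℂ)) (𝓝 x) (𝓝 (x : ℂ)) :=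
    Complex.continuous_ofReal.continuousAt
  filter_upwards [hc.eventually (Metric.ball_mem_nhds _ hε)] with y hy
  exact (hG y hy).real_of_complex

/-- `1 / (r √f)` has a real-analytic local primitive. -/
theorem exists_analytic_tortoise {r : ℝ} (hr : 0 < r) (hf : 0 < fSdS n rm L r) :
    ∃ φ : ℝ → ℝ, AnalyticAt ℝ φ r ∧
      ∀ᶠ y in 𝓝 r, HasDerivAt φ (1 / (y * Real.sqrt (fSdS n rm L y))) y := by
  set fc : ℂ → ℂ := fun z => 1 - (rm : ℂ) ^ (n + 2) / z ^ (n + 2) - z ^ 2 / (L : ℂ) ^ 2 with hfc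
  have hfr : ∀ y : ℝ, fc y = ((fSdS n rm L y : ℝ) : ℂ) := fun y => by
    simp [hfc, fSdS]
  have hr' : (r : ℂ) ≠ 0 := by exact_mod_cast hr.ne'
  have hfa : AnalyticAt ℂ fc r := by
    refine (analyticAt_const.sub (analyticAt_const.div (analyticAt_id.pow _)
      (pow_ne_zero _ hr'))).sub ?_
    exact (analyticAt_id.pow 2).div_const
  have hsl : fc r ∈ Complex.slitPlane := by
    rw [hfr]; exact Complex.ofReal_mem_slitPlane.2 hf
  -- The root is continued to the complex domain as `exp (log f / 2)`; this is legitimate because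
  -- `f(r) > 0` lies in the slit plane.
  have hFa : AnalyticAt ℂ (fun z => 1 / (z * Complex.exp (Complex.log (fc z) / 2))) r := by
    refine analyticAt_const.div (analyticAt_id.mul ((hfa.clog hsl).div_const.cexp)) ?_
    exact mul_ne_zero hr' (Complex.exp_ne_zero _)
  obtain ⟨φ, h1, h2⟩ := exists_analytic_primitive hFa
  refine ⟨φ, h1, ?_⟩
  filter_upwards [h2, (continuousAt_fSdS (n := n) (rm := rm) (L := L) hr).eventually_const_lt hf]
    with y hy hfy
  convert hy using 1
  rw [hfr, ← Complex.ofReal_log hfy.le, Real.sqrt_eq_rpow, Real.rpow_def_of_pos hfy]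
  have h3 : ((Real.log (fSdS n rm L y) : ℝ) : ℂ) / 2
    = ((Real.log (fSdS n rm L y) * (1 / 2) : ℝ) : ℂ) := by push_cast; ring
  rw [h3, ← Complex.ofReal_exp, ← Complex.ofReal_mul, ← Complex.ofReal_one, ← Complex.ofReal_div,
    Complex.ofReal_re]

/-- The two defining equations give `d log s = dR / (R √f)`. With `φ` an analytic primitive of the
right side, `φ(R(s)) - log s` is locally constant, and `R` is recovered by the analytic local
inverse of `φ`. -/
theorem ConformalRadius.analyticAt_R {C : ConformalRadius n rm L} (hrm : 0 ≤ rm) (hL : 0 < L)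
    {s : ℝ} (hs : s ∈ C.J) (h0 : 0 < s) : AnalyticAt ℝ C.R s := by
  have hR := R_pos hs h0
  obtain ⟨φ, hφa, hφ⟩ := exists_analytic_tortoise (n := n) (rm := rm) (L := L) hR (f_pos hs)
  have hφ' : deriv φ (C.R s) ≠ 0 := by
    rw [hφ.self_of_nhds.deriv]
    have : 0 < Real.sqrt (fSdS n rm L (C.R s)) := lapse_pos hs
    positivity
  have hcont : ContinuousAt C.R s := (hasDerivAt_R hrm hL hs h0).continuousAt
  have hev : ∀ᶠ t in 𝓝 s, HasDerivAt (fun t => φ (C.R t) - Real.log t) 0 t := by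
    filter_upwards [hcont.eventually hφ, mem_nhds hrm hL hs h0, lt_mem_nhds h0] with t h1 h2 h3
    refine ((h1.comp t (hasDerivAt_R hrm hL h2 h3)).sub
      (Real.hasDerivAt_log h3.ne')).congr_deriv ?_
    have h4 := R_pos h2 h3
    have h5 : 0 < Real.sqrt (fSdS n rm L (C.R t)) := lapse_pos h2
    unfold lapse
    field_simp
    ring
  obtain ⟨ε, hε, hb⟩ := Metric.eventually_nhds_iff_ball.1 hev
  have hconst : ∀ t ∈ Metric.ball s ε, φ (C.R t) - Real.log t = φ (C.R s) - Real.log s :=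
    fun t ht => Metric.isOpen_ball.is_const_of_deriv_eq_zero
      (convex_ball s ε).isPreconnected
      (fun y hy => (hb y hy).differentiableAt.differentiableWithinAt)
      (fun y hy => (hb y hy).deriv) ht (Metric.mem_ball_self hε)
  have hinv := hφa.analyticAt_localInverse hφ'
  set ψ := hφa.hasStrictDerivAt.localInverse _ _ _ hφ' with hψ
  have hleft : ∀ᶠ y in 𝓝 (C.R s), ψ (φ y) = y :=
    HasStrictDerivAt.eventually_left_inverse hφa.hasStrictDerivAt hφ'
  have hla : AnalyticAt ℝ (fun t => Real.log t + (φ (C.R s) - Real.log s)) s :=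
    (analyticAt_log h0).add analyticAt_const
  have hcomp : AnalyticAt ℝ (fun t => ψ (Real.log t + (φ (C.R s) - Real.log s))) s := by
    refine AnalyticAt.fun_comp ?_ hla
    rw [add_sub_cancel]
    exact hinv
  refine hcomp.congr ?_
  filter_upwards [Metric.ball_mem_nhds s hε, hcont.eventually hleft] with t h1 h2
  rw [← hconst t h1, add_sub_cancel, h2]

end

section

/-! ## The extrinsic equation along a one-parameter family -/

theorem analyticAt_sqrt_comp {f : ℝ → ℝ} {x : ℝ} (hf : AnalyticAt ℝ f x) (hx : 0 < f x) :
    AnalyticAt ℝ (fun y => Real.sqrt (f y)) x :=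
  (Real.contDiffAt_sqrt hx.ne').analyticAt.fun_comp hf

theorem analyticAt_fSdS {r : ℝ} (hr : 0 < r) : AnalyticAt ℝ (fSdS n rm L) r := by
  unfold fSdS
  have : r ^ (n + 2) ≠ 0 := by positivity
  exact (analyticAt_const.sub (analyticAt_const.div (analyticAt_id.pow _) this)).sub
    (analyticAt_id.pow 2).div_const

theorem analyticAt_fSlope {r : ℝ} (hr : 0 < r) : AnalyticAt ℝ (fSlope n rm L) r := by
  unfold fSlope
  have : r ^ (n + 2) ≠ 0 := by positivity
  exact (analyticAt_const.mul (analyticAt_const.div (analyticAt_id.pow _) this)).sub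
    (analyticAt_const.mul (analyticAt_id.pow 2).div_const)

/-- The static, non-planar extrinsic equation cannot hold on an interval of areal radii. -/
theorem not_eventually_static (hrm : 0 ≤ rm) (hL : 0 < L) {r₀ : ℝ}
    (hr₀ : r₀ ∈ staticRange n rm L) (h0 : 0 < r₀)
    (h : ∀ᶠ r in 𝓝 r₀, (n + 1) * fSlope n rm L r + 4 * fSdS n rm L r
      - 4 * Real.sqrt (fSdS n rm L r) = 0) : False := by
  obtain ⟨r₁, r₂, h1, h12, hf2, hg2, hS⟩ := staticRange_eq (n := n) hrm hL ⟨_, hr₀⟩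
  have hr2 : 0 < r₂ := h1.trans_lt h12
  have hsub : Set.Ioo r₁ r₂ ⊆ staticRange n rm L := by
    rcases hS with ⟨-, -, -, -, h⟩ | ⟨-, h, h'⟩
    · rw [h]
    · rw [h', h]; exact Set.Ioo_subset_Ico_self
  have hmem : r₀ ∈ Set.Ioo r₁ r₂ := by
    rcases hS with ⟨-, -, -, -, h⟩ | ⟨-, h, h'⟩
    · rwa [← h]
    · rw [h'] at hr₀; rw [h]; exact ⟨h0, hr₀.2⟩
  set G : ℝ → ℝ := fun r => (n + 1) * fSlope n rm L r + 4 * fSdS n rm L r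
      - 4 * Real.sqrt (fSdS n rm L r) with hG
  have han : AnalyticOnNhd ℝ G (Set.Ioo r₁ r₂) := by
    intro r hr
    have hr0 : 0 < r := h1.trans_lt hr.1
    refine ((analyticAt_const.mul (analyticAt_fSlope hr0)).add
      (analyticAt_const.mul (analyticAt_fSdS hr0))).sub (analyticAt_const.mul ?_)
    exact analyticAt_sqrt_comp (analyticAt_fSdS hr0) (hsub hr).2.2
  have hz := han.eqOn_zero_of_preconnected_of_eventuallyEq_zero isPreconnected_Ioo hmem h
  have hc : ContinuousAt G r₂ := by
    have h3 := continuousAt_fSdS (n := n) (rm := rm) (L := L) hr2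
    exact ((continuousAt_const.mul (continuousAt_fSlope hr2)).add (continuousAt_const.mul h3)).sub
      (continuousAt_const.mul h3.sqrt)
  have ht : Filter.Tendsto G (𝓝[<] r₂) (𝓝 0) := by
    refine tendsto_const_nhds.congr' ?_
    filter_upwards [Ioo_mem_nhdsLT h12] with r hr using (hz hr).symm
  -- Analyticity of `√f` fails at `r₂`, but continuity suffices: the terms in `f` and `√f` vanish
  -- there and only `(n+1) g(r₂) < 0` remains.
  have h4 := tendsto_nhds_unique (hc.tendsto.mono_left nhdsWithin_le_nhds) ht
  simp only [hG, hf2, Real.sqrt_zero] at h4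
  have : ((n : ℝ) + 1) * fSlope n rm L r₂ < 0 := mul_neg_of_pos_of_neg (by positivity) hg2
  linarith

/-! ### The scalar form of the extrinsic equation and its limit at a horizon -/

/-- The extrinsic equation in terms of the logarithmic slope `g`, the lapse `v`, the square `T` of
the spatial velocity, the support function `Q` and the normal acceleration `B`. -/
def bfExpr (n g v T Q B : ℝ) : ℝ :=
  Q * ((g + 4 * v ^ 2 - 4 * v) * (v ^ 2 - T) + n * (g * v ^ 2 - 2 * T * (v ^ 2 - v)))
    + 2 * n * B * v

namespace ConformalRadius

variable (C : ConformalRadius n rm L)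

/-- The extrinsic equation at conformal radius `s`, for Euclidean speed squared `P`, support
function `Q` and Euclidean normal acceleration `A`. -/
def bf (s P Q A : ℝ) : ℝ :=
  bfExpr n (C.slope s) (C.lapse s) (P * C.R s ^ 2 / s ^ 2) Q (A * C.R s ^ 2)

variable {C}

theorem analyticAt_lapse (hrm : 0 ≤ rm) (hL : 0 < L) {s : ℝ} (hs : s ∈ C.J) (h0 : 0 < s) :
    AnalyticAt ℝ C.lapse s :=
  analyticAt_sqrt_comp ((analyticAt_fSdS (R_pos hs h0)).fun_comp (analyticAt_R hrm hL hs h0))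
    (f_pos hs)

theorem analyticAt_slope (hrm : 0 ≤ rm) (hL : 0 < L) {s : ℝ} (hs : s ∈ C.J) (h0 : 0 < s) :
    AnalyticAt ℝ C.slope s :=
  (analyticAt_fSlope (R_pos hs h0)).fun_comp (analyticAt_R hrm hL hs h0)

theorem analyticAt_bf (hrm : 0 ≤ rm) (hL : 0 < L) {q P Q A : ℝ → ℝ} {u : ℝ}
    (hq : AnalyticAt ℝ q u) (hP : AnalyticAt ℝ P u) (hQ : AnalyticAt ℝ Q u)
    (hA : AnalyticAt ℝ A u) (hs : q u ∈ C.J) (h0 : 0 < q u) :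
    AnalyticAt ℝ (fun u => C.bf (q u) (P u) (Q u) (A u)) u := by
  have hv := (analyticAt_lapse hrm hL hs h0).fun_comp hq
  have hg := (analyticAt_slope hrm hL hs h0).fun_comp hq
  have hR := (analyticAt_R hrm hL hs h0).fun_comp hq
  have h2 : q u ^ 2 ≠ 0 := by positivity
  have hT := (hP.mul (hR.pow 2)).div (hq.pow 2) h2
  have hB := hA.mul (hR.pow 2)
  unfold bf bfExpr
  exact (hQ.mul ((((hg.add (analyticAt_const.mul (hv.pow 2))).sub (analyticAt_const.mul hv)).mul
    ((hv.pow 2).sub hT)).add (analyticAt_const.mul ((hg.mul (hv.pow 2)).sub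
      ((analyticAt_const.mul hT).mul ((hv.pow 2).sub hv)))))).add
        ((analyticAt_const.mul hB).mul hv)

/-- At a horizon the extrinsic equation degenerates to `Q P = 0`. -/
theorem mul_eq_zero_of_horizon (hrm : 0 ≤ rm) (hL : 0 < L) {q P Q A : ℝ → ℝ} {u : ℝ}
    (hq : ContinuousAt q u) (hP : ContinuousAt P u) (hQ : ContinuousAt Q u)
    (hA : ContinuousAt A u) (h0 : 0 < q u) (hJ : q u ∉ C.J) {l : Filter ℝ} [l.NeBot]
    (hl : l ≤ 𝓝 u) (hlJ : ∀ᶠ u in l, q u ∈ C.J)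
    (hl0 : ∀ᶠ u in l, C.bf (q u) (P u) (Q u) (A u) = 0) :
    Q u * P u = 0 ∧ ∃ r : ℝ, 0 < r ∧ Filter.Tendsto (fun u => C.lapse (q u)) l (𝓝 0) ∧
      Filter.Tendsto (fun u => C.R (q u)) l (𝓝 r) := by
  have hqt : Filter.Tendsto q l (𝓝[C.J] (q u)) :=
    tendsto_nhdsWithin_iff.2 ⟨hq.tendsto.mono_left hl, hlJ⟩
  have hcl : q u ∈ closure C.J := by
    rw [mem_closure_iff_nhdsWithin_neBot]
    exact hqt.neBot
  obtain ⟨r, hr, hfr, ht, hg⟩ := exists_horizon hrm hL hcl hJ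
  have hg0 : fSlope n rm L r ≠ 0 := by rcases hg with h | h; exacts [h.2.ne, h.2.ne']
  have hR := ht.comp hqt
  have hv : Filter.Tendsto (fun u => C.lapse (q u)) l (𝓝 0) := by
    have h := ((continuousAt_fSdS (n := n) (rm := rm) (L := L) hr).sqrt).tendsto.comp hR
    rwa [hfr, Real.sqrt_zero] at h
  have hs : Filter.Tendsto (fun u => C.slope (q u)) l (𝓝 (fSlope n rm L r)) :=
    (continuousAt_fSlope (n := n) (rm := rm) (L := L) hr).tendsto.comp hR
  have hT := ((hP.tendsto.mono_left hl).mul (hR.pow 2)).div ((hq.tendsto.mono_left hl).pow 2)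
    (by positivity)
  have hB := (hA.tendsto.mono_left hl).mul (hR.pow 2)
  have hQ' := hQ.tendsto.mono_left hl
  have hlim := (hQ'.mul ((((hs.add ((hv.pow 2).const_mul 4)).sub (hv.const_mul 4)).mul
    ((hv.pow 2).sub hT)).add (((hs.mul (hv.pow 2)).sub
      ((hT.const_mul 2).mul ((hv.pow 2).sub hv))).const_mul (n : ℝ)))).add
        ((hB.const_mul (2 * (n : ℝ))).mul hv)
  have h00 : Filter.Tendsto (fun u => C.bf (q u) (P u) (Q u) (A u)) l (𝓝 0) :=
    tendsto_const_nhds.congr' (hl0.mono fun _ h => h.symm)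
  have huniq := tendsto_nhds_unique h00 hlim
  refine ⟨?_, r, hr, hv, hR⟩
  -- With `v = 0` only `-Q g T` survives in `bfExpr`, and the horizon value of `g` is nonzero.
  have h3 : Q u * P u * (fSlope n rm L r * r ^ 2 / q u ^ 2) = 0 := by
    linear_combination huniq
  exact (mul_eq_zero.1 h3).resolve_right (by positivity)

/-- Since `J` is bounded and `q` is unbounded, the curve must leave. Positivity of `q` keeps it away
from the centre, so the set of exit parameters is closed and has a first element. -/
theorem exists_exit (hrm : 0 ≤ rm) (hL : 0 < L) {q : ℝ → ℝ} (hq : Continuous q)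
    (hq0 : ∀ u, 0 < q u) (htop : Filter.Tendsto q Filter.atTop Filter.atTop) {u₀ : ℝ}
    (hu₀ : q u₀ ∈ C.J) : ∃ u₂, u₀ < u₂ ∧ (∀ u ∈ Set.Ico u₀ u₂, q u ∈ C.J) ∧ q u₂ ∉ C.J := by
  obtain ⟨b, hb⟩ := bddAbove (C := C) hrm hL
  set E : Set ℝ := Set.Ici u₀ ∩ q ⁻¹' (C.Jᶜ) with hE
  have hclosed : IsClosed E := by
    have hop : IsOpen (q ⁻¹' C.J) := isOpen_iff_mem_nhds.2 fun u hu =>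
      hq.continuousAt.preimage_mem_nhds (mem_nhds hrm hL hu (hq0 u))
    exact isClosed_Ici.inter hop.isClosed_compl
  have hne : E.Nonempty := by
    obtain ⟨u, hu1, hu2⟩ := ((htop.eventually_gt_atTop b).and
      (Filter.eventually_ge_atTop u₀)).exists
    exact ⟨u, hu2, fun h => absurd (hb h) (by simpa using hu1)⟩
  have hbb : BddBelow E := ⟨u₀, fun u hu => hu.1⟩
  have hmem := hclosed.csInf_mem hne hbb
  refine ⟨sInf E, lt_of_le_of_ne hmem.1 fun h => hmem.2 (h ▸ hu₀), fun u hu => ?_, hmem.2⟩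
  by_contra hc
  exact absurd (csInf_le hbb ⟨hu.1, hc⟩) (by simpa using hu.2)

/-- Analytic continuation of the extrinsic equation up to the first horizon on the right. -/
theorem exists_exit_bf (hrm : 0 ≤ rm) (hL : 0 < L) {q P Q A : ℝ → ℝ}
    (hq : ∀ u, AnalyticAt ℝ q u) (hP : ∀ u, AnalyticAt ℝ P u) (hQ : ∀ u, AnalyticAt ℝ Q u)
    (hA : ∀ u, AnalyticAt ℝ A u) (hq0 : ∀ u, 0 < q u)
    (htop : Filter.Tendsto q Filter.atTop Filter.atTop) {u₀ : ℝ} (hu₀ : q u₀ ∈ C.J)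
    (h : ∀ᶠ u in 𝓝 u₀, C.bf (q u) (P u) (Q u) (A u) = 0) :
    ∃ u₂, u₀ < u₂ ∧ (∀ u ∈ Set.Ico u₀ u₂, q u ∈ C.J ∧ C.bf (q u) (P u) (Q u) (A u) = 0) ∧
      q u₂ ∉ C.J ∧ Q u₂ * P u₂ = 0 ∧ q u₂ ∈ closure C.J ∧
      ∃ r : ℝ, 0 < r ∧ Filter.Tendsto (fun u => C.lapse (q u)) (𝓝[<] u₂) (𝓝 0) ∧
        Filter.Tendsto (fun u => C.R (q u)) (𝓝[<] u₂) (𝓝 r) := by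
  have hqc : Continuous q := continuous_iff_continuousAt.2 fun u => (hq u).continuousAt
  obtain ⟨u₂, h02, hJ, hu₂⟩ := exists_exit hrm hL hqc hq0 htop hu₀
  have han : AnalyticOnNhd ℝ (fun u => C.bf (q u) (P u) (Q u) (A u)) (Set.Ico u₀ u₂) :=
    fun u hu => analyticAt_bf hrm hL (hq u) (hP u) (hQ u) (hA u) (hJ u hu) (hq0 u)
  have hz := han.eqOn_zero_of_preconnected_of_eventuallyEq_zero isPreconnected_Ico
    (Set.left_mem_Ico.2 h02) h
  have hlJ : ∀ᶠ u in 𝓝[<] u₂, q u ∈ C.J := by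
    filter_upwards [Ioo_mem_nhdsLT h02] with u hu using hJ u (Set.Ioo_subset_Ico_self hu)
  have hl0 : ∀ᶠ u in 𝓝[<] u₂, C.bf (q u) (P u) (Q u) (A u) = 0 := by
    filter_upwards [Ioo_mem_nhdsLT h02] with u hu using hz (Set.Ioo_subset_Ico_self hu)
  obtain ⟨h1, h2⟩ := mul_eq_zero_of_horizon hrm hL (hq u₂).continuousAt (hP u₂).continuousAt
    (hQ u₂).continuousAt (hA u₂).continuousAt (hq0 u₂) hu₂ nhdsWithin_le_nhds hlJ hl0
  have hcl : q u₂ ∈ closure C.J := by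
    have h4 : Filter.Tendsto q (𝓝[<] u₂) (𝓝 (q u₂)) :=
      (hq u₂).continuousAt.tendsto.mono_left nhdsWithin_le_nhds
    exact mem_closure_of_tendsto h4 hlJ
  exact ⟨u₂, h02, fun u hu => ⟨hJ u hu, hz hu⟩, hu₂, h1, hcl, h2⟩

/-- A rotating plane that misses the origin does not solve the extrinsic equation. -/
theorem not_eventually_plane (hrm : 0 ≤ rm) (hL : 0 < L) {z Ω : ℝ} (hz : z ≠ 0) (hΩ : Ω ≠ 0)
    {p₀ : ℝ} (hp₀ : 0 < p₀) (hJ : Real.sqrt (p₀ ^ 2 + z ^ 2) ∈ C.J)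
    (h : ∀ᶠ p in 𝓝 p₀, C.bf (Real.sqrt (p ^ 2 + z ^ 2)) (Ω ^ 2 * p ^ 2) z 0 = 0) : False := by
  have hpos : ∀ p : ℝ, 0 < p ^ 2 + z ^ 2 := fun p => by positivity
  have htop : Filter.Tendsto (fun p : ℝ => Real.sqrt (p ^ 2 + z ^ 2)) Filter.atTop
      Filter.atTop := by
    refine Filter.tendsto_atTop_mono (fun p => ?_) Filter.tendsto_id
    exact Real.le_sqrt_of_sq_le (by simp only [id]; nlinarith [sq_nonneg z])
  -- At the exit the horizon condition would read `z Ω² p₂² = 0`, while all three factors are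
  -- nonzero.
  obtain ⟨p₂, h1, -, -, h2, -⟩ := exists_exit_bf (C := C) hrm hL
    (q := fun p => Real.sqrt (p ^ 2 + z ^ 2)) (P := fun p => Ω ^ 2 * p ^ 2) (Q := fun _ => z)
    (A := fun _ => 0)
    (fun p => analyticAt_sqrt_comp ((analyticAt_id.pow 2).add analyticAt_const) (hpos p))
    (fun p => analyticAt_const.mul (analyticAt_id.pow 2)) (fun _ => analyticAt_const)
    (fun _ => analyticAt_const) (fun p => Real.sqrt_pos.2 (hpos p)) htop hJ h
  have hp2 : 0 < p₂ := hp₀.trans h1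
  exact absurd h2 (by positivity)

end ConformalRadius

end

section

/-! ## Catenoids -/

/-- Squared distance to the origin on a catenoid of neck radius `c`, shifted by `z` along its
axis. -/
def catS (c z u : ℝ) : ℝ := c ^ 2 * Real.cosh u ^ 2 + (z + c * u) ^ 2

/-- Half the derivative of `catS`. -/
def catSlope (c z u : ℝ) : ℝ := c ^ 2 * (Real.sinh u * Real.cosh u) + c * (z + c * u)

/-- Support function of the catenoid. -/
def catQ (c z u : ℝ) : ℝ := (z + c * u) * (Real.sinh u / Real.cosh u) - c

theorem catS_pos {c : ℝ} (hc : 0 < c) (z u : ℝ) : 0 < catS c z u := by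
  have := Real.cosh_pos u
  unfold catS; positivity

theorem hasDerivAt_catS (c z u : ℝ) : HasDerivAt (catS c z) (2 * catSlope c z u) u := by
  have h1 := ((Real.hasDerivAt_cosh u).pow 2).const_mul (c ^ 2)
  have h2 := (((hasDerivAt_id u).const_mul c).const_add z).pow 2
  refine (h1.add h2).congr_deriv ?_
  simp only [catSlope, id, Nat.cast_ofNat, Nat.add_one_sub_one, pow_one]
  ring

theorem hasDerivAt_catSlope (c z u : ℝ) : HasDerivAt (catSlope c z)
    (c ^ 2 * (Real.cosh u ^ 2 + Real.sinh u ^ 2) + c ^ 2) u := by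
  have h1 := ((Real.hasDerivAt_sinh u).mul (Real.hasDerivAt_cosh u)).const_mul (c ^ 2)
  have h2 := (((hasDerivAt_id u).const_mul c).const_add z).const_mul c
  refine (h1.add h2).congr_deriv ?_
  ring

/-- Along the profile, support function and squared distance have the same critical points. Rolle's
theorem for `catQ` therefore locates the point closest to the origin. -/
theorem hasDerivAt_catQ {c : ℝ} (hc : 0 < c) (z u : ℝ) : HasDerivAt (catQ c z)
    (catSlope c z u / (c * Real.cosh u ^ 2)) u := by
  have hch := Real.cosh_pos u
  have h1 := (Real.hasDerivAt_sinh u).div (Real.hasDerivAt_cosh u) hch.ne'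
  have h2 := ((hasDerivAt_id u).const_mul c).const_add z
  refine ((h2.mul h1).sub_const c).congr_deriv ?_
  simp only [catSlope, id, Pi.div_apply]
  field_simp
  linear_combination (z + c * u) * Real.cosh_sq u

/-- The squared distance to the origin is strictly convex in `u`, so the closest point of the
profile is unique. -/
theorem strictMono_catSlope {c : ℝ} (hc : 0 < c) (z : ℝ) : StrictMono (catSlope c z) :=
  strictMono_of_deriv_pos fun u => by
    rw [(hasDerivAt_catSlope c z u).deriv]
    have := Real.cosh_pos u
    positivity

theorem catS_lt_right {c z m u : ℝ} (hc : 0 < c) (hm : catSlope c z m = 0) (h : m < u) :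
    catS c z m < catS c z u := by
  obtain ⟨x, hx, hx'⟩ := exists_hasDerivAt_eq_slope (catS c z) (fun u => 2 * catSlope c z u) h
    (fun x _ => (hasDerivAt_catS c z x).continuousAt.continuousWithinAt)
    (fun x _ => hasDerivAt_catS c z x)
  have h1 : 0 < catSlope c z x := hm ▸ strictMono_catSlope hc z hx.1
  rw [eq_div_iff (by linarith)] at hx'
  have : 0 < 2 * catSlope c z x * (u - m) := mul_pos (by linarith) (by linarith)
  linarith

theorem catS_neg (c z u : ℝ) : catS c z (-u) = catS c (-z) u := by
  unfold catS; rw [Real.cosh_neg]; ring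

theorem catQ_neg (c z u : ℝ) : catQ c z (-u) = catQ c (-z) u := by
  unfold catQ; rw [Real.cosh_neg, Real.sinh_neg]; ring

theorem catSlope_neg (c z u : ℝ) : catSlope c z (-u) = -catSlope c (-z) u := by
  unfold catSlope; rw [Real.cosh_neg, Real.sinh_neg]; ring

theorem lt_cosh {x : ℝ} (hx : 0 < x) : x < Real.cosh x :=
  (Real.self_lt_sinh_iff.2 hx).trans (Real.sinh_lt_cosh x)

/-- Where the support function vanishes and the distance increases, the parameter is positive. -/
theorem pos_of_catQ_eq_zero {c z u : ℝ} (hc : 0 < c) (hQ : catQ c z u = 0)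
    (hs : 0 < catSlope c z u) :
    0 < u ∧ z + c * u = c * Real.cosh u / Real.sinh u ∧
      catS c z u = (c * (Real.cosh u ^ 2 / Real.sinh u)) ^ 2 := by
  have hch := Real.cosh_pos u
  have h1 : (z + c * u) * Real.sinh u = c * Real.cosh u := by
    unfold catQ at hQ
    have : (z + c * u) * (Real.sinh u / Real.cosh u) = c := by linarith
    field_simp at this
    linarith
  have hsh : Real.sinh u ≠ 0 := fun h => by
    rw [h] at h1
    have : 0 < c * Real.cosh u := by positivity
    linarith
  have h2 : z + c * u = c * Real.cosh u / Real.sinh u := by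
    rw [eq_div_iff hsh]; exact h1
  have h3 : catSlope c z u = c ^ 2 * Real.cosh u ^ 3 / Real.sinh u := by
    unfold catSlope
    rw [h2]
    field_simp
    linear_combination - Real.cosh_sq u
  have h4 : 0 < Real.sinh u := by
    by_contra! h
    have : c ^ 2 * Real.cosh u ^ 3 / Real.sinh u ≤ 0 :=
      div_nonpos_of_nonneg_of_nonpos (by positivity) h
    linarith
  refine ⟨Real.sinh_pos_iff.1 h4, h2, ?_⟩
  unfold catS
  rw [h2]
  field_simp
  linear_combination - Real.cosh_sq u

/-- A catenoid which meets a sphere around the origin orthogonally in two circles is centred. -/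
theorem shift_eq_zero {c z u w : ℝ} (hc : 0 < c) (hQu : catQ c z u = 0)
    (hsu : 0 < catSlope c z u) (hQw : catQ c z (-w) = 0) (hsw : catSlope c z (-w) < 0)
    (hS : catS c z u = catS c z (-w)) : z = 0 ∧ u = w := by
  rw [catQ_neg] at hQw
  rw [catSlope_neg] at hsw
  rw [catS_neg] at hS
  obtain ⟨hu, hzu, hSu⟩ := pos_of_catQ_eq_zero hc hQu hsu
  obtain ⟨hw, hzw, hSw⟩ := pos_of_catQ_eq_zero hc hQw (by linarith)
  have hshu := Real.sinh_pos_iff.2 hu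
  have hshw := Real.sinh_pos_iff.2 hw
  have hchu := Real.cosh_pos u
  have hchw := Real.cosh_pos w
  rw [hSu, hSw] at hS
  have h1 : c * (Real.cosh u ^ 2 / Real.sinh u) = c * (Real.cosh w ^ 2 / Real.sinh w) :=
    (pow_left_inj₀ (by positivity) (by positivity) two_ne_zero).1 hS
  have h2 : Real.cosh u ^ 2 / Real.sinh u = Real.cosh w ^ 2 / Real.sinh w :=
    mul_left_cancel₀ hc.ne' h1
  rw [div_eq_div_iff hshu.ne' hshw.ne', Real.cosh_sq, Real.cosh_sq] at h2
  -- The radius at an orthogonal intersection is `c (sinh + 1/sinh)`, which takes equal values only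
  -- at equal or reciprocal values of `sinh`.
  have h3 : (Real.sinh u - Real.sinh w) * (Real.sinh u * Real.sinh w - 1) = 0 := by
    linear_combination h2
  rcases mul_eq_zero.1 h3 with h4 | h4
  · have huw : u = w := Real.sinh_injective (by linarith)
    refine ⟨?_, huw⟩
    rw [← huw] at hzw
    linarith
  -- If `sinh u * sinh w = 1`, then `coth u = cosh w` and `coth w = cosh u`. Adding the two height
  -- relations eliminates `z` and yields `u + w = cosh u + cosh w`, against `x < cosh x`.
  · exfalso
    have hsum : c * (u + w) = c * (Real.cosh u / Real.sinh u + Real.cosh w / Real.sinh w) := by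
      linear_combination hzu + hzw
    have hsum' := mul_left_cancel₀ hc.ne' hsum
    have h5 : Real.cosh u / Real.sinh u = Real.cosh w := by
      refine (pow_left_inj₀ (by positivity) hchw.le two_ne_zero).1 ?_
      rw [div_pow, div_eq_iff (by positivity), Real.cosh_sq, Real.cosh_sq]
      linear_combination (-Real.sinh u * Real.sinh w - 1) * h4
    have h6 : Real.cosh w / Real.sinh w = Real.cosh u := by
      refine (pow_left_inj₀ (by positivity) hchu.le two_ne_zero).1 ?_
      rw [div_pow, div_eq_iff (by positivity), Real.cosh_sq, Real.cosh_sq]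
      linear_combination (-Real.sinh u * Real.sinh w - 1) * h4
    rw [h5, h6] at hsum'
    have := lt_cosh hu
    have := lt_cosh hw
    linarith

namespace ConformalRadius

variable {C : ConformalRadius n rm L}

theorem catS_tendsto {c : ℝ} (hc : 0 < c) (z : ℝ) :
    Filter.Tendsto (fun u => Real.sqrt (catS c z u)) Filter.atTop Filter.atTop := by
  refine Filter.tendsto_atTop_mono (f := fun u => c * u) (fun u => ?_)
    (Filter.tendsto_id.const_mul_atTop hc)
  refine Real.le_sqrt_of_sq_le ?_
  rcases le_or_gt 0 u with hu | hu
  · have h1 : u ≤ Real.cosh u := (Real.self_le_sinh_iff.2 hu).trans (Real.sinh_lt_cosh u).le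
    have h2 : u ^ 2 ≤ Real.cosh u ^ 2 := by gcongr
    unfold catS
    nlinarith [sq_nonneg (z + c * u), mul_le_mul_of_nonneg_left h2 (sq_nonneg c)]
  · have h1 : -u < Real.cosh u := by
      have := lt_cosh (x := -u) (by linarith)
      rwa [Real.cosh_neg] at this
    have h2 : (-u) ^ 2 ≤ Real.cosh u ^ 2 := by
      have : 0 ≤ -u := by linarith
      gcongr
    unfold catS
    nlinarith [sq_nonneg (z + c * u), mul_le_mul_of_nonneg_left h2 (sq_nonneg c)]

theorem analyticAt_catS (c z u : ℝ) : AnalyticAt ℝ (catS c z) u :=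
  (analyticAt_const.mul (Real.analyticAt_cosh.pow 2)).add
    ((analyticAt_const.add (analyticAt_const.mul analyticAt_id)).pow 2)

theorem analyticAt_catQ (c z u : ℝ) : AnalyticAt ℝ (catQ c z) u :=
  ((analyticAt_const.add (analyticAt_const.mul analyticAt_id)).mul
    (Real.analyticAt_sinh.div Real.analyticAt_cosh (Real.cosh_pos u).ne')).sub analyticAt_const

/-- The extrinsic equation on a rotating catenoid. -/
def catEq (C : ConformalRadius n rm L) (c z Ω u : ℝ) : ℝ :=
  C.bf (Real.sqrt (catS c z u)) (Ω ^ 2 * (c ^ 2 * Real.cosh u ^ 2)) (catQ c z u) (Ω ^ 2 * c)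

/-- A rotating catenoid never meets its axis, so `P > 0` and the horizon condition leaves only `Q =
0`: the profile meets the horizon sphere orthogonally. -/
theorem exists_exit_cat (hrm : 0 ≤ rm) (hL : 0 < L) {c z Ω : ℝ} (hc : 0 < c) (hΩ : Ω ≠ 0)
    {u₀ : ℝ} (hJ : Real.sqrt (catS c z u₀) ∈ C.J) (h : ∀ᶠ u in 𝓝 u₀, catEq C c z Ω u = 0) :
    ∃ u₂, u₀ < u₂ ∧ (∀ u ∈ Set.Ico u₀ u₂, Real.sqrt (catS c z u) ∈ C.J ∧ catEq C c z Ω u = 0) ∧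
      Real.sqrt (catS c z u₂) ∉ C.J ∧ catQ c z u₂ = 0 ∧ Real.sqrt (catS c z u₂) ∈ closure C.J ∧
      ∃ r : ℝ, 0 < r ∧
        Filter.Tendsto (fun u => C.lapse (Real.sqrt (catS c z u))) (𝓝[<] u₂) (𝓝 0) ∧
        Filter.Tendsto (fun u => C.R (Real.sqrt (catS c z u))) (𝓝[<] u₂) (𝓝 r) := by
  obtain ⟨u₂, h1, h2, h3, h4, h5, h6⟩ := exists_exit_bf (C := C) hrm hL
    (q := fun u => Real.sqrt (catS c z u)) (P := fun u => Ω ^ 2 * (c ^ 2 * Real.cosh u ^ 2))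
    (Q := catQ c z) (A := fun _ => Ω ^ 2 * c)
    (fun u => analyticAt_sqrt_comp (analyticAt_catS c z u) (catS_pos hc z u))
    (fun u => analyticAt_const.mul (analyticAt_const.mul (Real.analyticAt_cosh.pow 2)))
    (analyticAt_catQ c z) (fun _ => analyticAt_const)
    (fun u => Real.sqrt_pos.2 (catS_pos hc z u)) (catS_tendsto hc z) hJ h
  refine ⟨u₂, h1, h2, h3, (mul_eq_zero.1 h4).resolve_right ?_, h5, h6⟩
  have := Real.cosh_pos u₂
  positivity

theorem catEq_neg (C : ConformalRadius n rm L) (c z Ω u : ℝ) :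
    catEq C c z Ω (-u) = catEq C c (-z) Ω u := by
  unfold catEq; rw [catS_neg, catQ_neg, Real.cosh_neg]

/-- A catenoid that solves the extrinsic equation is centred at the origin, and the equation
persists up to the cosmological horizon. -/
theorem cat_centred (hrm : 0 ≤ rm) (hL : 0 < L) {c z Ω : ℝ} (hc : 0 < c) (hΩ : Ω ≠ 0)
    {u₀ : ℝ} (hJ : Real.sqrt (catS c z u₀) ∈ C.J) (h : ∀ᶠ u in 𝓝 u₀, catEq C c z Ω u = 0) :
    z = 0 ∧ ∃ u₂, |u₀| < u₂ ∧
      (∀ u ∈ Set.Ico |u₀| u₂, Real.sqrt (catS c z u) ∈ C.J ∧ catEq C c z Ω u = 0) ∧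
      catQ c z u₂ = 0 ∧ ∃ r : ℝ, 0 < r ∧
        Filter.Tendsto (fun u => C.lapse (Real.sqrt (catS c z u))) (𝓝[<] u₂) (𝓝 0) ∧
        Filter.Tendsto (fun u => C.R (Real.sqrt (catS c z u))) (𝓝[<] u₂) (𝓝 r) := by
  obtain ⟨u₂, h02, hI2, hJ2, hQ2, hcl2, hlim⟩ := exists_exit_cat hrm hL hc hΩ hJ h
  have hneg : ∀ᶠ u in 𝓝 (-u₀), catEq C c (-z) Ω u = 0 := by
    have : Filter.Tendsto (fun u : ℝ => -u) (𝓝 (-u₀)) (𝓝 u₀) := by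
      simpa using (continuous_neg.tendsto (-u₀))
    filter_upwards [this.eventually h] with u hu
    rwa [catEq_neg] at hu
  -- The reflection `u ↦ -u`, `z ↦ -z` turns the continuation to the left into one to the right.
  obtain ⟨w, h01, hI1, hJ1, hQ1, hcl1, -⟩ := exists_exit_cat (C := C) hrm hL hc hΩ (u₀ := -u₀)
    (z := -z) (by rw [← catS_neg, neg_neg]; exact hJ) hneg
  rw [← catS_neg] at hJ1 hcl1
  rw [← catQ_neg] at hQ1
  have hall : ∀ u ∈ Set.Ioo (-w) u₂, Real.sqrt (catS c z u) ∈ C.J ∧ catEq C c z Ω u = 0 := by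
    intro u hu
    rcases le_or_gt u₀ u with h1 | h1
    · exact hI2 u ⟨h1, hu.2⟩
    · have := hI1 (-u) ⟨by linarith, by linarith [hu.1]⟩
      rwa [← catS_neg, ← catEq_neg, neg_neg] at this
  -- `catQ` vanishes at both exits; the critical point in between is the closest point, and both
  -- exits lie strictly farther out.
  obtain ⟨m, hm, hm'⟩ := exists_hasDerivAt_eq_zero (f := catQ c z) (show -w < u₂ by linarith)
    (fun u _ => (hasDerivAt_catQ hc z u).continuousAt.continuousWithinAt) (by rw [hQ1, hQ2])
    (fun u _ => hasDerivAt_catQ hc z u)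
  have hσm : catSlope c z m = 0 := by
    have := Real.cosh_pos m
    rcases div_eq_zero_iff.1 hm' with h | h
    · exact h
    · exact absurd h (by positivity)
  have hS2 : catS c z m < catS c z u₂ := catS_lt_right hc hσm hm.2
  have hS1 : catS c z m < catS c z (-w) := by
    rw [catS_neg]
    have := catS_lt_right (c := c) (z := -z) (m := -m) (u := w) hc
      (by rw [← neg_eq_zero, ← catSlope_neg, neg_neg, hσm]) (by linarith [hm.1])
    rwa [← catS_neg, neg_neg] at this
  have hmJ := (hall m hm).1
  -- As `J` is an interval containing the radius at `m`, an exit at a larger radius bounds `J` from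
  -- above. Both exit radii are also in the closure of `J`, so both equal its supremum.
  have hub : ∀ x, Real.sqrt (catS c z x) ∉ C.J → catS c z m < catS c z x →
      ∀ s ∈ closure C.J, s ≤ Real.sqrt (catS c z x) := by
    intro x hx hmx
    refine closure_minimal (fun s hs => ?_) isClosed_Iic
    by_contra! hc'
    exact hx (C.interval.out hmJ hs ⟨Real.sqrt_le_sqrt hmx.le, (not_le.1 hc').le⟩)
  have hSeq : catS c z u₂ = catS c z (-w) := by
    have h1 := le_antisymm (hub _ hJ1 hS1 _ hcl2) (hub _ hJ2 hS2 _ hcl1)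
    exact (Real.sqrt_inj (catS_pos hc z _).le (catS_pos hc z _).le).1 h1
  obtain ⟨hz, huw⟩ := shift_eq_zero hc hQ2 (by rw [← hσm]; exact strictMono_catSlope hc z hm.2)
    hQ1 (by rw [← hσm]; exact strictMono_catSlope hc z hm.1) hSeq
  have habs : |u₀| < u₂ := abs_lt.2 ⟨by linarith, h02⟩
  refine ⟨hz, u₂, habs, fun u hu => hall u ⟨?_, hu.2⟩, hQ2, hlim⟩
  have := abs_nonneg u₀
  linarith [hu.1]

/-- Minus the derivative of `k²` is negative where `k² = 0` on a centred catenoid solving the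
extrinsic equation. -/
theorem cat_crossing_algebra {N g v c u R S σ Q P ch t D Ω : ℝ} (hN : 0 < N) (hv : 0 < v)
    (hc : 0 < c) (hch : 0 < ch) (hS : 0 < S) (ht : ch ^ 2 * (1 - t ^ 2) = 1)
    (hσ : σ = c ^ 2 * ch ^ 2 * t + c * (c * u)) (hQ : Q = c * u * t - c)
    (hP : P = Ω ^ 2 * (c ^ 2 * ch ^ 2)) (hT : P * R ^ 2 / S = v ^ 2)
    (hD : D = g * v * σ / S - 2 * v ^ 2 * (t + (v - 1) * σ / S))
    (hE : bfExpr N g v (P * R ^ 2 / S) Q (Ω ^ 2 * c * R ^ 2) = 0) :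
    -Q * D = 2 * v ^ 2 * (c * u) := by
  have hR : Ω ^ 2 * R ^ 2 = v ^ 2 * S / (c ^ 2 * ch ^ 2) := by
    rw [hP] at hT
    field_simp at hT ⊢
    linear_combination hT
  have h1 : Q * (g - 2 * v ^ 2 + 2 * v) * (c * ch ^ 2) = -2 * v * S := by
    rw [hT] at hE
    unfold bfExpr at hE
    -- At `T = v²` the bracket carrying the factor `v² - T` disappears and the rest is divisible by
    -- `N v`. This is where a nonzero `n` is needed.
    have h2 : N * v * (Q * v * (g - 2 * v ^ 2 + 2 * v) + 2 * (Ω ^ 2 * R ^ 2) * c) = 0 := by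
      linear_combination hE
    have h3 := (mul_eq_zero.1 h2).resolve_left (by positivity)
    rw [hR] at h3
    field_simp at h3
    have h3' : v * (Q * (g - 2 * v ^ 2 + 2 * v) * c * ch ^ 2 + v * 2 * S) = 0 := by
      linear_combination h3
    linear_combination (mul_eq_zero.1 h3').resolve_left hv.ne'
  have h4 : -Q * D * (c * ch ^ 2 * S) = 2 * v ^ 2 * (c * u) * (c * ch ^ 2 * S) := by
    have hDS : D * S = v * σ * (g - 2 * v ^ 2 + 2 * v) - 2 * v ^ 2 * t * S := by
      rw [hD]; field_simp; ring
    have h5 : -Q * D * (c * ch ^ 2 * S) = -(Q * (g - 2 * v ^ 2 + 2 * v) * (c * ch ^ 2)) * (v * σ)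
        + 2 * v ^ 2 * t * S * Q * (c * ch ^ 2) := by
      linear_combination (-Q * (c * ch ^ 2)) * hDS
    rw [h5, h1, hσ, hQ]
    linear_combination (-2 * v ^ 2 * S * c ^ 2 * u) * ht
  exact mul_right_cancel₀ (by positivity) h4

/-- A rotating catenoid does not solve the extrinsic equation. -/
theorem not_eventually_cat (hn : 1 ≤ n) (hrm : 0 ≤ rm) (hL : 0 < L) {c z Ω : ℝ} (hc : 0 < c)
    (hΩ : Ω ≠ 0) {u₀ : ℝ} (hJ : Real.sqrt (catS c z u₀) ∈ C.J)
    (hk : Ω ^ 2 * (c ^ 2 * Real.cosh u₀ ^ 2) * C.R (Real.sqrt (catS c z u₀)) ^ 2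
      / Real.sqrt (catS c z u₀) ^ 2 < fSdS n rm L (C.R (Real.sqrt (catS c z u₀))))
    (h : ∀ᶠ u in 𝓝 u₀, catEq C c z Ω u = 0) : False := by
  obtain ⟨hz, u₂, hu2, hI, hQ2, r, hr, hlv, hlR⟩ := cat_centred hrm hL hc hΩ hJ h
  subst hz
  set q : ℝ → ℝ := fun u => Real.sqrt (catS c 0 u) with hq
  have hq0 : ∀ u, 0 < q u := fun u => Real.sqrt_pos.2 (catS_pos hc 0 u)
  have hqsq : ∀ u, q u ^ 2 = catS c 0 u := fun u => Real.sq_sqrt (catS_pos hc 0 u).le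
  have hqd : ∀ u, HasDerivAt q (catSlope c 0 u / q u) u := fun u => by
    refine ((hasDerivAt_catS c 0 u).sqrt (catS_pos hc 0 u).ne').congr_deriv ?_
    exact mul_div_mul_left _ _ two_ne_zero
  set P : ℝ → ℝ := fun u => Ω ^ 2 * (c ^ 2 * Real.cosh u ^ 2) with hP
  have hP0 : ∀ u, 0 < P u := fun u => by have := Real.cosh_pos u; positivity
  have hPd : ∀ u, HasDerivAt P (2 * P u * (Real.sinh u / Real.cosh u)) u := fun u => by
    have hch := Real.cosh_pos u
    refine ((((Real.hasDerivAt_cosh u).pow 2).const_mul (c ^ 2)).const_mul (Ω ^ 2)).congr_deriv ?_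
    simp only [hP, Nat.cast_ofNat, Nat.add_one_sub_one, pow_one]
    field_simp
  -- This is `𝐤²` along the profile.
  set K : ℝ → ℝ := fun u => C.lapse (q u) ^ 2 - P u * C.R (q u) ^ 2 / q u ^ 2 with hK
  have hKd : ∀ u ∈ Set.Ico |u₀| u₂, HasDerivAt K
      (C.slope (q u) * C.lapse (q u) * catSlope c 0 u / catS c 0 u
        - 2 * (P u * C.R (q u) ^ 2 / q u ^ 2) * (Real.sinh u / Real.cosh u
          + (C.lapse (q u) - 1) * catSlope c 0 u / catS c 0 u)) u := by
    intro u hu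
    have hs : q u ∈ C.J := (hI u hu).1
    have hch := Real.cosh_pos u
    have h0 := hq0 u
    have hS := catS_pos hc 0 u
    have hv := ((hasDerivAt_lapse hrm hL hs h0).comp u (hqd u)).pow 2
    have hR := ((hasDerivAt_R hrm hL hs h0).comp u (hqd u)).pow 2
    refine (hv.sub (((hPd u).mul hR).div ((hqd u).pow 2)
      (pow_ne_zero 2 h0.ne'))).congr_deriv ?_
    rw [← hqsq u]
    simp only [Function.comp_apply, Nat.cast_ofNat, Nat.add_one_sub_one, pow_one, Pi.pow_apply,
      Pi.mul_apply]
    field_simp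
    ring
  -- A centred catenoid is symmetric under `u ↦ -u`, so one may start at `|u₀|` and keep the
  -- crossing parameter positive.
  have ha : 0 < K |u₀| := by
    have hev : catS c 0 |u₀| = catS c 0 u₀ := by
      rcases abs_cases u₀ with ⟨h, -⟩ | ⟨h, -⟩
      · rw [h]
      · rw [h, catS_neg, neg_zero]
    have hs := (hI _ ⟨le_rfl, hu2⟩).1
    change 0 < C.lapse (q |u₀|) ^ 2 - _
    rw [lapse_sq hs]
    simp only [hP, hq, Real.cosh_abs, hev]
    linarith
  -- At the horizon the lapse vanishes while the rotational velocity has a positive limit, so `𝐤²`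
  -- becomes negative before the exit.
  obtain ⟨b, hb, hKb⟩ : ∃ b ∈ Set.Ioo |u₀| u₂, K b < 0 := by
    have hl : Filter.Tendsto K (𝓝[<] u₂) (𝓝 (0 ^ 2 - P u₂ * r ^ 2 / q u₂ ^ 2)) :=
      (hlv.pow 2).sub ((((hPd u₂).continuousAt.tendsto.mono_left nhdsWithin_le_nhds).mul
        (hlR.pow 2)).div (((hqd u₂).continuousAt.tendsto.mono_left nhdsWithin_le_nhds).pow 2)
          (pow_ne_zero 2 (hq0 u₂).ne'))
    have hneg : (0 : ℝ) ^ 2 - P u₂ * r ^ 2 / q u₂ ^ 2 < 0 := by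
      have := hP0 u₂
      have := hq0 u₂
      have : 0 < P u₂ * r ^ 2 / q u₂ ^ 2 := by positivity
      linarith
    obtain ⟨b, h1, h2⟩ := ((hl.eventually_lt_const hneg).and (Ioo_mem_nhdsLT hu2)).exists
    exact ⟨b, h2, h1⟩
  have hKc : ContinuousOn K (Set.Icc |u₀| b) := fun u hu =>
    (hKd u ⟨hu.1, hu.2.trans_lt hb.2⟩).continuousAt.continuousWithinAt
  set E : Set ℝ := Set.Icc |u₀| b ∩ K ⁻¹' Set.Iic 0 with hE
  have hEc : IsClosed E := hKc.preimage_isClosed_of_isClosed isClosed_Icc isClosed_Iic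
  have hEb : BddBelow E := ⟨|u₀|, fun u hu => hu.1.1⟩
  have hmem : sInf E ∈ E := hEc.csInf_mem ⟨b, ⟨hb.1.le, le_rfl⟩, hKb.le⟩ hEb
  set w := sInf E with hw
  have hw0 : |u₀| < w := lt_of_le_of_ne hmem.1.1 fun h => by
    have : K w ≤ 0 := hmem.2
    rw [← h] at this
    linarith
  have hwI : w ∈ Set.Ico |u₀| u₂ := ⟨hw0.le, hmem.1.2.trans_lt hb.2⟩
  have hbefore : ∀ u ∈ Set.Ioo |u₀| w, 0 < K u := by
    intro u hu
    by_contra! hc'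
    exact absurd (csInf_le hEb ⟨⟨hu.1.le, hu.2.le.trans hmem.1.2⟩, hc'⟩) (not_le.2 hu.2)
  have hKw : K w = 0 := by
    refine le_antisymm hmem.2 ?_
    refine ge_of_tendsto ((hKd w hwI).continuousAt.tendsto.mono_left
      (nhdsWithin_le_nhds (s := Set.Iio w))) ?_
    filter_upwards [Ioo_mem_nhdsLT hw0] with u hu using (hbefore u hu).le
  have hwpos : 0 < w := (abs_nonneg u₀).trans_lt hw0
  obtain ⟨hwJ, hwE⟩ := hI w hwI
  have hchw := Real.cosh_pos w
  -- For positive parameters `catQ` increases, and it reaches zero only at the exit `u₂`.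
  have hQw : catQ c 0 w < 0 := by
    suffices catQ c 0 w < catQ c 0 u₂ by rwa [hQ2] at this
    obtain ⟨x, hx, hx'⟩ := exists_hasDerivAt_eq_slope (catQ c 0) _ hwI.2
      (fun u _ => (hasDerivAt_catQ hc 0 u).continuousAt.continuousWithinAt)
      (fun u _ => hasDerivAt_catQ hc 0 u)
    have hx0 : 0 < x := hwpos.trans hx.1
    have h0 : catSlope c 0 0 = 0 := by simp [catSlope]
    have h1 : 0 < catSlope c 0 x := h0.symm.trans_lt (strictMono_catSlope hc 0 hx0)
    have h2 : 0 < catSlope c 0 x / (c * Real.cosh x ^ 2) := by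
      have := Real.cosh_pos x
      positivity
    rw [hx'] at h2
    have h3 := hwI.2
    by_contra! hcon
    exact absurd (div_nonpos_of_nonpos_of_nonneg (sub_nonpos.2 hcon) (sub_nonneg.2 h3.le))
      (not_le.2 h2)
  have hT : P w * C.R (q w) ^ 2 / catS c 0 w = C.lapse (q w) ^ 2 := by
    rw [← hqsq w]
    exact (sub_eq_zero.1 hKw).symm
  have hDw := hKd w hwI
  set D := C.slope (q w) * C.lapse (q w) * catSlope c 0 w / catS c 0 w
        - 2 * (P w * C.R (q w) ^ 2 / q w ^ 2) * (Real.sinh w / Real.cosh w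
          + (C.lapse (q w) - 1) * catSlope c 0 w / catS c 0 w) with hD
  have halg := cat_crossing_algebra (N := n) (g := C.slope (q w)) (v := C.lapse (q w)) (c := c)
    (u := w) (R := C.R (q w)) (S := catS c 0 w) (σ := catSlope c 0 w) (Q := catQ c 0 w) (P := P w)
    (ch := Real.cosh w) (t := Real.sinh w / Real.cosh w) (D := D) (Ω := Ω)
    (by exact_mod_cast hn) (lapse_pos hwJ) hc hchw (catS_pos hc 0 w)
    (by field_simp; linear_combination Real.cosh_sq w)
    (by unfold catSlope; field_simp; ring) (by unfold catQ; ring) rfl hT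
    (by rw [hD, hqsq w, hT]) (by rw [← hqsq w]; exact hwE)
  have hDpos : 0 < D := by
    have h1 : 0 < -catQ c 0 w * D := by
      rw [halg]
      have := lapse_pos hwJ
      positivity
    exact (mul_pos_iff_of_pos_left (neg_pos.2 hQw)).1 h1
  have hslope := hDw.tendsto_slope.mono_left (nhdsWithin_mono w (s := Set.Iio w)
    fun x (hx : x < w) => hx.ne)
  -- A positive derivative at `w` gives positive left difference quotients, but `K > 0` just before
  -- `w` and `K w = 0` make them nonpositive.
  obtain ⟨x, hx1, hx2⟩ := ((hslope.eventually_const_lt hDpos).and (Ioo_mem_nhdsLT hw0)).exists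
  rw [slope_def_field, hKw] at hx1
  have h1 := hbefore x hx2
  exact absurd (div_nonpos_of_nonneg_of_nonpos (by linarith : 0 ≤ K x - 0)
    (by linarith [hx2.2] : x - w ≤ 0)) (by linarith)

end ConformalRadius

end

section

/-! ## Existence of conformally flat coordinates -/

/-- The conformal radius of de Sitter space-time. -/
def conformalRadiusDeSitter (n : ℕ) (L : ℝ) (hL : 0 < L) : ConformalRadius n 0 L where
  J := Set.Ico 0 1
  R s := 2 * L * s / (1 + s ^ 2)
  h s := ((1 + s ^ 2) / (2 * L)) ^ 2
  interval := Set.ordConnected_Ico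
  nonneg s hs := hs.1
  bijOn := by
    have hf : ∀ r, fSdS n 0 L r = 1 - r ^ 2 / L ^ 2 := fun r => by simp [fSdS]
    refine ⟨fun s hs => ⟨?_, fun _ => rfl, ?_⟩, fun s hs t ht hst => ?_, fun r hr => ?_⟩
    · have := hs.1
      positivity
    · have h1 := mul_pos (sub_pos.2 hs.2) (sub_pos.2 hs.2)
      have h2 : 0 < 1 - s ^ 2 := by nlinarith [hs.1, hs.2]
      rw [hf]
      have : 1 - (2 * L * s / (1 + s ^ 2)) ^ 2 / L ^ 2 = ((1 - s ^ 2) / (1 + s ^ 2)) ^ 2 := by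
        field_simp; ring
      rw [this]
      positivity
    · simp only at hst
      rw [div_eq_div_iff (by positivity) (by positivity)] at hst
      have h1 : (2 * L) * ((s - t) * (1 - s * t)) = 0 := by linear_combination hst
      have h2 := (mul_eq_zero.1 h1).resolve_left (by positivity)
      have h3 : 1 - s * t ≠ 0 := by nlinarith [hs.1, hs.2, ht.1, ht.2]
      linarith [(mul_eq_zero.1 h2).resolve_right h3]
    · obtain ⟨hr0, -, hr⟩ := hr
      rw [hf] at hr
      set v := Real.sqrt (1 - r ^ 2 / L ^ 2) with hv
      have hv0 : 0 < v := Real.sqrt_pos.2 hr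
      have hv2 : v ^ 2 = 1 - r ^ 2 / L ^ 2 := Real.sq_sqrt hr.le
      have hr2 : r ^ 2 = L ^ 2 * (1 - v ^ 2) := by rw [hv2]; field_simp; ring
      have hrL : r < L * (1 + v) := by
        by_contra! hc
        have : (L * (1 + v)) ^ 2 ≤ r ^ 2 := by gcongr
        nlinarith [mul_pos (sq_pos_of_pos hL) hv0, sq_nonneg v, sq_pos_of_pos hv0, sq_pos_of_pos hL,
          mul_pos (sq_pos_of_pos hL) (sq_pos_of_pos hv0)]
      -- Half-angle substitution: with `r = L sin θ` and `v = cos θ` the conformal radius is `tan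
      -- (θ/2)`.
      refine ⟨r / (L * (1 + v)), ⟨by positivity, (div_lt_one (by positivity)).2 hrL⟩, ?_⟩
      have h1 : 1 + (r / (L * (1 + v))) ^ 2 = 2 / (1 + v) := by
        rw [div_pow, hr2]; field_simp; ring
      simp only [h1]
      field_simp
  h_pos s _ := by positivity
  sq_eq s _ := by field_simp
  deriv_eq s hs := by
    have hf : ∀ r, fSdS n 0 L r = 1 - r ^ 2 / L ^ 2 := fun r => by simp [fSdS]
    have h2 : 0 < 1 - s ^ 2 := by nlinarith [hs.1, hs.2]
    have h3 : fSdS n 0 L (2 * L * s / (1 + s ^ 2)) * (((1 + s ^ 2) / (2 * L)) ^ 2)⁻¹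
        = (2 * L * (1 - s ^ 2) / (1 + s ^ 2) ^ 2) ^ 2 := by
      rw [hf]; field_simp; ring
    rw [h3, Real.sqrt_sq (by positivity)]
    have h4 := ((hasDerivAt_id s).const_mul (2 * L)).div (((hasDerivAt_id s).pow 2).const_add 1)
      (by simp only [id, Pi.pow_apply]; positivity)
    refine (h4.congr_deriv ?_).hasDerivWithinAt
    simp only [id, Nat.cast_ofNat, Nat.add_one_sub_one, pow_one, Pi.pow_apply]
    field_simp
    ring

theorem exists_tortoise {r₁ r₂ : ℝ} (h1 : 0 ≤ r₁) (h12 : r₁ < r₂)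
    (hf : ∀ r ∈ Set.Ioo r₁ r₂, 0 < fSdS n rm L r) :
    ∃ Λ : ℝ → ℝ, ∀ r ∈ Set.Ioo r₁ r₂,
      HasStrictDerivAt Λ (1 / (r * Real.sqrt (fSdS n rm L r))) r := by
  set w : ℝ → ℝ := fun r => 1 / (r * Real.sqrt (fSdS n rm L r)) with hw
  have hwc : ContinuousOn w (Set.Ioo r₁ r₂) := by
    intro r hr
    have hr0 : 0 < r := h1.trans_lt hr.1
    have := Real.sqrt_pos.2 (hf r hr)
    exact (continuousAt_const.div (continuousAt_id.mul (continuousAt_fSdS hr0).sqrt)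
      (mul_pos hr0 this).ne').continuousWithinAt
  have hm : (r₁ + r₂) / 2 ∈ Set.Ioo r₁ r₂ := ⟨by linarith, by linarith⟩
  refine ⟨fun r => ∫ x in (r₁ + r₂) / 2..r, w x, fun r hr => ?_⟩
  refine intervalIntegral.integral_hasStrictDerivAt_right ?_ ?_ ?_
  · exact (hwc.mono (Set.ordConnected_Ioo.uIcc_subset hm hr)).intervalIntegrable
  · exact hwc.stronglyMeasurableAtFilter isOpen_Ioo r hr
  · exact hwc.continuousAt (isOpen_Ioo.mem_nhds hr)

/-- Dividing the second defining equation by the first gives `d log s = dr / (r √f)`. Hence `s` is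
the exponential of a primitive, `R` its inverse, and `h = s²/R²` is dictated by the first equation.
-/
theorem nonempty_conformalRadius_of_Ioo {r₁ r₂ : ℝ} (h1 : 0 < r₁) (h12 : r₁ < r₂)
    (hS : staticRange n rm L = Set.Ioo r₁ r₂) : Nonempty (ConformalRadius n rm L) := by
  have hf : ∀ r ∈ Set.Ioo r₁ r₂, 0 < fSdS n rm L r := fun r hr => by
    rw [← hS] at hr; exact hr.2.2
  obtain ⟨Λ, hΛ⟩ := exists_tortoise h1.le h12 hf
  set φ : ℝ → ℝ := fun r => Real.exp (Λ r) with hφ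
  have hφd : ∀ r ∈ Set.Ioo r₁ r₂,
      HasStrictDerivAt φ (φ r * (1 / (r * Real.sqrt (fSdS n rm L r)))) r :=
    fun r hr => (hΛ r hr).exp
  have hv : ∀ r ∈ Set.Ioo r₁ r₂, 0 < Real.sqrt (fSdS n rm L r) := fun r hr =>
    Real.sqrt_pos.2 (hf r hr)
  have hcont : ContinuousOn φ (Set.Ioo r₁ r₂) := fun r hr =>
    (hφd r hr).hasDerivAt.continuousAt.continuousWithinAt
  have hmono : StrictMonoOn φ (Set.Ioo r₁ r₂) := by
    refine strictMonoOn_of_deriv_pos (convex_Ioo r₁ r₂) hcont fun r hr => ?_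
    rw [interior_Ioo] at hr
    rw [(hφd r hr).hasDerivAt.deriv]
    have := hv r hr
    have : 0 < r := h1.trans hr.1
    have : 0 < φ r := Real.exp_pos _
    positivity
  have hbij : Set.BijOn φ (Set.Ioo r₁ r₂) (φ '' Set.Ioo r₁ r₂) := hmono.injOn.bijOn_image
  have hinv := hbij.invOn_invFunOn
  have hbij' := (Set.bijOn_comm hinv).2 hbij
  set R := Function.invFunOn φ (Set.Ioo r₁ r₂) with hR
  refine ⟨{ J := φ '' Set.Ioo r₁ r₂
            R := R
            h := fun s => s ^ 2 / R s ^ 2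
            interval := (isPreconnected_Ioo.image φ hcont).ordConnected
            nonneg := ?_
            bijOn := by rw [hS]; exact hbij'
            h_pos := ?_
            sq_eq := ?_
            deriv_eq := ?_ }⟩
  · rintro _ ⟨r, -, rfl⟩
    exact (Real.exp_pos _).le
  · rintro _ ⟨r, hr, rfl⟩
    have h3 : R (φ r) = r := hinv.1 hr
    have : 0 < r := h1.trans hr.1
    have : 0 < φ r := Real.exp_pos _
    rw [h3]; positivity
  · rintro _ ⟨r, hr, rfl⟩
    have h3 : R (φ r) = r := hinv.1 hr
    have : 0 < r := h1.trans hr.1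
    have : 0 < φ r := Real.exp_pos _
    rw [h3]; field_simp
  · rintro _ ⟨r, hr, rfl⟩
    have h3 : R (φ r) = r := hinv.1 hr
    have hr0 : 0 < r := h1.trans hr.1
    have hφ0 : 0 < φ r := Real.exp_pos _
    have hv0 := hv r hr
    have hd := (hφd r hr).to_local_left_inverse (g := R) (by positivity)
      (by filter_upwards [isOpen_Ioo.mem_nhds hr] with x hx using hinv.1 hx)
    refine (hd.hasDerivAt.congr_deriv ?_).hasDerivWithinAt
    rw [h3, inv_div, Real.sqrt_mul (hf r hr).le, ← div_pow, Real.sqrt_sq (by positivity)]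
    field_simp

theorem nonempty_conformalRadius (hrm : 0 ≤ rm) (hL : 0 < L)
    (hne : (staticRange n rm L).Nonempty) : Nonempty (ConformalRadius n rm L) := by
  obtain ⟨r₁, r₂, -, h12, -, -, ⟨-, h10, -, -, hS⟩ | ⟨h0, -, -⟩⟩ :=
    staticRange_eq (n := n) hrm hL hne
  · exact nonempty_conformalRadius_of_Ioo h10 h12 hS
  · subst h0
    exact ⟨conformalRadiusDeSitter n L hL⟩

end

section

/-! ## Partial derivatives -/

/-- With an affine section through `x`, differentiability of the composite and of `φ` are
equivalent. In the nondifferentiable case both sides are the default value zero, so the chain rule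
needs no smoothness of `φ`. -/
theorem fderiv_comp_of_section {E F : Type*} [NormedAddCommGroup E] [NormedSpace ℝ E]
    [NormedAddCommGroup F] [NormedSpace ℝ F] (φ : F → ℝ) (p : E →L[ℝ] F) (i : F →L[ℝ] E)
    (h : ∀ y, p (i y) = y) (x : E) :
    fderiv ℝ (fun z => φ (p z)) x = (fderiv ℝ φ (p x)).comp p := by
  by_cases hφ : DifferentiableAt ℝ φ (p x)
  · exact (hφ.hasFDerivAt.comp x p.hasFDerivAt).fderiv
  · have h2 : ¬ DifferentiableAt ℝ (fun z => φ (p z)) x := by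
      intro hd
      apply hφ
      have h3 : DifferentiableAt ℝ (fun y => x + i (y - p x)) (p x) := by fun_prop
      have h4 : DifferentiableAt ℝ (fun z => φ (p z)) (x + i (p x - p x)) := by simpa using hd
      have h5 := DifferentiableAt.comp (p x) (f := fun y => x + i (y - p x)) h4 h3
      refine h5.congr_of_eventuallyEq (Filter.Eventually.of_forall fun y => ?_)
      simp [h]
    rw [fderiv_zero_of_not_differentiableAt h2, fderiv_zero_of_not_differentiableAt hφ]
    simp

section pd

variable {ι : Type} [Fintype ι] [DecidableEq ι]

theorem sum_mul_pd (F : (ι → ℝ) → ℝ) (x m : ι → ℝ) :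
    ∑ i, m i * pd F i x = fderiv ℝ F x m := by
  conv_rhs => rw [pi_eq_sum_univ' m]
  simp only [map_sum, map_smul, smul_eq_mul]
  refine Finset.sum_congr rfl fun i _ => ?_
  unfold pd
  congr 2

@[simp] theorem pd_const (c : ℝ) (i : ι) (x : ι → ℝ) : pd (fun _ => c) i x = 0 := by
  simp [pd]

theorem pd_neg (F : (ι → ℝ) → ℝ) (i : ι) (x : ι → ℝ) : pd (fun y => -F y) i x = -pd F i x := by
  simp [pd]

theorem pd_coord (i j : ι) (x : ι → ℝ) :
    pd (fun y : ι → ℝ => y j) i x = if j = i then 1 else 0 := by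
  unfold pd
  have h : HasFDerivAt (fun y : ι → ℝ => y j)
      (ContinuousLinearMap.proj (R := ℝ) (φ := fun _ : ι => ℝ) j) x :=
    (ContinuousLinearMap.proj (R := ℝ) (φ := fun _ : ι => ℝ) j).hasFDerivAt
  rw [h.fderiv]
  simp [Pi.single_apply]

/-- Projection that forgets the `none` coordinate. -/
def someProj (ι : Type) [Fintype ι] : (Option ι → ℝ) →L[ℝ] (ι → ℝ) :=
  ContinuousLinearMap.pi fun i => ContinuousLinearMap.proj (some i)

theorem someProj_apply {κ : Type} [Fintype κ] (y : Option κ → ℝ) : someProj κ y = fun i => y (some i) := rfl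

theorem fderiv_comp_someProj {κ : Type} [Fintype κ] (F : (κ → ℝ) → ℝ) (x : Option κ → ℝ) :
    fderiv ℝ (fun y : Option κ → ℝ => F (fun i => y (some i))) x
      = (fderiv ℝ F (fun i => x (some i))).comp (someProj κ) :=
  fderiv_comp_of_section F (someProj κ)
    (ContinuousLinearMap.pi fun o : Option κ => match o with
      | none => 0
      | some i => ContinuousLinearMap.proj i) (fun _ => rfl) x

theorem pd_comp_some (F : (ι → ℝ) → ℝ) (i : ι) (x : Option ι → ℝ) :
    pd (fun y : Option ι → ℝ => F (fun i => y (some i))) (some i) x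
      = pd F i (fun i => x (some i)) := by
  unfold pd
  rw [fderiv_comp_someProj, ContinuousLinearMap.comp_apply]
  congr 1
  ext j
  simp [someProj_apply, Pi.single_apply]

theorem pd_comp_none (F : (ι → ℝ) → ℝ) (x : Option ι → ℝ) :
    pd (fun y : Option ι → ℝ => F (fun i => y (some i))) none x = 0 := by
  unfold pd
  rw [fderiv_comp_someProj, ContinuousLinearMap.comp_apply]
  have h : someProj ι (Pi.single none 1) = 0 := by
    ext j
    simp [someProj_apply]
  rw [h, map_zero]

/-! ## Diagonal metrics -/

theorem christoffel_diagonal (d : (ι → ℝ) → ι → ℝ) (x : ι → ℝ) (hd : ∀ i, d x i ≠ 0)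
    (ρ μ ν : ι) : christoffel (fun y => Matrix.diagonal (d y)) x ρ μ ν
      = (1 / 2) * ((d x ρ)⁻¹ * ((if ρ = ν then pd (fun y => d y ρ) μ x else 0)
        + (if ρ = μ then pd (fun y => d y ρ) ν x else 0)
        - (if μ = ν then pd (fun y => d y μ) ρ x else 0))) := by
  have hinv : (Matrix.diagonal (d x))⁻¹ = Matrix.diagonal fun i => (d x i)⁻¹ := by
    refine Matrix.inv_eq_right_inv ?_
    rw [Matrix.diagonal_mul_diagonal, ← Matrix.diagonal_one]
    congr 1
    ext i
    exact mul_inv_cancel₀ (hd i)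
  have hpd : ∀ i j k, pd (fun y => Matrix.diagonal (d y) i j) k x
      = if i = j then pd (fun y => d y i) k x else 0 := by
    intro i j k
    by_cases h : i = j
    · subst h; simp
    · simp [h]
  unfold christoffel
  rw [hinv]
  simp only [hpd]
  congr 1
  rw [Finset.sum_eq_single ρ]
  · simp
  · intro b _ hb
    simp [Matrix.diagonal_apply_ne _ hb.symm]
  · simp

theorem sum_christoffel_diagonal (d : (ι → ℝ) → ι → ℝ) (x : ι → ℝ) (hd : ∀ i, d x i ≠ 0)
    (m V W : ι → ℝ) :
    ∑ ρ, ∑ μ, ∑ ν, m ρ * christoffel (fun y => Matrix.diagonal (d y)) x ρ μ ν * V μ * W ν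
      = (1 / 2) * ∑ ρ, m ρ * (d x ρ)⁻¹ * (W ρ * ∑ μ, V μ * pd (fun y => d y ρ) μ x
        + V ρ * ∑ ν, W ν * pd (fun y => d y ρ) ν x
        - ∑ μ, V μ * W μ * pd (fun y => d y μ) ρ x) := by
  rw [Finset.mul_sum]
  refine Finset.sum_congr rfl fun ρ _ => ?_
  simp only [christoffel_diagonal d x hd]
  have h1 : ∑ μ, ∑ ν, (if ρ = ν then pd (fun y => d y ρ) μ x else 0) * V μ * W ν
      = W ρ * ∑ μ, V μ * pd (fun y => d y ρ) μ x := by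
    rw [Finset.mul_sum]
    refine Finset.sum_congr rfl fun μ _ => ?_
    simp [ite_mul]
    ring
  have h2 : ∑ μ, ∑ ν, (if ρ = μ then pd (fun y => d y ρ) ν x else 0) * V μ * W ν
      = V ρ * ∑ ν, W ν * pd (fun y => d y ρ) ν x := by
    rw [Finset.sum_comm, Finset.mul_sum]
    refine Finset.sum_congr rfl fun μ _ => ?_
    simp [ite_mul]
    ring
  have h3 : ∑ μ, ∑ ν, (if μ = ν then pd (fun y => d y μ) ρ x else 0) * V μ * W ν
      = ∑ μ, V μ * W μ * pd (fun y => d y μ) ρ x := by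
    refine Finset.sum_congr rfl fun μ _ => ?_
    simp [ite_mul]
    ring
  rw [← h1, ← h2, ← h3]
  simp only [Finset.mul_sum, ← Finset.sum_add_distrib, ← Finset.sum_sub_distrib]
  refine Finset.sum_congr rfl fun μ _ => Finset.sum_congr rfl fun ν _ => ?_
  ring

theorem extrinsic_one {α : Type} [Fintype α] [DecidableEq α] (X : (α → ℝ) → ι → ℝ) (s : α → ℝ)
    (m : ι → ℝ) (a b : α) :
    extrinsic (fun _ => (1 : Matrix ι ι ℝ)) X s m a b
      = ∑ μ, m μ * pd (fun y => tangent X y b μ) a s := by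
  unfold extrinsic
  have : ∀ ρ μ ν, christoffel (fun _ => (1 : Matrix ι ι ℝ)) (X s) ρ μ ν = 0 := by
    intro ρ μ ν
    simp [christoffel]
  simp [this]

theorem induced_one {α : Type} [Fintype α] [DecidableEq α] (X : (α → ℝ) → ι → ℝ) (s : α → ℝ)
    (a b : α) :
    induced (fun _ => (1 : Matrix ι ι ℝ)) X s a b = tangent X s a ⬝ᵥ tangent X s b := by
  simp [induced, Matrix.one_apply, dotProduct]

end pd

/-! ## Radial functions -/

theorem euclid_nonneg {d : ℕ} (x : Fin d → ℝ) : 0 ≤ euclid x := Real.sqrt_nonneg _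

theorem euclid_sq {d : ℕ} (x : Fin d → ℝ) : euclid x ^ 2 = x ⬝ᵥ x := by
  unfold euclid
  rw [Real.sq_sqrt (Finset.sum_nonneg fun i _ => sq_nonneg _)]
  simp [dotProduct, sq]

theorem euclid_eq_sqrt {d : ℕ} (x : Fin d → ℝ) : euclid x = Real.sqrt (x ⬝ᵥ x) := by
  rw [← euclid_sq, Real.sqrt_sq (euclid_nonneg x)]

theorem euclid_pos {d : ℕ} {x : Fin d → ℝ} (hx : x ≠ 0) : 0 < euclid x := by
  rw [euclid_eq_sqrt]
  exact Real.sqrt_pos.2 (lt_of_le_of_ne (by simpa using dotProduct_star_self_nonneg x)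
    fun h => hx (dotProduct_self_eq_zero.1 h.symm))

theorem continuous_euclid {d : ℕ} : Continuous (euclid : (Fin d → ℝ) → ℝ) := by
  unfold euclid; fun_prop

theorem pd_radial {d : ℕ} {φ : ℝ → ℝ} {φ' : ℝ} {x : Fin d → ℝ} (hx : x ≠ 0)
    (hφ : HasDerivAt φ φ' (euclid x)) (q : Fin d) :
    pd (fun z => φ (euclid z)) q x = φ' * (x q / euclid x) := by
  have h0 := euclid_pos hx
  have h1 : HasFDerivAt (fun z : Fin d → ℝ => ∑ i, z i ^ 2)
      (∑ i, (2 * x i) • (ContinuousLinearMap.proj i : (Fin d → ℝ) →L[ℝ] ℝ)) x := by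
    refine HasFDerivAt.fun_sum fun i _ => ?_
    have := (ContinuousLinearMap.proj (R := ℝ) (φ := fun _ : Fin d => ℝ) i).hasFDerivAt (x := x)
    simpa using this.pow 2
  have h2 : (∑ i, x i ^ 2) ≠ 0 := fun h => by
    unfold euclid at h0; rw [h, Real.sqrt_zero] at h0; exact lt_irrefl _ h0
  have h3 := hφ.comp_hasFDerivAt x (h1.sqrt h2)
  unfold pd
  rw [show (fun z : Fin d → ℝ => φ (euclid z)) = φ ∘ euclid from rfl, h3.fderiv]
  simp only [smul_apply, sum_apply,
    ContinuousLinearMap.proj_apply, smul_eq_mul, Pi.single_apply]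
  change φ' * (1 / (2 * euclid x) * _) = _
  simp only [mul_ite, mul_one, mul_zero, Finset.sum_ite_eq', Finset.mem_univ, if_true]
  field_simp

/-- A radial function has no derivative in directions orthogonal to the position vector. -/
theorem fderiv_radial_orthogonal {d : ℕ} (φ : ℝ → ℝ) {x m : Fin d → ℝ} (h : m ⬝ᵥ x = 0) :
    fderiv ℝ (fun z : Fin d → ℝ => φ (euclid z)) x m = 0 := by
  by_cases hm : m = 0
  · simp [hm]
  have hmm : m ⬝ᵥ m ≠ 0 := fun h => hm (dotProduct_self_eq_zero.1 h)
  -- Reflection in the hyperplane orthogonal to `m`. It preserves the radial function, fixes `x` and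
  -- reverses `m`, so the derivative along `m` equals its negative; no regularity of `φ` is needed,
  -- not even at the origin.
  set ρl : (Fin d → ℝ) →ₗ[ℝ] (Fin d → ℝ) :=
    { toFun := fun z => z - (2 * (m ⬝ᵥ z) / (m ⬝ᵥ m)) • m
      map_add' := fun a b => by
        ext i; simp [dotProduct_add]; ring
      map_smul' := fun c a => by
        ext i; simp [dotProduct_smul]; ring } with hρl
  set ρ := LinearMap.toContinuousLinearMap ρl with hρ
  have hρa : ∀ z, ρ z = z - (2 * (m ⬝ᵥ z) / (m ⬝ᵥ m)) • m := fun z => rfl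
  have hinv : ∀ z, ρ (ρ z) = z := fun z => by
    rw [hρa, hρa]
    ext i
    simp [dotProduct_sub, dotProduct_smul]
    field_simp
    ring
  have hnorm : ∀ z, euclid (ρ z) = euclid z := fun z => by
    rw [euclid_eq_sqrt, euclid_eq_sqrt, hρa]
    congr 1
    simp only [dotProduct_sub, sub_dotProduct, smul_dotProduct, dotProduct_smul, smul_eq_mul]
    rw [dotProduct_comm z m]
    field_simp
    ring
  have hfd := fderiv_comp_of_section (fun z : Fin d → ℝ => φ (euclid z)) ρ ρ hinv x
  simp only [hnorm] at hfd
  have hx : ρ x = x := by rw [hρa, h]; simp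
  have hmρ : ρ m = -m := by
    rw [hρa, mul_div_assoc, div_self hmm]; ext i; simp; ring
  rw [hx] at hfd
  have h4 := congrArg (fun T => T m) hfd
  simp only [ContinuousLinearMap.comp_apply, hmρ, map_neg] at h4
  linarith

end

section

/-! ## Type I embeddings -/

/-- Extension of a vector of `ℝ³` by zero. -/
def pad (n : ℕ) (v : Fin 3 → ℝ) (q : Fin (n + 4)) : ℝ :=
  if hq : q.val < 3 then v ⟨q.val, hq⟩ else 0

/-- The first three components of a vector. -/
def trunc (m : Fin (n + 4) → ℝ) : Fin 3 → ℝ := fun i => m (Fin.castLE (by omega) i)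

theorem pad_castLE (v : Fin 3 → ℝ) (i : Fin 3) :
    pad n v (Fin.castLE (by omega) i) = v i := by
  have h : (Fin.castLE (show 3 ≤ n + 4 by omega) i).val < 3 := i.isLt
  simp [pad]

theorem trunc_pad (v : Fin 3 → ℝ) : trunc (pad n v) = v := by
  ext i
  exact pad_castLE v i

theorem sum_mul_pad (m : Fin (n + 4) → ℝ) (v : Fin 3 → ℝ) :
    ∑ q, m q * pad n v q = trunc m ⬝ᵥ v := by
  refine (Fintype.sum_of_injective (Fin.castLE (show 3 ≤ n + 4 by omega))
    (Fin.castLE_injective _) _ _ (fun q hq => ?_) (fun i => ?_)).symm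
  · have : ¬ q.val < 3 := fun h => hq ⟨⟨q.val, h⟩, rfl⟩
    simp [pad, this]
  · rw [pad_castLE]; rfl

theorem pad_dotProduct_pad (v w : Fin 3 → ℝ) : pad n v ⬝ᵥ pad n w = v ⬝ᵥ w := by
  rw [dotProduct, sum_mul_pad, trunc_pad]

theorem euclid_pad (v : Fin 3 → ℝ) : euclid (pad n v) = euclid v := by
  rw [euclid_eq_sqrt, euclid_eq_sqrt, pad_dotProduct_pad]

theorem pad_eq_zero {v : Fin 3 → ℝ} : pad n v = 0 ↔ v = 0 := by
  constructor
  · intro h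
    rw [← trunc_pad (n := n) v, h]; rfl
  · rintro rfl
    ext q
    simp [pad]

/-- Second derivatives of a surface. -/
def hess (Y : (Fin 2 → ℝ) → Fin 3 → ℝ) (σ : Fin 2 → ℝ) (a b : Fin 2) (i : Fin 3) : ℝ :=
  pd (fun y => tangent Y y b i) a σ

variable {Y : (Fin 2 → ℝ) → Fin 3 → ℝ} {s : WVIndex → ℝ}

theorem typeI_some (Y : (Fin 2 → ℝ) → Fin 3 → ℝ) (s : WVIndex → ℝ) (q : Fin (n + 4)) :
    typeI n Y s (some q) = pad n (Y fun a => s (some a)) q := rfl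

theorem tangent_none_none : tangent (typeI n Y) s none none = 1 := by
  unfold tangent
  simp only [typeI]
  rw [pd_coord, if_pos rfl]

theorem tangent_some_none (a : Fin 2) : tangent (typeI n Y) s (some a) none = 0 := by
  unfold tangent
  simp only [typeI]
  rw [pd_coord, if_neg (by simp)]

theorem tangent_none_some (q : Fin (n + 4)) : tangent (typeI n Y) s none (some q) = 0 :=
  pd_comp_none (fun σ => pad n (Y σ) q) s

theorem tangent_some_some (a : Fin 2) (q : Fin (n + 4)) :
    tangent (typeI n Y) s (some a) (some q) = pad n (tangent Y (fun a => s (some a)) a) q := by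
  refine (pd_comp_some (fun σ => pad n (Y σ) q) a s).trans ?_
  unfold pad tangent
  by_cases h : q.val < 3 <;> simp [h]

theorem pd_tangent_none_left (b : WVIndex) (μ : STIndex n) :
    pd (fun y => tangent (typeI n Y) y b μ) none s = 0 := by
  rcases b with _ | b <;> rcases μ with _ | q
  · simp only [tangent_none_none, pd_const]
  · simp only [tangent_none_some, pd_const]
  · simp only [tangent_some_none, pd_const]
  · simp only [tangent_some_some]
    exact pd_comp_none (fun σ => pad n (tangent Y σ b) q) s

theorem pd_tangent_none_right (a : WVIndex) (μ : STIndex n) :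
    pd (fun y => tangent (typeI n Y) y none μ) a s = 0 := by
  rcases μ with _ | q
  · simp only [tangent_none_none, pd_const]
  · simp only [tangent_none_some, pd_const]

theorem pd_tangent_none (a : WVIndex) (b : Fin 2) :
    pd (fun y => tangent (typeI n Y) y (some b) none) a s = 0 := by
  simp only [tangent_some_none, pd_const]

theorem pd_tangent_some (a b : Fin 2) (q : Fin (n + 4)) :
    pd (fun y => tangent (typeI n Y) y (some b) (some q)) (some a) s
      = pad n (hess Y (fun a => s (some a)) a b) q := by
  simp only [tangent_some_some]
  refine (pd_comp_some (fun σ => pad n (tangent Y σ b) q) a s).trans ?_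
  unfold pad hess
  by_cases h : q.val < 3 <;> simp [h]

/-- `∂_τ` maps to `∂_t`, which removes the time component. Components beyond the third are
unconstrained, so only the truncation to `ℝ³` has to be a Euclidean normal. -/
theorem isNormal_typeI {m : STIndex n → ℝ} : IsNormal (typeI n Y) s m ↔
    m none = 0 ∧ ∀ a, (trunc fun q => m (some q)) ⬝ᵥ tangent Y (fun a => s (some a)) a = 0 := by
  unfold IsNormal
  constructor
  · intro h
    refine ⟨?_, fun a => ?_⟩
    · have := h none
      simpa [Fintype.sum_option, tangent_none_none, tangent_none_some] using this
    · have := h (some a)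
      simp only [Fintype.sum_option, tangent_some_none, tangent_some_some] at this
      rw [sum_mul_pad] at this
      simpa using this
  · rintro ⟨h0, h⟩ (_ | a)
    · simp [Fintype.sum_option, tangent_none_some, h0]
    · simp only [Fintype.sum_option, tangent_some_none, tangent_some_some]
      rw [sum_mul_pad, h a]
      simp

namespace ConformalRadius

variable (C : ConformalRadius n rm L)

/-- `f` as a function of the Cartesian coordinates. -/
def potF {d : ℕ} (x : Fin d → ℝ) : ℝ := fSdS n rm L (C.R (euclid x))

/-- `h⁻¹` as a function of the Cartesian coordinates. -/
def potH {d : ℕ} (x : Fin d → ℝ) : ℝ := (C.h (euclid x))⁻¹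

/-- The diagonal of the metric. -/
def metricDiag (x : STIndex n → ℝ) : STIndex n → ℝ
  | none => -C.potF fun q => x (some q)
  | some _ => C.potH fun q => x (some q)

theorem metric_eq : C.metric = fun x => Matrix.diagonal (C.metricDiag x) := by
  funext x
  unfold metric
  congr 1

theorem pd_metricDiag_none (μ : STIndex n) (x : STIndex n → ℝ) :
    pd (fun y => C.metricDiag y μ) none x = 0 := by
  cases μ
  · change pd (fun y => -C.potF fun q => y (some q)) none x = 0
    rw [pd_neg, neg_eq_zero]
    exact pd_comp_none C.potF x
  · exact pd_comp_none C.potH x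

theorem pd_metricDiag_none_some (q : Fin (n + 4)) (x : STIndex n → ℝ) :
    pd (fun y => C.metricDiag y none) (some q) x = -pd C.potF q (fun q => x (some q)) := by
  change pd (fun y => -C.potF fun q => y (some q)) (some q) x = _
  rw [pd_neg, neg_inj]
  exact pd_comp_some C.potF q x

theorem pd_metricDiag_some_some (p q : Fin (n + 4)) (x : STIndex n → ℝ) :
    pd (fun y => C.metricDiag y (some p)) (some q) x = pd C.potH q (fun q => x (some q)) :=
  pd_comp_some C.potH q x

variable {C}

theorem induced_none_none : induced C.metric (typeI n Y) s none none
    = -C.potF (pad n (Y fun a => s (some a))) := by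
  simp only [metric_eq, induced, Matrix.of_apply, Fintype.sum_option, tangent_none_none,
    tangent_none_some]
  simp [metricDiag, typeI_some]

theorem induced_none_some (a : Fin 2) : induced C.metric (typeI n Y) s none (some a) = 0 := by
  simp [metric_eq, induced, Fintype.sum_option, tangent_none_none,
    tangent_none_some, tangent_some_none]

theorem induced_some_none (a : Fin 2) : induced C.metric (typeI n Y) s (some a) none = 0 := by
  simp [metric_eq, induced, Fintype.sum_option, tangent_none_none,
    tangent_none_some, tangent_some_none]

theorem induced_some_some (a b : Fin 2) : induced C.metric (typeI n Y) s (some a) (some b)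
    = C.potH (pad n (Y fun a => s (some a))) *
      (tangent Y (fun a => s (some a)) a ⬝ᵥ tangent Y (fun a => s (some a)) b) := by
  simp only [metric_eq, induced, Matrix.of_apply, Fintype.sum_option,
    tangent_some_none, tangent_some_some, Matrix.diagonal_apply]
  simp only [mul_zero, zero_mul, Finset.sum_const_zero, zero_add, add_zero, Option.some.injEq,
    ite_mul, Finset.sum_ite_eq, Finset.mem_univ, if_true, reduceCtorEq, if_false]
  simp only [metricDiag, typeI_some, mul_assoc]
  rw [← Finset.mul_sum, sum_mul_pad, trunc_pad]

/-- The derivative of a function of the spatial coordinates along a covector. -/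
def along (F : (Fin (n + 4) → ℝ) → ℝ) (Y : (Fin 2 → ℝ) → Fin 3 → ℝ) (s : WVIndex → ℝ)
    (m : STIndex n → ℝ) : ℝ :=
  ∑ q, m (some q) * pd F q (pad n (Y fun a => s (some a)))

/-- For a diagonal metric the Christoffel contraction has two terms along `V` and `W` and one
gradient term. Orthogonality of `m` to the spatial parts kills the first two, leaving the normal
derivatives of `f` and `h⁻¹`. -/
theorem sum_christoffel_typeI {m : STIndex n → ℝ} (hm : IsNormal (typeI n Y) s m)
    (hF : C.potF (pad n (Y fun a => s (some a))) ≠ 0)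
    (hH : C.potH (pad n (Y fun a => s (some a))) ≠ 0)
    (V W : STIndex n → ℝ)
    (hV : ∑ q, m (some q) * V (some q) = 0) (hW : ∑ q, m (some q) * W (some q) = 0) :
    ∑ ρ, ∑ μ, ∑ ν, m ρ * christoffel C.metric (typeI n Y s) ρ μ ν * V μ * W ν
      = (2 * C.potH (pad n (Y fun a => s (some a))))⁻¹ *
        (along C.potF Y s m * (V none * W none)
          - along C.potH Y s m * ∑ q, V (some q) * W (some q)) := by
  have h0 : m none = 0 := (isNormal_typeI.1 hm).1
  have hd : ∀ i, C.metricDiag (typeI n Y s) i ≠ 0 := by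
    rintro (_ | q)
    · exact neg_ne_zero.2 hF
    · exact hH
  rw [metric_eq, sum_christoffel_diagonal C.metricDiag (typeI n Y s) hd, Fintype.sum_option, h0]
  simp only [Fintype.sum_option, pd_metricDiag_none, pd_metricDiag_none_some,
    pd_metricDiag_some_some, zero_mul, mul_zero, zero_add]
  have hdiag : ∀ q, C.metricDiag (typeI n Y s) (some q)
      = C.potH (pad n (Y fun a => s (some a))) := fun q => rfl
  have hx : (fun q => typeI n Y s (some q)) = pad n (Y fun a => s (some a)) := rfl
  simp only [hdiag, hx, along]
  set H := C.potH (pad n (Y fun a => s (some a)))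
  set x := pad n (Y fun a => s (some a))
  set A := ∑ q, V (some q) * pd C.potH q x
  set B := ∑ q, W (some q) * pd C.potH q x
  have h3 : ∀ q, ∑ p, V (some p) * W (some p) * pd C.potH q x
      = (∑ p, V (some p) * W (some p)) * pd C.potH q x := fun q => by
    rw [Finset.sum_mul]
  simp only [h3]
  set E := ∑ p, V (some p) * W (some p)
  have h4 : ∑ q, m (some q) * H⁻¹ * (W (some q) * A + V (some q) * B
      - (V none * W none * -pd C.potF q x + E * pd C.potH q x))
      = H⁻¹ * (A * ∑ q, m (some q) * W (some q) + B * ∑ q, m (some q) * V (some q)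
        + (∑ q, m (some q) * pd C.potF q x) * (V none * W none)
        - (∑ q, m (some q) * pd C.potH q x) * E) := by
    simp only [Finset.mul_sum, Finset.sum_mul, ← Finset.sum_add_distrib,
      ← Finset.sum_sub_distrib]
    refine Finset.sum_congr rfl fun q _ => ?_
    ring
  rw [h4, hV, hW]
  field_simp
  ring

theorem extrinsic_none_none {m : STIndex n → ℝ} (hm : IsNormal (typeI n Y) s m)
    (hF : C.potF (pad n (Y fun a => s (some a))) ≠ 0)
    (hH : C.potH (pad n (Y fun a => s (some a))) ≠ 0) :
    extrinsic C.metric (typeI n Y) s m none none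
    = (2 * C.potH (pad n (Y fun a => s (some a))))⁻¹ * along C.potF Y s m := by
  unfold extrinsic
  rw [sum_christoffel_typeI hm hF hH]
  · simp [pd_tangent_none_left, tangent_none_none, tangent_none_some]
  · simp [tangent_none_some]
  · simp [tangent_none_some]

theorem sum_normal_tangent {m : STIndex n → ℝ} (hm : IsNormal (typeI n Y) s m) (a : Fin 2) :
    ∑ q, m (some q) * tangent (typeI n Y) s (some a) (some q) = 0 := by
  simp only [tangent_some_some]
  rw [sum_mul_pad]
  exact (isNormal_typeI.1 hm).2 a

theorem extrinsic_none_some {m : STIndex n → ℝ} (hm : IsNormal (typeI n Y) s m)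
    (hF : C.potF (pad n (Y fun a => s (some a))) ≠ 0)
    (hH : C.potH (pad n (Y fun a => s (some a))) ≠ 0)
    (a : Fin 2) :
    extrinsic C.metric (typeI n Y) s m none (some a) = 0 := by
  unfold extrinsic
  rw [sum_christoffel_typeI hm hF hH]
  · simp [pd_tangent_none_left, tangent_some_none, tangent_none_some]
  · simp [tangent_none_some]
  · exact sum_normal_tangent hm a

theorem extrinsic_some_none {m : STIndex n → ℝ} (hm : IsNormal (typeI n Y) s m)
    (hF : C.potF (pad n (Y fun a => s (some a))) ≠ 0)
    (hH : C.potH (pad n (Y fun a => s (some a))) ≠ 0)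
    (a : Fin 2) :
    extrinsic C.metric (typeI n Y) s m (some a) none = 0 := by
  unfold extrinsic
  rw [sum_christoffel_typeI hm hF hH]
  · simp [pd_tangent_none_right, tangent_some_none, tangent_none_some]
  · exact sum_normal_tangent hm a
  · simp [tangent_none_some]

/-- The usual behaviour of a second fundamental form under a conformal change of the spatial metric:
the Euclidean form plus a multiple of the first fundamental form. -/
theorem extrinsic_some_some {m : STIndex n → ℝ} (hm : IsNormal (typeI n Y) s m)
    (hF : C.potF (pad n (Y fun a => s (some a))) ≠ 0)
    (hH : C.potH (pad n (Y fun a => s (some a))) ≠ 0)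
    (a b : Fin 2) :
    extrinsic C.metric (typeI n Y) s m (some a) (some b)
      = (trunc fun q => m (some q)) ⬝ᵥ hess Y (fun a => s (some a)) a b
        - (2 * C.potH (pad n (Y fun a => s (some a))))⁻¹ * along C.potH Y s m *
          (tangent Y (fun a => s (some a)) a ⬝ᵥ tangent Y (fun a => s (some a)) b) := by
  unfold extrinsic
  rw [sum_christoffel_typeI hm hF hH _ _ (sum_normal_tangent hm a)
    (sum_normal_tangent hm b)]
  rw [Fintype.sum_option]
  simp only [pd_tangent_none, pd_tangent_some]
  simp only [tangent_some_none, tangent_some_some, mul_zero, zero_add, zero_sub]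
  rw [sum_mul_pad, sum_mul_pad, trunc_pad]
  ring

end ConformalRadius

end

section

/-! ## The extrinsic equation of a Type I embedding -/

/-- First fundamental form of a surface in Euclidean space. -/
def firstForm (Y : (Fin 2 → ℝ) → Fin 3 → ℝ) (σ : Fin 2 → ℝ) : Matrix (Fin 2) (Fin 2) ℝ :=
  Matrix.of fun a b => tangent Y σ a ⬝ᵥ tangent Y σ b

/-- Euclidean length squared of the velocity `χ`. -/
def speedSq (Y : (Fin 2 → ℝ) → Fin 3 → ℝ) (χ : (Fin 2 → ℝ) → Fin 2 → ℝ) (σ : Fin 2 → ℝ) : ℝ :=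
  ∑ a, ∑ b, (tangent Y σ a ⬝ᵥ tangent Y σ b) * χ σ a * χ σ b

/-- Second fundamental form along `N`, evaluated on `χ`. -/
def normalAcc (Y : (Fin 2 → ℝ) → Fin 3 → ℝ) (χ : (Fin 2 → ℝ) → Fin 2 → ℝ) (σ : Fin 2 → ℝ)
    (N : Fin 3 → ℝ) : ℝ :=
  ∑ a, ∑ b, χ σ a * χ σ b * (N ⬝ᵥ hess Y σ a b)

/-- Twice the Euclidean mean curvature along `N`. -/
def euclMean (Y : (Fin 2 → ℝ) → Fin 3 → ℝ) (σ : Fin 2 → ℝ) (N : Fin 3 → ℝ) : ℝ :=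
  ∑ a, ∑ b, (firstForm Y σ)⁻¹ a b * (N ⬝ᵥ hess Y σ a b)

variable {Y : (Fin 2 → ℝ) → Fin 3 → ℝ} {χ : (Fin 2 → ℝ) → Fin 2 → ℝ} {s : WVIndex → ℝ}

theorem induced_one_eq (σ : Fin 2 → ℝ) :
    induced (fun _ => (1 : Matrix (Fin 3) (Fin 3) ℝ)) Y σ = firstForm Y σ := by
  ext a b
  exact induced_one Y σ a b

theorem meanCurv_one (σ : Fin 2 → ℝ) (N : Fin 3 → ℝ) :
    meanCurv (fun _ => (1 : Matrix (Fin 3) (Fin 3) ℝ)) Y σ N = euclMean Y σ N := by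
  unfold meanCurv euclMean
  rw [induced_one_eq]
  simp only [extrinsic_one]
  rfl

theorem firstForm_symm (σ : Fin 2 → ℝ) (a b : Fin 2) : firstForm Y σ a b = firstForm Y σ b a := by
  simp only [firstForm, Matrix.of_apply]
  exact dotProduct_comm _ _

theorem firstForm_det_ne_zero {σ : Fin 2 → ℝ} (h : LinearIndependent ℝ (tangent Y σ)) :
    (firstForm Y σ).det ≠ 0 := by
  intro h0
  obtain ⟨v, hv, hv'⟩ := Matrix.exists_mulVec_eq_zero_iff.2 h0
  apply hv
  have h1 : v 0 • tangent Y σ 0 + v 1 • tangent Y σ 1 = 0 := by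
    rw [← dotProduct_self_eq_zero]
    have h2 := congrFun hv' 0
    have h3 := congrFun hv' 1
    simp only [Matrix.mulVec, dotProduct, Fin.sum_univ_two, firstForm, Matrix.of_apply,
      Fin.sum_univ_three, Pi.zero_apply] at h2 h3
    simp only [dotProduct, Fin.sum_univ_three, Pi.add_apply, Pi.smul_apply, smul_eq_mul]
    linear_combination v 0 * h2 + v 1 * h3
  have h2 := Fintype.linearIndependent_iff.1 h v (by rw [Fin.sum_univ_two]; exact h1)
  ext i
  exact h2 i

theorem sum_inv_firstForm {σ : Fin 2 → ℝ} (h : (firstForm Y σ).det ≠ 0) :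
    ∑ a, ∑ b, (firstForm Y σ)⁻¹ a b * firstForm Y σ a b = 2 := by
  have h1 := congrArg Matrix.trace (Matrix.nonsing_inv_mul (firstForm Y σ) (Ne.isUnit h))
  rw [Matrix.trace_one, Fintype.card_fin] at h1
  simp only [Matrix.trace, Matrix.diag, Matrix.mul_apply] at h1
  push_cast at h1
  rw [← h1]
  refine Finset.sum_congr rfl fun a _ => Finset.sum_congr rfl fun b _ => ?_
  rw [firstForm_symm σ a b]

namespace ConformalRadius

variable {C : ConformalRadius n rm L}

theorem kSq_typeI : kSq C.metric (typeI n Y) (wvField χ) s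
    = C.potF (pad n (Y fun a => s (some a)))
      - C.potH (pad n (Y fun a => s (some a))) * speedSq Y χ (fun a => s (some a)) := by
  unfold kSq speedSq
  simp only [Fintype.sum_option, induced_none_none, induced_none_some, induced_some_none,
    induced_some_some, wvField, Fin.sum_univ_two]
  ring

/-- The induced metric is block diagonal. Euclidean minimality removes the Hessian part of the
spatial trace, and the conformal correction is traced against the identity, giving the factor two.
-/
theorem meanCurv_typeI {m : STIndex n → ℝ} (hm : IsNormal (typeI n Y) s m)
    (hF : C.potF (pad n (Y fun a => s (some a))) ≠ 0)
    (hH : C.potH (pad n (Y fun a => s (some a))) ≠ 0)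
    (hdet : (firstForm Y fun a => s (some a)).det ≠ 0)
    (hmin : euclMean Y (fun a => s (some a)) (trunc fun q => m (some q)) = 0) :
    meanCurv C.metric (typeI n Y) s m
      = -(2 * C.potF (pad n (Y fun a => s (some a))) *
          C.potH (pad n (Y fun a => s (some a))))⁻¹ * along C.potF Y s m
        - (C.potH (pad n (Y fun a => s (some a))) ^ 2)⁻¹ * along C.potH Y s m := by
  set σ : Fin 2 → ℝ := fun a => s (some a) with hσ
  set F := C.potF (pad n (Y σ)) with hFdef
  set H := C.potH (pad n (Y σ)) with hHdef
  have hinv : (induced C.metric (typeI n Y) s)⁻¹ = Matrix.of fun a b : WVIndex => match a, b with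
      | none, none => -F⁻¹
      | none, some _ => 0
      | some _, none => 0
      | some a, some b => H⁻¹ * (firstForm Y σ)⁻¹ a b := by
    refine Matrix.inv_eq_right_inv ?_
    have hmul := Matrix.mul_nonsing_inv (firstForm Y σ) (Ne.isUnit hdet)
    ext a b
    rw [Matrix.mul_apply, Fintype.sum_option]
    rcases a with _ | a <;> rcases b with _ | b
    · simp only [induced_none_none, induced_none_some, Matrix.of_apply, ← hσ, ← hFdef]
      simp [hF]
    · simp [induced_none_some]
    · simp [induced_some_none]
    · have h1 := congrFun (congrFun hmul a) b
      rw [Matrix.mul_apply] at h1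
      simp only [induced_some_none, induced_some_some, Matrix.of_apply, zero_mul, zero_add,
        ← hσ, ← hHdef, Matrix.one_apply, Option.some.injEq]
      rw [Matrix.one_apply] at h1
      rw [← h1]
      refine Finset.sum_congr rfl fun c _ => ?_
      simp only [firstForm, Matrix.of_apply]
      field_simp
  unfold meanCurv
  rw [hinv]
  simp only [Fintype.sum_option, Matrix.of_apply, zero_mul, zero_add, add_zero,
    Finset.sum_const_zero, extrinsic_none_none hm hF hH, extrinsic_some_some hm hF hH]
  simp only [← hσ, ← hHdef]
  have h2 := sum_inv_firstForm hdet
  have hmin' := hmin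
  unfold euclMean at hmin'
  set t := along C.potH Y s m
  set aF := along C.potF Y s m
  have h3 : ∑ a, ∑ b, H⁻¹ * (firstForm Y σ)⁻¹ a b * ((trunc fun q => m (some q)) ⬝ᵥ hess Y σ a b
      - (2 * H)⁻¹ * t * (tangent Y σ a ⬝ᵥ tangent Y σ b))
      = H⁻¹ * (∑ a, ∑ b, (firstForm Y σ)⁻¹ a b * ((trunc fun q => m (some q)) ⬝ᵥ hess Y σ a b))
        - H⁻¹ * ((2 * H)⁻¹ * t) * ∑ a, ∑ b, (firstForm Y σ)⁻¹ a b * firstForm Y σ a b := by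
    simp only [Finset.mul_sum, ← Finset.sum_sub_distrib]
    refine Finset.sum_congr rfl fun a _ => Finset.sum_congr rfl fun b _ => ?_
    simp only [firstForm, Matrix.of_apply]
    ring
  rw [h3, h2, hmin']
  field_simp
  ring

theorem sum_velocity_extrinsic {m : STIndex n → ℝ} (hm : IsNormal (typeI n Y) s m)
    (hF : C.potF (pad n (Y fun a => s (some a))) ≠ 0)
    (hH : C.potH (pad n (Y fun a => s (some a))) ≠ 0)
    (hk : 0 < kSq C.metric (typeI n Y) (wvField χ) s) :
    ∑ a, ∑ b, velocity C.metric (typeI n Y) (wvField χ) s a *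
        velocity C.metric (typeI n Y) (wvField χ) s b * extrinsic C.metric (typeI n Y) s m a b
      = (kSq C.metric (typeI n Y) (wvField χ) s)⁻¹ *
        ((2 * C.potH (pad n (Y fun a => s (some a))))⁻¹ * along C.potF Y s m
          + normalAcc Y χ (fun a => s (some a)) (trunc fun q => m (some q))
          - (2 * C.potH (pad n (Y fun a => s (some a))))⁻¹ * along C.potH Y s m *
            speedSq Y χ (fun a => s (some a))) := by
  set k := kSq C.metric (typeI n Y) (wvField χ) s with hkdef
  have hvel : ∀ a b, velocity C.metric (typeI n Y) (wvField χ) s a *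
      velocity C.metric (typeI n Y) (wvField χ) s b = k⁻¹ * (wvField χ s a * wvField χ s b) := by
    intro a b
    unfold velocity
    rw [← hkdef, div_mul_div_comm, Real.mul_self_sqrt hk.le]
    ring
  simp only [hvel]
  simp only [Fintype.sum_option, extrinsic_none_none hm hF hH, extrinsic_some_some hm hF hH,
    extrinsic_none_some hm hF hH, extrinsic_some_none hm hF hH]
  unfold speedSq normalAcc
  simp only [wvField, Fin.sum_univ_two]
  ring

/-- In a plane through the origin with vanishing second fundamental form the extrinsic equation
holds. -/
theorem extrinsic_eq_of_flat {m : STIndex n → ℝ} (hm : IsNormal (typeI n Y) s m)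
    (hF : C.potF (pad n (Y fun a => s (some a))) ≠ 0)
    (hH : C.potH (pad n (Y fun a => s (some a))) ≠ 0)
    (hdet : (firstForm Y fun a => s (some a)).det ≠ 0)
    (hk : 0 < kSq C.metric (typeI n Y) (wvField χ) s)
    (h0 : (trunc fun q => m (some q)) ⬝ᵥ Y (fun a => s (some a)) = 0)
    (h2 : ∀ a b, (trunc fun q => m (some q)) ⬝ᵥ hess Y (fun a => s (some a)) a b = 0) :
    meanCurv C.metric (typeI n Y) s m
      = n * ∑ a, ∑ b, velocity C.metric (typeI n Y) (wvField χ) s a *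
        velocity C.metric (typeI n Y) (wvField χ) s b * extrinsic C.metric (typeI n Y) s m a b := by
  have horth : (fun q => m (some q)) ⬝ᵥ pad n (Y fun a => s (some a)) = 0 := by
    rw [dotProduct, sum_mul_pad, h0]
  have h3 : along C.potF Y s m = 0 :=
    (sum_mul_pd C.potF _ _).trans
      (fderiv_radial_orthogonal (fun r => fSdS n rm L (C.R r)) horth)
  have h4 : along C.potH Y s m = 0 :=
    (sum_mul_pd C.potH _ _).trans (fderiv_radial_orthogonal (fun r => (C.h r)⁻¹) horth)
  rw [meanCurv_typeI hm hF hH hdet (by simp [euclMean, h2]), sum_velocity_extrinsic hm hF hH hk,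
    h3, h4]
  simp [normalAcc, h2]

theorem potF_pad (y : Fin 3 → ℝ) : C.potF (pad n y) = fSdS n rm L (C.R (euclid y)) := by
  unfold potF; rw [euclid_pad]

theorem potH_pad (y : Fin 3 → ℝ) : C.potH (pad n y) = (C.h (euclid y))⁻¹ := by
  unfold potH; rw [euclid_pad]

theorem along_radial {F : (Fin (n + 4) → ℝ) → ℝ} {φ : ℝ → ℝ} {φ' : ℝ} {m : STIndex n → ℝ}
    (hF : F = fun x => φ (euclid x)) (hY : Y (fun a => s (some a)) ≠ 0)
    (hφ : HasDerivAt φ φ' (euclid (Y fun a => s (some a)))) :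
    along F Y s m = φ' * (((trunc fun q => m (some q)) ⬝ᵥ Y fun a => s (some a)) /
      euclid (Y fun a => s (some a))) := by
  unfold along
  have hx : pad n (Y fun a => s (some a)) ≠ 0 := fun h => hY (pad_eq_zero.1 h)
  have h1 : ∀ q, pd F q (pad n (Y fun a => s (some a)))
      = φ' * (pad n (Y fun a => s (some a)) q / euclid (Y fun a => s (some a))) := fun q => by
    rw [hF, pd_radial hx (by rwa [euclid_pad]), euclid_pad]
  simp only [h1]
  rw [← sum_mul_pad, Finset.sum_div, Finset.mul_sum]
  refine Finset.sum_congr rfl fun q _ => ?_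
  ring

/-- Inserting the radial derivatives of `f` and `h⁻¹` turns every normal derivative into a multiple
of the support function; multiplying by the nonvanishing denominators leaves a polynomial relation.
-/
theorem extrinsic_eq_iff_bf (hrm : 0 ≤ rm) (hL : 0 < L) {m : STIndex n → ℝ}
    (hm : IsNormal (typeI n Y) s m) (hJ : euclid (Y fun a => s (some a)) ∈ C.J)
    (hY : Y (fun a => s (some a)) ≠ 0)
    (hdet : (firstForm Y fun a => s (some a)).det ≠ 0)
    (hmin : euclMean Y (fun a => s (some a)) (trunc fun q => m (some q)) = 0)
    (hk : 0 < kSq C.metric (typeI n Y) (wvField χ) s) :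
    meanCurv C.metric (typeI n Y) s m
      = n * ∑ a, ∑ b, velocity C.metric (typeI n Y) (wvField χ) s a *
        velocity C.metric (typeI n Y) (wvField χ) s b * extrinsic C.metric (typeI n Y) s m a b ↔
    C.bf (euclid (Y fun a => s (some a))) (speedSq Y χ fun a => s (some a))
      ((trunc fun q => m (some q)) ⬝ᵥ Y fun a => s (some a))
      (normalAcc Y χ (fun a => s (some a)) (trunc fun q => m (some q))) = 0 := by
  have hs := euclid_pos hY
  have hR := R_pos hJ hs
  have hv := lapse_pos hJ
  have hF : C.potF (pad n (Y fun a => s (some a))) ≠ 0 := by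
    rw [potF_pad]; exact (f_pos hJ).ne'
  have hH : C.potH (pad n (Y fun a => s (some a))) ≠ 0 := by
    rw [potH_pad]; exact (inv_pos.2 (C.h_pos _ hJ)).ne'
  rw [meanCurv_typeI hm hF hH hdet hmin, sum_velocity_extrinsic hm hF hH hk]
  rw [kSq_typeI] at hk ⊢
  rw [along_radial (F := C.potF) rfl hY (hasDerivAt_f hrm hL hJ hs),
    along_radial (F := C.potH) rfl hY (hasDerivAt_h_inv hrm hL hJ hs)]
  rw [potF_pad, potH_pad, h_inv hJ hs, ← lapse_sq hJ] at *
  unfold bf bfExpr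
  set r := C.R (euclid (Y fun a => s (some a)))
  set v := C.lapse (euclid (Y fun a => s (some a)))
  set g := C.slope (euclid (Y fun a => s (some a)))
  set x := euclid (Y fun a => s (some a))
  set Q := (trunc fun q => m (some q)) ⬝ᵥ Y fun a => s (some a)
  set P := speedSq Y χ fun a => s (some a)
  set A := normalAcc Y χ (fun a => s (some a)) (trunc fun q => m (some q))
  -- `𝐤²` is made the independent variable in place of `P`, so that the positive denominator in the
  -- velocity can be cleared.
  set k := v ^ 2 - (r / x) ^ 2 * P with hkdef
  have hPx : P * r ^ 2 / x ^ 2 = v ^ 2 - k := by rw [hkdef]; field_simp; ring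
  have hP : P = (v ^ 2 - k) * x ^ 2 / r ^ 2 := by rw [← hPx]; field_simp
  rw [hPx, hP]
  clear_value k
  constructor
  · intro h
    field_simp at h
    linear_combination (-1) * h
  · intro h
    field_simp
    linear_combination (-1) * h

end ConformalRadius

end

section

/-! ## Helicoids, catenoids and Scherk surfaces -/

theorem euclMean_eq (Y : (Fin 2 → ℝ) → Fin 3 → ℝ) (σ : Fin 2 → ℝ) (N : Fin 3 → ℝ) :
    euclMean Y σ N = (firstForm Y σ).det⁻¹ *
      (firstForm Y σ 1 1 * (N ⬝ᵥ hess Y σ 0 0) - firstForm Y σ 0 1 * (N ⬝ᵥ hess Y σ 0 1)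
        - firstForm Y σ 1 0 * (N ⬝ᵥ hess Y σ 1 0) + firstForm Y σ 0 0 * (N ⬝ᵥ hess Y σ 1 1)) := by
  unfold euclMean
  rw [Matrix.inv_def, Matrix.adjugate_fin_two, Ring.inverse_eq_inv']
  simp [Fin.sum_univ_two]
  ring

theorem pd_zero_of_hasDerivAt {G : ℝ → ℝ → ℝ} {σ : Fin 2 → ℝ} {d : ℝ}
    (hG : DifferentiableAt ℝ (fun y : Fin 2 → ℝ => G (y 0) (y 1)) σ)
    (h : HasDerivAt (fun t => G t (σ 1)) d (σ 0)) :
    pd (fun y : Fin 2 → ℝ => G (y 0) (y 1)) 0 σ = d := by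
  have hl : HasDerivAt (fun t : ℝ => (σ + (t - σ 0) • (Pi.single 0 1 : Fin 2 → ℝ)))
      (Pi.single 0 1) (σ 0) := by
    have := (((hasDerivAt_id (σ 0)).sub_const (σ 0)).smul_const
      (Pi.single 0 1 : Fin 2 → ℝ)).const_add σ
    simpa using this
  have h0 : σ + (σ 0 - σ 0) • (Pi.single 0 1 : Fin 2 → ℝ) = σ := by simp
  have h1 := HasFDerivAt.comp_hasDerivAt (σ 0) (by rw [h0]; exact hG.hasFDerivAt) hl
  rw [pd]
  refine h1.unique (h.congr_of_eventuallyEq (Filter.Eventually.of_forall fun t => ?_))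
  simp

theorem pd_one_of_hasDerivAt {G : ℝ → ℝ → ℝ} {σ : Fin 2 → ℝ} {d : ℝ}
    (hG : DifferentiableAt ℝ (fun y : Fin 2 → ℝ => G (y 0) (y 1)) σ)
    (h : HasDerivAt (fun t => G (σ 0) t) d (σ 1)) :
    pd (fun y : Fin 2 → ℝ => G (y 0) (y 1)) 1 σ = d := by
  have hl : HasDerivAt (fun t : ℝ => (σ + (t - σ 1) • (Pi.single 1 1 : Fin 2 → ℝ)))
      (Pi.single 1 1) (σ 1) := by
    have := (((hasDerivAt_id (σ 1)).sub_const (σ 1)).smul_const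
      (Pi.single 1 1 : Fin 2 → ℝ)).const_add σ
    simpa using this
  have h0 : σ + (σ 1 - σ 1) • (Pi.single 1 1 : Fin 2 → ℝ) = σ := by simp
  have h1 := HasFDerivAt.comp_hasDerivAt (σ 1) (by rw [h0]; exact hG.hasFDerivAt) hl
  rw [pd]
  refine h1.unique (h.congr_of_eventuallyEq (Filter.Eventually.of_forall fun t => ?_))
  simp

section scherk

variable (a c l : ℝ)

/-- Coordinate tangent vector `∂_ρ` of the Scherk surfaces. -/
def scherkRho (σ : Fin 2 → ℝ) : Fin 3 → ℝ :=
  ![l * Real.cosh (σ 0 / c) * Real.sin (a * σ 1)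
      + Real.sqrt (1 - l ^ 2) * Real.sinh (σ 0 / c) * Real.cos (a * σ 1),
    -(l * Real.cosh (σ 0 / c) * Real.cos (a * σ 1))
      + Real.sqrt (1 - l ^ 2) * Real.sinh (σ 0 / c) * Real.sin (a * σ 1),
    Real.sqrt (1 - l ^ 2)]

/-- Coordinate tangent vector `∂_φ` of the Scherk surfaces. -/
def scherkPhi (σ : Fin 2 → ℝ) : Fin 3 → ℝ :=
  ![a * (l * (c * Real.sinh (σ 0 / c)) * Real.cos (a * σ 1)
      - Real.sqrt (1 - l ^ 2) * (c * Real.cosh (σ 0 / c)) * Real.sin (a * σ 1)),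
    a * (l * (c * Real.sinh (σ 0 / c)) * Real.sin (a * σ 1)
      + Real.sqrt (1 - l ^ 2) * (c * Real.cosh (σ 0 / c)) * Real.cos (a * σ 1)),
    l * (c * a)]

/-- Normal vector of the Scherk surfaces. -/
def scherkNormal (σ : Fin 2 → ℝ) : Fin 3 → ℝ :=
  ![-Real.cos (a * σ 1), -Real.sin (a * σ 1), Real.sinh (σ 0 / c)]

variable {a c l}

theorem hasDerivAt_sinh_div (hc : c ≠ 0) (x : ℝ) :
    HasDerivAt (fun t => c * Real.sinh (t / c)) (Real.cosh (x / c)) x := by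
  refine (((hasDerivAt_id x).div_const c).sinh.const_mul c).congr_deriv ?_
  simp only [id]
  field_simp

theorem hasDerivAt_cosh_div (hc : c ≠ 0) (x : ℝ) :
    HasDerivAt (fun t => c * Real.cosh (t / c)) (Real.sinh (x / c)) x := by
  refine (((hasDerivAt_id x).div_const c).cosh.const_mul c).congr_deriv ?_
  simp only [id]
  field_simp

theorem hasDerivAt_sin_mul (x : ℝ) :
    HasDerivAt (fun t => Real.sin (a * t)) (a * Real.cos (a * x)) x := by
  refine (((hasDerivAt_id x).const_mul a).sin).congr_deriv ?_
  simp only [id]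
  ring

theorem hasDerivAt_cos_mul (x : ℝ) :
    HasDerivAt (fun t => Real.cos (a * t)) (-(a * Real.sin (a * x))) x := by
  refine (((hasDerivAt_id x).const_mul a).cos).congr_deriv ?_
  simp only [id]
  ring

theorem tangent_scherk_zero (hc : c ≠ 0) (σ : Fin 2 → ℝ) :
    tangent (scherk a c l) σ 0 = scherkRho a c l σ := by
  ext i
  unfold tangent scherk scherkRho
  fin_cases i
  · refine pd_zero_of_hasDerivAt (G := fun x y => l * (c * Real.sinh (x / c)) * Real.sin (a * y)
      + Real.sqrt (1 - l ^ 2) * (c * Real.cosh (x / c)) * Real.cos (a * y)) (by fun_prop) ?_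
    exact (((hasDerivAt_sinh_div hc _).const_mul l).mul_const _).add
      (((hasDerivAt_cosh_div hc _).const_mul _).mul_const _)
  · refine pd_zero_of_hasDerivAt (G := fun x y => -(l * (c * Real.sinh (x / c)) * Real.cos (a * y))
      + Real.sqrt (1 - l ^ 2) * (c * Real.cosh (x / c)) * Real.sin (a * y)) (by fun_prop) ?_
    exact (((hasDerivAt_sinh_div hc _).const_mul l).mul_const _).neg.add
      (((hasDerivAt_cosh_div hc _).const_mul _).mul_const _)
  · refine pd_zero_of_hasDerivAt (G := fun x y => l * (c * a * y) + Real.sqrt (1 - l ^ 2) * x)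
      (by fun_prop) ?_
    simpa using ((hasDerivAt_id (σ 0)).const_mul (Real.sqrt (1 - l ^ 2))).const_add
      (l * (c * a * σ 1))

theorem tangent_scherk_one (σ : Fin 2 → ℝ) :
    tangent (scherk a c l) σ 1 = scherkPhi a c l σ := by
  ext i
  unfold tangent scherk scherkPhi
  fin_cases i
  · refine pd_one_of_hasDerivAt (G := fun x y => l * (c * Real.sinh (x / c)) * Real.sin (a * y)
      + Real.sqrt (1 - l ^ 2) * (c * Real.cosh (x / c)) * Real.cos (a * y)) (by fun_prop) ?_
    refine (((hasDerivAt_sin_mul _).const_mul _).add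
      ((hasDerivAt_cos_mul _).const_mul _)).congr_deriv ?_
    simp; ring
  · refine pd_one_of_hasDerivAt (G := fun x y => -(l * (c * Real.sinh (x / c)) * Real.cos (a * y))
      + Real.sqrt (1 - l ^ 2) * (c * Real.cosh (x / c)) * Real.sin (a * y)) (by fun_prop) ?_
    refine (((hasDerivAt_cos_mul _).const_mul _).neg.add
      ((hasDerivAt_sin_mul _).const_mul _)).congr_deriv ?_
    simp; ring
  · refine pd_one_of_hasDerivAt (G := fun x y => l * (c * a * y) + Real.sqrt (1 - l ^ 2) * x)
      (by fun_prop) ?_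
    simpa using (((hasDerivAt_id (σ 1)).const_mul (c * a)).const_mul l).add_const
      (Real.sqrt (1 - l ^ 2) * σ 0)

theorem hess_scherk_zero_zero (hc : c ≠ 0) (σ : Fin 2 → ℝ) :
    hess (scherk a c l) σ 0 0 =
      ![(l * (c * Real.sinh (σ 0 / c)) * Real.sin (a * σ 1)
          + Real.sqrt (1 - l ^ 2) * (c * Real.cosh (σ 0 / c)) * Real.cos (a * σ 1)) / c ^ 2,
        (-(l * (c * Real.sinh (σ 0 / c)) * Real.cos (a * σ 1))
          + Real.sqrt (1 - l ^ 2) * (c * Real.cosh (σ 0 / c)) * Real.sin (a * σ 1)) / c ^ 2, 0] := by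
  have hch : ∀ x, HasDerivAt (fun t => Real.cosh (t / c)) (Real.sinh (x / c) / c) x := fun x => by
    simpa [div_eq_mul_inv] using ((hasDerivAt_id x).div_const c).cosh
  have hsh : ∀ x, HasDerivAt (fun t => Real.sinh (t / c)) (Real.cosh (x / c) / c) x := fun x => by
    simpa [div_eq_mul_inv] using ((hasDerivAt_id x).div_const c).sinh
  ext i
  unfold hess
  simp only [tangent_scherk_zero hc]
  unfold scherkRho
  fin_cases i
  · refine pd_zero_of_hasDerivAt (G := fun x y => l * Real.cosh (x / c) * Real.sin (a * y)
      + Real.sqrt (1 - l ^ 2) * Real.sinh (x / c) * Real.cos (a * y)) (by fun_prop) ?_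
    refine ((((hch _).const_mul l).mul_const _).add
      (((hsh _).const_mul _).mul_const _)).congr_deriv ?_
    simp; field_simp
  · refine pd_zero_of_hasDerivAt (G := fun x y => -(l * Real.cosh (x / c) * Real.cos (a * y))
      + Real.sqrt (1 - l ^ 2) * Real.sinh (x / c) * Real.sin (a * y)) (by fun_prop) ?_
    refine ((((hch _).const_mul l).mul_const _).neg.add
      (((hsh _).const_mul _).mul_const _)).congr_deriv ?_
    simp; field_simp
  · exact pd_const _ _ _

theorem hess_scherk_one_one (σ : Fin 2 → ℝ) :
    hess (scherk a c l) σ 1 1 =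
      ![-a ^ 2 * (l * (c * Real.sinh (σ 0 / c)) * Real.sin (a * σ 1)
          + Real.sqrt (1 - l ^ 2) * (c * Real.cosh (σ 0 / c)) * Real.cos (a * σ 1)),
        -a ^ 2 * (-(l * (c * Real.sinh (σ 0 / c)) * Real.cos (a * σ 1))
          + Real.sqrt (1 - l ^ 2) * (c * Real.cosh (σ 0 / c)) * Real.sin (a * σ 1)), 0] := by
  ext i
  unfold hess
  simp only [tangent_scherk_one]
  unfold scherkPhi
  fin_cases i
  · refine pd_one_of_hasDerivAt (G := fun x y => a * (l * (c * Real.sinh (x / c)) * Real.cos (a * y)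
      - Real.sqrt (1 - l ^ 2) * (c * Real.cosh (x / c)) * Real.sin (a * y))) (by fun_prop) ?_
    refine ((((hasDerivAt_cos_mul _).const_mul _).sub
      ((hasDerivAt_sin_mul _).const_mul _)).const_mul a).congr_deriv ?_
    simp; ring
  · refine pd_one_of_hasDerivAt (G := fun x y => a * (l * (c * Real.sinh (x / c)) * Real.sin (a * y)
      + Real.sqrt (1 - l ^ 2) * (c * Real.cosh (x / c)) * Real.cos (a * y))) (by fun_prop) ?_
    refine ((((hasDerivAt_sin_mul _).const_mul _).add
      ((hasDerivAt_cos_mul _).const_mul _)).const_mul a).congr_deriv ?_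
    simp; ring
  · exact pd_const _ _ _

end scherk

/-! ### Fundamental forms and support function of the Scherk family -/

section algebra


theorem sqrt_one_sub_sq {l : ℝ} (hl0 : 0 ≤ l) (hl1 : l ≤ 1) :
    Real.sqrt (1 - l ^ 2) ^ 2 = 1 - l ^ 2 := Real.sq_sqrt (by nlinarith)

/-- The surfaces form an associated family: the first fundamental form is independent of `l`, a
mixture of catenoid and helicoid with coefficients on the unit circle. -/
theorem firstForm_scherk {a c l : ℝ} (hc : 0 < c) (hl0 : 0 ≤ l) (hl1 : l ≤ 1) (σ : Fin 2 → ℝ) :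
    firstForm (scherk a c l) σ 0 0 = Real.cosh (σ 0 / c) ^ 2 ∧
    firstForm (scherk a c l) σ 0 1 = 0 ∧ firstForm (scherk a c l) σ 1 0 = 0 ∧
    firstForm (scherk a c l) σ 1 1 = a ^ 2 * (c ^ 2 * Real.cosh (σ 0 / c) ^ 2) := by
  have hμ := sqrt_one_sub_sq hl0 hl1
  have hh := Real.cosh_sq (σ 0 / c)
  have ht := Real.sin_sq_add_cos_sq (a * σ 1)
  have h01 : firstForm (scherk a c l) σ 0 1 = 0 := by
    simp only [firstForm, Matrix.of_apply, tangent_scherk_zero hc.ne', tangent_scherk_one,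
      scherkRho, scherkPhi, dotProduct, Fin.sum_univ_three]
    simp
    set μ := Real.sqrt (1 - l ^ 2)
    set S := Real.sinh (σ 0 / c)
    set K := Real.cosh (σ 0 / c)
    set x := Real.sin (a * σ 1)
    set y := Real.cos (a * σ 1)
    linear_combination (a * c * l * μ * (S ^ 2 - K ^ 2)) * ht - a * c * l * μ * hh
  refine ⟨?_, h01, by rw [firstForm_symm]; exact h01, ?_⟩
  · simp only [firstForm, Matrix.of_apply, tangent_scherk_zero hc.ne',
      scherkRho, dotProduct, Fin.sum_univ_three]
    simp
    set μ := Real.sqrt (1 - l ^ 2)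
    set S := Real.sinh (σ 0 / c)
    set K := Real.cosh (σ 0 / c)
    set x := Real.sin (a * σ 1)
    set y := Real.cos (a * σ 1)
    linear_combination (l ^ 2 * K ^ 2 + μ ^ 2 * S ^ 2) * ht + (S ^ 2 + 1) * hμ + (l ^ 2 - 1) * hh
  · simp only [firstForm, Matrix.of_apply, tangent_scherk_one,
      scherkPhi, dotProduct, Fin.sum_univ_three]
    simp
    set μ := Real.sqrt (1 - l ^ 2)
    set S := Real.sinh (σ 0 / c)
    set K := Real.cosh (σ 0 / c)
    set x := Real.sin (a * σ 1)
    set y := Real.cos (a * σ 1)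
    linear_combination (a ^ 2 * c ^ 2 * (l ^ 2 * S ^ 2 + μ ^ 2 * K ^ 2)) * ht
      + a ^ 2 * c ^ 2 * K ^ 2 * hμ - a ^ 2 * c ^ 2 * l ^ 2 * hh

/-- The height `x³` on the Scherk surfaces. -/
def scherkZ (a c l : ℝ) (σ : Fin 2 → ℝ) : ℝ := l * (c * a * σ 1) + Real.sqrt (1 - l ^ 2) * σ 0

theorem scherk_dotProduct_self {a c l : ℝ} (hl0 : 0 ≤ l) (hl1 : l ≤ 1) (σ : Fin 2 → ℝ) :
    scherk a c l σ ⬝ᵥ scherk a c l σ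
      = c ^ 2 * (Real.cosh (σ 0 / c) ^ 2 - l ^ 2) + scherkZ a c l σ ^ 2 := by
  have hμ := sqrt_one_sub_sq hl0 hl1
  have hh := Real.cosh_sq (σ 0 / c)
  have ht := Real.sin_sq_add_cos_sq (a * σ 1)
  simp only [scherk, scherkZ, dotProduct, Fin.sum_univ_three]
  simp
  set μ := Real.sqrt (1 - l ^ 2)
  set S := Real.sinh (σ 0 / c)
  set K := Real.cosh (σ 0 / c)
  set x := Real.sin (a * σ 1)
  set y := Real.cos (a * σ 1)
  linear_combination (c ^ 2 * (l ^ 2 * S ^ 2 + μ ^ 2 * K ^ 2)) * ht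
      + c ^ 2 * K ^ 2 * hμ - c ^ 2 * l ^ 2 * hh

theorem scherkNormal_scherk {a c l : ℝ} (σ : Fin 2 → ℝ) :
    scherkNormal a c σ ⬝ᵥ scherk a c l σ = scherkZ a c l σ * Real.sinh (σ 0 / c)
      - Real.sqrt (1 - l ^ 2) * c * Real.cosh (σ 0 / c) := by
  have ht := Real.sin_sq_add_cos_sq (a * σ 1)
  simp only [scherk, scherkZ, scherkNormal, dotProduct, Fin.sum_univ_three]
  simp
  linear_combination (-Real.sqrt (1 - l ^ 2) * c * Real.cosh (σ 0 / c)) * ht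

theorem scherkNormal_tangent {a c l : ℝ} (hc : 0 < c) (σ : Fin 2 → ℝ) (b : Fin 2) :
    scherkNormal a c σ ⬝ᵥ tangent (scherk a c l) σ b = 0 := by
  have ht := Real.sin_sq_add_cos_sq (a * σ 1)
  fin_cases b
  · simp only [Fin.zero_eta, tangent_scherk_zero hc.ne', scherkRho, scherkNormal, dotProduct,
      Fin.sum_univ_three]
    simp
    linear_combination (-Real.sqrt (1 - l ^ 2) * Real.sinh (σ 0 / c)) * ht
  · simp only [Fin.mk_one, tangent_scherk_one, scherkPhi, scherkNormal, dotProduct,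
      Fin.sum_univ_three]
    simp
    linear_combination (-a * c * l * Real.sinh (σ 0 / c)) * ht

theorem scherkNormal_hess_one {a c l : ℝ} (σ : Fin 2 → ℝ) :
    scherkNormal a c σ ⬝ᵥ hess (scherk a c l) σ 1 1
      = a ^ 2 * (Real.sqrt (1 - l ^ 2) * c * Real.cosh (σ 0 / c)) := by
  have ht := Real.sin_sq_add_cos_sq (a * σ 1)
  simp only [hess_scherk_one_one, scherkNormal, dotProduct, Fin.sum_univ_three]
  simp
  linear_combination (a ^ 2 * (Real.sqrt (1 - l ^ 2) * c * Real.cosh (σ 0 / c))) * ht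

theorem scherkNormal_hess_zero {a c l : ℝ} (hc : 0 < c) (σ : Fin 2 → ℝ) :
    scherkNormal a c σ ⬝ᵥ hess (scherk a c l) σ 0 0
      = -(Real.sqrt (1 - l ^ 2) * Real.cosh (σ 0 / c)) / c := by
  have ht := Real.sin_sq_add_cos_sq (a * σ 1)
  simp only [hess_scherk_zero_zero hc.ne', scherkNormal, dotProduct, Fin.sum_univ_three]
  simp
  field_simp
  linear_combination (-(Real.sqrt (1 - l ^ 2) * Real.cosh (σ 0 / c))) * ht

theorem euclMean_scherk {a c l : ℝ} (hc : 0 < c) (hl0 : 0 ≤ l) (hl1 : l ≤ 1) (σ : Fin 2 → ℝ) :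
    euclMean (scherk a c l) σ (scherkNormal a c σ) = 0 := by
  obtain ⟨h00, h01, h10, h11⟩ := firstForm_scherk (a := a) hc hl0 hl1 σ
  rw [euclMean_eq, h00, h01, h10, h11, scherkNormal_hess_one, scherkNormal_hess_zero hc]
  field_simp
  ring

theorem firstForm_scherk_det {a c l : ℝ} (ha : a ≠ 0) (hc : 0 < c) (hl0 : 0 ≤ l) (hl1 : l ≤ 1)
    (σ : Fin 2 → ℝ) : (firstForm (scherk a c l) σ).det ≠ 0 := by
  obtain ⟨h00, h01, h10, h11⟩ := firstForm_scherk (a := a) hc hl0 hl1 σ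
  have := Real.cosh_pos (σ 0 / c)
  rw [Matrix.det_fin_two, h00, h01, h10, h11]
  simp only [mul_zero, sub_zero]
  positivity

end algebra

/-! ### Passage from the blackfold equation to its scalar form -/

namespace ConformalRadius

variable {C : ConformalRadius n rm L}

/-- The areal radius is a local homeomorphism in the conformal radius, so an open set of conformal
radii covers an open set of areal radii. -/
theorem not_eventually_static_radius (hrm : 0 ≤ rm) (hL : 0 < L) {s₀ : ℝ} (hs₀ : s₀ ∈ C.J)
    (h0 : 0 < s₀)
    (h : ∀ᶠ s in 𝓝 s₀, (n + 1) * C.slope s + 4 * C.lapse s ^ 2 - 4 * C.lapse s = 0) : False := by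
  refine not_eventually_static (n := n) hrm hL (R_mem hs₀) (R_pos hs₀ h0) ?_
  have hst := (analyticAt_R hrm hL hs₀ h0).hasStrictDerivAt
  have hd : deriv C.R s₀ ≠ 0 := by
    rw [(hasDerivAt_R hrm hL hs₀ h0).deriv]
    have := R_pos hs₀ h0
    have := lapse_pos hs₀
    positivity
  rw [← hst.map_nhds_eq hd, Filter.eventually_map]
  filter_upwards [h, mem_nhds hrm hL hs₀ h0] with s hs hsJ
  rwa [lapse_sq hsJ] at hs

/-- The equation is linear in the normal covector. This permits unnormalised normals and a change of
orientation. -/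
theorem bf_mul (s P Q A k : ℝ) : C.bf s P (k * Q) (k * A) = k * C.bf s P Q A := by
  unfold bf bfExpr; ring

theorem bf_static {s Q : ℝ} (hs : s ∈ C.J) (hQ : Q ≠ 0) (h : C.bf s 0 Q 0 = 0) :
    (n + 1) * C.slope s + 4 * C.lapse s ^ 2 - 4 * C.lapse s = 0 := by
  have hv := lapse_pos hs
  have h1 : Q * C.lapse s ^ 2 *
      ((n + 1) * C.slope s + 4 * C.lapse s ^ 2 - 4 * C.lapse s) = 0 := by
    unfold bf bfExpr at h
    linear_combination h
  exact (mul_eq_zero.1 h1).resolve_left (by positivity)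

/-- Lift of a point of the parameter domain to the worldvolume. -/
def liftPoint (σ : Fin 2 → ℝ) : WVIndex → ℝ
  | none => 0
  | some a => σ a

theorem euclid_of_mem_domain {Y : (Fin 2 → ℝ) → Fin 3 → ℝ} {s : WVIndex → ℝ}
    (h : typeI n Y s ∈ C.domain) : euclid (Y fun a => s (some a)) ∈ C.J := by
  have h1 : euclid (pad n (Y fun a => s (some a))) ∈ C.J := h
  rwa [euclid_pad] at h1

/-- Covector of the space-time with given components in `ℝ³`. -/
def liftCovector (n : ℕ) (N : Fin 3 → ℝ) : STIndex n → ℝ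
  | none => 0
  | some q => pad n N q

theorem trunc_liftCovector (N : Fin 3 → ℝ) : (trunc fun q => liftCovector n N (some q)) = N :=
  trunc_pad N

theorem isNormal_liftCovector {Y : (Fin 2 → ℝ) → Fin 3 → ℝ} {s : WVIndex → ℝ} {N : Fin 3 → ℝ}
    (hN : ∀ a, N ⬝ᵥ tangent Y (fun a => s (some a)) a = 0) :
    IsNormal (typeI n Y) s (liftCovector n N) :=
  isNormal_typeI.2 ⟨rfl, fun a => by rw [trunc_liftCovector]; exact hN a⟩

/-- The extrinsic equation at one point, along one Euclidean normal. -/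
theorem bf_eq_zero (hrm : 0 ≤ rm) (hL : 0 < L) {U : Set (Fin 2 → ℝ)}
    {Y : (Fin 2 → ℝ) → Fin 3 → ℝ} {χ : (Fin 2 → ℝ) → Fin 2 → ℝ}
    (hdom : ∀ s ∈ worldvolume U, typeI n Y s ∈ C.domain)
    (hk : ∀ s ∈ worldvolume U, 0 < kSq C.metric (typeI n Y) (wvField χ) s)
    (hE : ExtrinsicEquation n C.metric (typeI n Y) (worldvolume U) (wvField χ))
    {σ : Fin 2 → ℝ} (hσ : σ ∈ U) {N : Fin 3 → ℝ} (hN : ∀ a, N ⬝ᵥ tangent Y σ a = 0)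
    (hY : Y σ ≠ 0) (hdet : (firstForm Y σ).det ≠ 0) (hmin : euclMean Y σ N = 0) :
    C.bf (euclid (Y σ)) (speedSq Y χ σ) (N ⬝ᵥ Y σ) (normalAcc Y χ σ N) = 0 := by
  have hs : liftPoint σ ∈ worldvolume U := hσ
  have hm : IsNormal (typeI n Y) (liftPoint σ) (liftCovector n N) := isNormal_liftCovector hN
  have h := (extrinsic_eq_iff_bf (s := liftPoint σ) hrm hL hm
    (euclid_of_mem_domain (hdom _ hs)) hY hdet
    (by rw [trunc_liftCovector]; exact hmin) (hk _ hs)).1 (hE _ hs _ hm)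
  rwa [trunc_liftCovector] at h

/-- Because the velocity points along `∂_φ`, only the `φφ` component of each fundamental form
enters; no invariance of the surface is used. -/
theorem scherk_bf (hrm : 0 ≤ rm) (hL : 0 < L) {a c l Ω : ℝ} (ha : a ≠ 0) (hc : 0 < c)
    (hl0 : 0 ≤ l) (hl1 : l ≤ 1) {U : Set (Fin 2 → ℝ)}
    (hdom : ∀ s ∈ worldvolume U, typeI n (scherk a c l) s ∈ C.domain)
    (hk : ∀ s ∈ worldvolume U,
      0 < kSq C.metric (typeI n (scherk a c l)) (wvField fun _ => ![0, Ω]) s)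
    (hE : ExtrinsicEquation n C.metric (typeI n (scherk a c l)) (worldvolume U)
      (wvField fun _ => ![0, Ω])) {σ : Fin 2 → ℝ} (hσ : σ ∈ U)
    (hY : 0 < c ^ 2 * (Real.cosh (σ 0 / c) ^ 2 - l ^ 2) + scherkZ a c l σ ^ 2) :
    C.bf (Real.sqrt (c ^ 2 * (Real.cosh (σ 0 / c) ^ 2 - l ^ 2) + scherkZ a c l σ ^ 2))
      ((a * Ω) ^ 2 * (c ^ 2 * Real.cosh (σ 0 / c) ^ 2))
      (scherkZ a c l σ * Real.sinh (σ 0 / c) - Real.sqrt (1 - l ^ 2) * c * Real.cosh (σ 0 / c))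
      ((a * Ω) ^ 2 * (Real.sqrt (1 - l ^ 2) * c * Real.cosh (σ 0 / c))) = 0 := by
  have hsq := scherk_dotProduct_self (a := a) (c := c) hl0 hl1 σ
  have hY' : scherk a c l σ ≠ 0 := fun h => by
    rw [h] at hsq
    simp only [zero_dotProduct] at hsq
    linarith
  have h := bf_eq_zero hrm hL hdom hk hE hσ (scherkNormal_tangent hc σ) hY'
    (firstForm_scherk_det ha hc hl0 hl1 σ) (euclMean_scherk hc hl0 hl1 σ)
  obtain ⟨-, -, -, h11⟩ := firstForm_scherk (a := a) hc hl0 hl1 σ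
  have hsp : speedSq (scherk a c l) (fun _ => ![0, Ω]) σ
      = (a * Ω) ^ 2 * (c ^ 2 * Real.cosh (σ 0 / c) ^ 2) := by
    simp only [firstForm, Matrix.of_apply] at h11
    simp [speedSq, Fin.sum_univ_two, h11]
    ring
  have hacc : normalAcc (scherk a c l) (fun _ => ![0, Ω]) σ (scherkNormal a c σ)
      = (a * Ω) ^ 2 * (Real.sqrt (1 - l ^ 2) * c * Real.cosh (σ 0 / c)) := by
    simp [normalAcc, Fin.sum_univ_two, scherkNormal_hess_one]
    ring
  rwa [euclid_eq_sqrt, hsq, hsp, hacc, scherkNormal_scherk] at h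

end ConformalRadius

end

/-! ### Failure of catenoids, helicoids and Scherk surfaces -/

section

namespace ConformalRadius

variable {C : ConformalRadius n rm L}

/-- Away from the neck the distance to the origin is a local coordinate on the profile, and the
support function has isolated zeros there. A small shift makes both nonzero and reduces to the
static equation on an interval of radii. -/
theorem not_static_cat (hrm : 0 ≤ rm) (hL : 0 < L) {c u₀ : ℝ} (hc : 0 < c)
    (h : ∀ᶠ u in 𝓝 u₀, Real.sqrt (catS c 0 u) ∈ C.J ∧ catEq C c 0 0 u = 0) : False := by
  have h0 : catSlope c 0 0 = 0 := by simp [catSlope]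
  have hne : ∀ u, u ≠ 0 → catSlope c 0 u ≠ 0 := fun u hu hs =>
    hu ((strictMono_catSlope hc 0).injective (hs.trans h0.symm))
  obtain ⟨u₁, hu₁, hu₁'⟩ : ∃ u, u ≠ 0 ∧ ∀ᶠ u in 𝓝 u, Real.sqrt (catS c 0 u) ∈ C.J ∧
      catEq C c 0 0 u = 0 := by
    have h1 : ∀ᶠ u in 𝓝[≠] u₀, u ≠ 0 := by
      by_cases hu : u₀ = 0
      · rw [hu]; exact self_mem_nhdsWithin
      · exact (isOpen_ne.eventually_mem hu).filter_mono nhdsWithin_le_nhds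
    exact (h1.and (h.eventually_nhds.filter_mono nhdsWithin_le_nhds)).exists
  have hch := Real.cosh_pos u₁
  have hQ : ∀ᶠ u in 𝓝[≠] u₁, catQ c 0 u ≠ 0 :=
    (hasDerivAt_catQ hc 0 u₁).eventually_ne (div_ne_zero (hne u₁ hu₁) (by positivity))
  obtain ⟨u₂, hQ2, hu2, hu2'⟩ := (hQ.and (((isOpen_ne.eventually_mem hu₁).and
    hu₁'.eventually_nhds).filter_mono nhdsWithin_le_nhds)).exists
  have hS := catS_pos hc 0 u₂
  have hq : HasStrictDerivAt (fun u => Real.sqrt (catS c 0 u))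
      (2 * catSlope c 0 u₂ / (2 * Real.sqrt (catS c 0 u₂))) u₂ := by
    have h1 := (analyticAt_sqrt_comp (analyticAt_catS c 0 u₂) hS).hasStrictDerivAt
    rwa [((hasDerivAt_catS c 0 u₂).sqrt hS.ne').deriv] at h1
  have hq0 : 2 * catSlope c 0 u₂ / (2 * Real.sqrt (catS c 0 u₂)) ≠ 0 := by
    have := hne u₂ hu2
    have := Real.sqrt_pos.2 hS
    positivity
  refine not_eventually_static_radius hrm hL hu2'.self_of_nhds.1 (Real.sqrt_pos.2 hS) ?_
  rw [← hq.map_nhds_eq hq0, Filter.eventually_map]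
  filter_upwards [hu2', (hasDerivAt_catQ hc 0 u₂).continuousAt.eventually_ne hQ2] with u hu hQu
  refine bf_static hu.1 hQu ?_
  have := hu.2
  unfold catEq at this
  simpa using this

theorem scherkZ_zero (a c : ℝ) (σ : Fin 2 → ℝ) : scherkZ a c 0 σ = σ 0 := by
  simp [scherkZ]

/-- At fixed `φ` the surface is traced by `u = ρ/c` and rotates with angular velocity `aΩ`. The
chosen normal is `cosh u` times a unit normal, and this factor divides out. -/
theorem not_extrinsic_catenoid (hn : 1 ≤ n) (hrm : 0 ≤ rm) (hL : 0 < L) {a c Ω : ℝ}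
    (ha : a ≠ 0) (hc : 0 < c) {U : Set (Fin 2 → ℝ)} (hU : IsOpen U) (hne : U.Nonempty)
    (hdom : ∀ s ∈ worldvolume U, typeI n (scherk a c 0) s ∈ C.domain)
    (hk : ∀ s ∈ worldvolume U,
      0 < kSq C.metric (typeI n (scherk a c 0)) (wvField fun _ => ![0, Ω]) s)
    (hE : ExtrinsicEquation n C.metric (typeI n (scherk a c 0)) (worldvolume U)
      (wvField fun _ => ![0, Ω])) : False := by
  obtain ⟨σ₀, hσ₀⟩ := hne
  set p : ℝ → Fin 2 → ℝ := fun u => ![c * u, σ₀ 1] with hp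
  have hpc : Continuous p := by
    rw [continuous_pi_iff]
    intro i
    fin_cases i
    · exact continuous_const.mul continuous_id
    · exact continuous_const
  have hp0 : p (σ₀ 0 / c) = σ₀ := by
    ext i
    fin_cases i
    · simp only [hp, Fin.zero_eta, Matrix.cons_val_zero]; field_simp
    · simp [hp]
  have hpU : ∀ᶠ u in 𝓝 (σ₀ 0 / c), p u ∈ U :=
    hpc.continuousAt.eventually (by rw [hp0]; exact hU.mem_nhds hσ₀)
  have hpu : ∀ u, p u 0 / c = u := fun u => by
    simp only [hp, Matrix.cons_val_zero]; field_simp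
  have hp0' : ∀ u, p u 0 = c * u := fun u => by simp [hp]
  have hS : ∀ u, c ^ 2 * (Real.cosh (p u 0 / c) ^ 2 - 0 ^ 2) + scherkZ a c 0 (p u) ^ 2
      = catS c 0 u := fun u => by
    rw [hpu, scherkZ_zero, hp0']; unfold catS; ring
  have hmem : ∀ u, p u ∈ U → Real.sqrt (catS c 0 u) ∈ C.J := fun u hu => by
    have h1 := euclid_of_mem_domain (hdom (liftPoint (p u)) hu)
    change euclid (scherk a c 0 (p u)) ∈ C.J at h1
    rwa [euclid_eq_sqrt, scherk_dotProduct_self le_rfl zero_le_one, hS] at h1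
  have hcat : ∀ u, p u ∈ U → catEq C c 0 (a * Ω) u = 0 := fun u hu => by
    have h1 := scherk_bf (l := 0) hrm hL ha hc le_rfl zero_le_one hdom hk hE hu
      (by rw [hS]; exact catS_pos hc 0 u)
    rw [hS, hpu, scherkZ_zero, hp0'] at h1
    have hch := Real.cosh_pos u
    have h2 : c * u * Real.sinh u - Real.sqrt (1 - 0 ^ 2) * c * Real.cosh u
        = Real.cosh u * catQ c 0 u := by
      unfold catQ; simp; field_simp
    have h3 : (a * Ω) ^ 2 * (Real.sqrt (1 - 0 ^ 2) * c * Real.cosh u)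
        = Real.cosh u * ((a * Ω) ^ 2 * c) := by simp; ring
    rw [h2, h3, bf_mul] at h1
    exact (mul_eq_zero.1 h1).resolve_left hch.ne'
  by_cases hΩ : a * Ω = 0
  · refine not_static_cat (C := C) (u₀ := σ₀ 0 / c) hrm hL hc ?_
    filter_upwards [hpU] with u hu
    refine ⟨hmem u hu, ?_⟩
    have := hcat u hu
    rwa [hΩ] at this
  · refine not_eventually_cat (C := C) (u₀ := σ₀ 0 / c) (z := 0) hn hrm hL hc hΩ
      (hmem _ hpU.self_of_nhds) ?_ (hpU.mono hcat)
    have h1 := hk (liftPoint σ₀) hσ₀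
    have hJ := hmem _ hpU.self_of_nhds
    have hS0 := hS (σ₀ 0 / c)
    rw [hp0] at hS0
    have heu : euclid (scherk a c 0 σ₀) = Real.sqrt (catS c 0 (σ₀ 0 / c)) := by
      rw [euclid_eq_sqrt, scherk_dotProduct_self le_rfl zero_le_one, hS0]
    rw [kSq_typeI, potF_pad, potH_pad] at h1
    change 0 < fSdS n rm L (C.R (euclid (scherk a c 0 σ₀))) - (C.h (euclid (scherk a c 0 σ₀)))⁻¹
      * speedSq (scherk a c 0) (fun _ => ![0, Ω]) σ₀ at h1
    obtain ⟨-, -, -, h11⟩ := firstForm_scherk (a := a) hc le_rfl zero_le_one σ₀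
    have hsp : speedSq (scherk a c 0) (fun _ => ![0, Ω]) σ₀
        = (a * Ω) ^ 2 * (c ^ 2 * Real.cosh (σ₀ 0 / c) ^ 2) := by
      simp only [firstForm, Matrix.of_apply] at h11
      simp [speedSq, Fin.sum_univ_two, h11]
      ring
    rw [heu, hsp, h_inv hJ (Real.sqrt_pos.2 (catS_pos hc 0 _))] at h1
    rw [mul_div_assoc, ← div_pow]
    linarith

/-- The polynomial identity behind the failure of helicoids and Scherk surfaces. -/
theorem eq_zero_of_eventually_sq {A B M K E c : ℝ} {X₀ : ℝ} (hM : 0 < M)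
    (h : ∀ᶠ X in 𝓝 X₀, (M - c ^ 2 * X) * (X - 1) * (A - B * X) ^ 2
      = E * X * (K - B * X) ^ 2) : A = 0 := by
  set p : Polynomial ℝ := (Polynomial.C M - Polynomial.C (c ^ 2) * Polynomial.X) *
    (Polynomial.X - 1) * (Polynomial.C A - Polynomial.C B * Polynomial.X) ^ 2
    - Polynomial.C E * Polynomial.X *
      (Polynomial.C K - Polynomial.C B * Polynomial.X) ^ 2 with hp
  have he : ∀ X, p.eval X = (M - c ^ 2 * X) * (X - 1) * (A - B * X) ^ 2
      - E * X * (K - B * X) ^ 2 := fun X => by simp [hp]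
  have hinf : Set.Infinite {X | p.IsRoot X} := by
    refine infinite_of_mem_nhds X₀ ?_
    filter_upwards [h] with X hX
    change p.eval X = 0
    rw [he, hX, sub_self]
  -- At `X = 0` the right side vanishes and the left is `-M A²`; this value is reached only because
  -- a polynomial identity extends from a neighbourhood of `X₀` to all `X`.
  have h0 := he 0
  rw [Polynomial.eq_zero_of_infinite_isRoot p hinf] at h0
  simp at h0
  exact h0.resolve_left hM.ne'

/-- For `l > 0` the height can be varied independently of `ρ`, so squared distance `S` and `ρ` serve
as local coordinates. At fixed `S` the quantities `g`, `v` and `R` are constants, and only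
hyperbolic functions of `ρ` vary. -/
theorem not_extrinsic_scherk (hrm : 0 ≤ rm) (hL : 0 < L) {a c l Ω : ℝ}
    (ha : a ≠ 0) (hc : 0 < c) (hl0 : 0 < l) (hl1 : l ≤ 1) {U : Set (Fin 2 → ℝ)} (hU : IsOpen U)
    (hne : U.Nonempty)
    (hdom : ∀ s ∈ worldvolume U, typeI n (scherk a c l) s ∈ C.domain)
    (hk : ∀ s ∈ worldvolume U,
      0 < kSq C.metric (typeI n (scherk a c l)) (wvField fun _ => ![0, Ω]) s)
    (hE : ExtrinsicEquation n C.metric (typeI n (scherk a c l)) (worldvolume U)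
      (wvField fun _ => ![0, Ω])) : False := by
  set μ := Real.sqrt (1 - l ^ 2) with hμ
  have hlca : l * (c * a) ≠ 0 := by positivity
  -- a point of the surface off the axis and off the plane `x³ = 0`
  obtain ⟨x₀, z₀, hx₀, hz₀, hmem⟩ : ∃ x z : ℝ, x ≠ 0 ∧ z ≠ 0 ∧
      ![x, (z - μ * x) / (l * (c * a))] ∈ U := by
    obtain ⟨σ, hσ⟩ := hne
    set P : ℝ × ℝ → Fin 2 → ℝ := fun w => ![w.1, (w.2 - μ * w.1) / (l * (c * a))] with hP
    have hPc : Continuous P := by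
      rw [continuous_pi_iff]
      intro i
      fin_cases i
      · exact continuous_fst
      · exact (continuous_snd.sub (continuous_const.mul continuous_fst)).div_const _
    have hP0 : P (σ 0, scherkZ a c l σ) = σ := by
      ext i
      fin_cases i
      · simp [hP]
      · simp only [hP, scherkZ, Fin.mk_one, Matrix.cons_val_one, Matrix.cons_val_fin_one]
        field_simp
        ring
    have hev : ∀ᶠ w in 𝓝 (σ 0, scherkZ a c l σ), P w ∈ U :=
      hPc.continuousAt.eventually (by rw [hP0]; exact hU.mem_nhds hσ)
    have h1 : ∀ y : ℝ, ∀ᶠ x in 𝓝[≠] y, x ≠ 0 := by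
      intro y
      by_cases hy : y = 0
      · rw [hy]; exact self_mem_nhdsWithin
      · exact (isOpen_ne.eventually_mem hy).filter_mono nhdsWithin_le_nhds
    obtain ⟨x, hx, hx'⟩ := ((h1 _).and (hev.curry_nhds.filter_mono nhdsWithin_le_nhds)).exists
    obtain ⟨z, hz, hz'⟩ := ((h1 _).and (hx'.filter_mono nhdsWithin_le_nhds)).exists
    exact ⟨x, z, hx, hz, hz'⟩
  set S₀ := c ^ 2 * (Real.cosh (x₀ / c) ^ 2 - l ^ 2) + z₀ ^ 2 with hS₀
  have hch1 : ∀ x : ℝ, 0 ≤ Real.cosh x ^ 2 - l ^ 2 := fun x => by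
    nlinarith [Real.one_le_cosh x]
  have hS₀pos : 0 < S₀ := by
    have := hch1 (x₀ / c)
    positivity
  -- The height recovered from squared distance and `ρ`. The sign of `z₀` selects the branch, which
  -- is why the base point has nonzero height.
  set Z : ℝ × ℝ → ℝ := fun w => SignType.sign z₀ *
    Real.sqrt (w.1 - c ^ 2 * (Real.cosh (w.2 / c) ^ 2 - l ^ 2)) with hZ
  have hZc : Continuous Z := by
    refine continuous_const.mul (Real.continuous_sqrt.comp ?_)
    fun_prop
  have hZ0 : Z (S₀, x₀) = z₀ := by
    simp only [hZ, hS₀]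
    rw [add_sub_cancel_left, Real.sqrt_sq_eq_abs, sign_mul_abs]
  have hrad : ∀ᶠ w in 𝓝 (S₀, x₀), 0 < w.1 - c ^ 2 * (Real.cosh (w.2 / c) ^ 2 - l ^ 2) := by
    have hcont : Continuous fun w : ℝ × ℝ => w.1 - c ^ 2 * (Real.cosh (w.2 / c) ^ 2 - l ^ 2) := by
      fun_prop
    refine hcont.continuousAt.eventually_const_lt ?_
    simp only [hS₀]
    rw [add_sub_cancel_left]
    positivity
  set P : ℝ × ℝ → Fin 2 → ℝ := fun w => ![w.2, (Z w - μ * w.2) / (l * (c * a))] with hP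
  have hPc : Continuous P := by
    rw [continuous_pi_iff]
    intro i
    fin_cases i
    · exact continuous_snd
    · exact (hZc.sub (continuous_const.mul continuous_snd)).div_const _
  have hPU : ∀ᶠ w in 𝓝 (S₀, x₀), P w ∈ U := by
    refine hPc.continuousAt.eventually (hU.mem_nhds ?_)
    simp only [hP, hZ0]
    exact hmem
  have hPz : ∀ w, scherkZ a c l (P w) = Z w := fun w => by
    simp only [scherkZ, hP, Matrix.cons_val_zero, Matrix.cons_val_one, Matrix.cons_val_fin_one,
      ← hμ]
    field_simp
    ring
  have hP0 : ∀ w, P w 0 = w.2 := fun w => by simp [hP]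
  have hev : ∀ᶠ w in 𝓝 (S₀, x₀), Real.sqrt w.1 ∈ C.J ∧ 0 < w.1 ∧
      Z w ^ 2 = w.1 - c ^ 2 * (Real.cosh (w.2 / c) ^ 2 - l ^ 2) ∧
      C.bf (Real.sqrt w.1) ((a * Ω) ^ 2 * (c ^ 2 * Real.cosh (w.2 / c) ^ 2))
        (Z w * Real.sinh (w.2 / c) - μ * c * Real.cosh (w.2 / c))
        ((a * Ω) ^ 2 * (μ * c * Real.cosh (w.2 / c))) = 0 := by
    filter_upwards [hPU, hrad, (continuous_fst.continuousAt (x := (S₀, x₀))).eventually_const_lt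
      hS₀pos] with w hw hr hw1
    have hsgn : ((SignType.sign z₀ : SignType) : ℝ) ^ 2 = 1 := by
      rcases lt_or_gt_of_ne hz₀ with h | h
      · simp [sign_neg h]
      · simp [sign_pos h]
    have hZ2 : Z w ^ 2 = w.1 - c ^ 2 * (Real.cosh (w.2 / c) ^ 2 - l ^ 2) := by
      simp only [hZ]
      rw [mul_pow, hsgn, Real.sq_sqrt hr.le, one_mul]
    have hS : c ^ 2 * (Real.cosh (P w 0 / c) ^ 2 - l ^ 2) + scherkZ a c l (P w) ^ 2 = w.1 := by
      rw [hPz, hP0, hZ2]; ring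
    refine ⟨?_, hw1, hZ2, ?_⟩
    · have h1 := euclid_of_mem_domain (hdom (liftPoint (P w)) hw)
      change euclid (scherk a c l (P w)) ∈ C.J at h1
      rwa [euclid_eq_sqrt, scherk_dotProduct_self hl0.le hl1, hS] at h1
    · have h1 := scherk_bf hrm hL ha hc hl0.le hl1 hdom hk hE hw (by rw [hS]; exact hw1)
      rwa [hS, hPz, hP0] at h1
  have hst : ∀ᶠ S in 𝓝 S₀, (n + 1) * C.slope (Real.sqrt S) + 4 * C.lapse (Real.sqrt S) ^ 2
      - 4 * C.lapse (Real.sqrt S) = 0 := by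
    filter_upwards [hev.curry_nhds] with S hS
    obtain ⟨hJ, hSpos, -, -⟩ := hS.self_of_nhds
    have hv := lapse_pos hJ
    set v := C.lapse (Real.sqrt S)
    set g := C.slope (Real.sqrt S)
    set r := C.R (Real.sqrt S)
    have hA : v ^ 2 * ((n + 1) * g + 4 * v ^ 2 - 4 * v) = 0 := by
      -- The equation is affine in `Z sinh` and `cosh`; separating and squaring removes both the
      -- root in `Z` and the odd powers, leaving a polynomial identity in `X = cosh²`. Its
      -- coefficient `A` is the static expression.
      refine eq_zero_of_eventually_sq (X₀ := Real.cosh (x₀ / c) ^ 2) (c := c)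
        (M := S + c ^ 2 * l ^ 2) (E := μ ^ 2 * c ^ 2)
        (B := (g + 4 * v ^ 2 - 4 * v + 2 * n * (v ^ 2 - v)) * ((a * Ω) ^ 2 * c ^ 2 * r ^ 2 / S))
        (K := v ^ 2 * ((n + 1) * g + 4 * v ^ 2 - 4 * v) - 2 * n * (a * Ω) ^ 2 * r ^ 2 * v)
        (by positivity) ?_
      have hst : HasStrictDerivAt (fun x => Real.cosh (x / c) ^ 2)
          (2 * Real.cosh (x₀ / c) * (Real.sinh (x₀ / c) * (1 / c))) x₀ := by
        have h1 := (((hasStrictDerivAt_id x₀).div_const c).cosh).pow 2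
        exact h1.congr_deriv (by simp)
      -- Since `x₀ ≠ 0`, `cosh²` is a local coordinate near it and its values cover a neighbourhood
      -- of `X₀`.
      have hd : 2 * Real.cosh (x₀ / c) * (Real.sinh (x₀ / c) * (1 / c)) ≠ 0 := by
        have h1 := Real.cosh_pos (x₀ / c)
        have h2 : Real.sinh (x₀ / c) ≠ 0 := fun h =>
          div_ne_zero hx₀ hc.ne' (Real.sinh_eq_zero.1 h)
        positivity
      rw [← hst.map_nhds_eq hd, Filter.eventually_map]
      filter_upwards [hS] with x hx
      obtain ⟨-, -, hZ2, hbf⟩ := hx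
      set K := Real.cosh (x / c)
      set H := Real.sinh (x / c)
      have hKH : K ^ 2 = H ^ 2 + 1 := Real.cosh_sq (x / c)
      unfold bf bfExpr at hbf
      rw [Real.sq_sqrt hSpos.le] at hbf
      have h1 : Z (S, x) * H * (v ^ 2 * ((n + 1) * g + 4 * v ^ 2 - 4 * v)
          - (g + 4 * v ^ 2 - 4 * v + 2 * n * (v ^ 2 - v)) *
            ((a * Ω) ^ 2 * c ^ 2 * r ^ 2 / S) * K ^ 2)
          = μ * c * K * (v ^ 2 * ((n + 1) * g + 4 * v ^ 2 - 4 * v)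
            - 2 * n * (a * Ω) ^ 2 * r ^ 2 * v
            - (g + 4 * v ^ 2 - 4 * v + 2 * n * (v ^ 2 - v)) *
              ((a * Ω) ^ 2 * c ^ 2 * r ^ 2 / S) * K ^ 2) := by
        linear_combination hbf
      have h2 := congrArg (fun y => y ^ 2) h1
      simp only [mul_pow] at h2
      rw [hZ2, show H ^ 2 = K ^ 2 - 1 by linarith] at h2
      linear_combination h2
    exact (mul_eq_zero.1 hA).resolve_left (by positivity)
  refine not_eventually_static_radius (C := C) (s₀ := Real.sqrt S₀) hrm hL
    hev.self_of_nhds.1 (Real.sqrt_pos.2 hS₀pos) ?_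
  have hsq : Filter.Tendsto (fun s : ℝ => s ^ 2) (𝓝 (Real.sqrt S₀)) (𝓝 S₀) := by
    have h1 := (continuous_pow 2).tendsto (Real.sqrt S₀)
    rwa [Real.sq_sqrt hS₀pos.le] at h1
  filter_upwards [hsq.eventually hst, lt_mem_nhds (Real.sqrt_pos.2 hS₀pos)] with s hs hs0
  rwa [Real.sqrt_sq hs0.le] at hs

end ConformalRadius

end

section

/-! ## Topology of spherical shells -/

/-- The shell is the image of the interval times the unit sphere under scaling, and spheres are
connected in dimension at least two. A radius zero collapses the sphere and needs no separate
treatment of the topology. -/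
theorem isPreconnected_shell {d : ℕ} (hd : 2 ≤ d) {I : Set ℝ} (hI : I.OrdConnected)
    (h0 : ∀ s ∈ I, 0 ≤ s) : IsPreconnected {x : Fin d → ℝ | euclid x ∈ I} := by
  have hrank : 1 < Module.rank ℝ (EuclideanSpace ℝ (Fin d)) := by
    rw [← Module.finrank_eq_rank, finrank_euclideanSpace_fin]
    exact_mod_cast hd
  have hs := isPreconnected_sphere hrank (0 : EuclideanSpace ℝ (Fin d)) 1
  have hp := hI.isPreconnected.prod hs
  have hc : Continuous fun w : ℝ × EuclideanSpace ℝ (Fin d) => (fun i => w.1 * w.2 i : Fin d → ℝ) := by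
    fun_prop
  have hne : ∀ u : EuclideanSpace ℝ (Fin d), euclid (fun i => u i) = ‖u‖ := fun u => by
    rw [EuclideanSpace.norm_eq]
    unfold euclid
    simp
  have hmul : ∀ (r : ℝ) (u : EuclideanSpace ℝ (Fin d)), 0 ≤ r →
      euclid (fun i => r * u i) = r * ‖u‖ := fun r u hr => by
    have := hne (r • u)
    rw [norm_smul, Real.norm_of_nonneg hr] at this
    exact this
  convert hp.image _ hc.continuousOn using 1
  ext x
  constructor
  · intro hx
    by_cases hx0 : x = 0
    · have : Nonempty (Fin d) := ⟨⟨0, by omega⟩⟩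
      obtain ⟨u, hu⟩ := NormedSpace.sphere_nonempty (E := EuclideanSpace ℝ (Fin d)) (x := 0)
        (r := 1) |>.2 zero_le_one
      refine ⟨(euclid x, u), ⟨hx, hu⟩, ?_⟩
      ext i
      simp [hx0, euclid]
    · have hpos := euclid_pos hx0
      refine ⟨(euclid x, WithLp.toLp 2 fun i => (euclid x)⁻¹ * x i), ⟨hx, ?_⟩, ?_⟩
      · rw [mem_sphere_zero_iff_norm]
        have := hmul (euclid x)⁻¹ (WithLp.toLp 2 x) (by positivity)
        rw [← hne] at this
        rw [← hne]
        simp only at this ⊢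
        rw [this, inv_mul_cancel₀ hpos.ne']
      · ext i
        simp only
        field_simp
  · rintro ⟨⟨r, u⟩, ⟨hr, hu⟩, rfl⟩
    rw [mem_sphere_zero_iff_norm] at hu
    change euclid (fun i => r * u i) ∈ I
    rw [hmul r u (h0 r hr), hu, mul_one]
    exact hr

/-! ### Openness and connectedness of the coordinate domain and of the balls -/

namespace ConformalRadius

variable {C : ConformalRadius n rm L}

theorem exists_pos_mem (hrm : 0 ≤ rm) (hL : 0 < L) (hne : C.J.Nonempty) : ∃ b ∈ C.J, 0 < b := by
  obtain ⟨s₀, hs₀⟩ := hne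
  obtain ⟨r₁, r₂, h1, h12, -, -, h⟩ := staticRange_eq (n := n) hrm hL ⟨_, R_mem hs₀⟩
  have hsub : Set.Ioo r₁ r₂ ⊆ staticRange n rm L := by
    rcases h with ⟨-, -, -, -, h⟩ | ⟨-, h, h'⟩
    · rw [h]
    · rw [h', h]; exact Set.Ioo_subset_Ico_self
  obtain ⟨b, hb, hb'⟩ := C.bijOn.surjOn
    (hsub (show (r₁ + r₂) / 2 ∈ Set.Ioo r₁ r₂ from ⟨by linarith, by linarith⟩))
  refine ⟨b, hb, lt_of_le_of_ne (C.nonneg b hb) fun h => ?_⟩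
  have h2 := C.sq_eq b hb
  rw [← h] at h2 hb'
  have h3 : C.R 0 = 0 := by simpa using h2
  rw [hb'] at h3
  linarith

/-- If the centre belongs to `J`, then so does a whole interval `[0, b]`, which is a neighbourhood
of zero among norms. -/
theorem isOpen_shell (hrm : 0 ≤ rm) (hL : 0 < L) (d : ℕ) :
    IsOpen {x : Fin d → ℝ | euclid x ∈ C.J} := by
  rw [isOpen_iff_mem_nhds]
  intro x hx
  rcases (euclid_nonneg x).lt_or_eq with h | h
  · exact continuous_euclid.continuousAt.preimage_mem_nhds (mem_nhds hrm hL hx h)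
  · obtain ⟨b, hb, hb0⟩ := exists_pos_mem hrm hL ⟨_, hx⟩
    have h0 : (0 : ℝ) ∈ C.J := by rw [h]; exact hx
    filter_upwards [continuous_euclid.continuousAt.eventually_lt_const (h ▸ hb0)] with y hy
    exact C.interval.out h0 hb ⟨euclid_nonneg y, hy.le⟩

theorem continuousOn_f (hrm : 0 ≤ rm) (hL : 0 < L) :
    ContinuousOn (fun s => fSdS n rm L (C.R s)) C.J := by
  intro s hs
  rcases (C.nonneg s hs).lt_or_eq with h | h
  · exact (hasDerivAt_f hrm hL hs h).continuousAt.continuousWithinAt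
  · have h0 := rm_eq_zero (h.symm ▸ hs)
    subst h0
    have hf : ∀ r, fSdS n 0 L r = 1 - r ^ 2 / L ^ 2 := fun r => by simp [fSdS]
    simp only [hf]
    exact continuousWithinAt_const.sub (((continuousOn_R s hs).pow 2).div_const _)

/-- `f - Ω² r²` as a function of the conformal radius. -/
def redshift (C : ConformalRadius n rm L) (Ω s : ℝ) : ℝ :=
  fSdS n rm L (C.R s) - Ω ^ 2 * C.R s ^ 2

theorem continuousOn_redshift (hrm : 0 ≤ rm) (hL : 0 < L) (Ω : ℝ) :
    ContinuousOn (C.redshift Ω) C.J :=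
  (continuousOn_f hrm hL).sub (continuousOn_const.mul (continuousOn_R.pow 2))

theorem mem_ball_iff {d : ℕ} {Ω : ℝ} {x : Fin d → ℝ} :
    x ∈ C.ball d Ω ↔ euclid x ∈ C.J ∧ 0 < C.redshift Ω (euclid x) := by
  unfold ball redshift
  rw [sub_pos]
  rfl

theorem isOpen_ball (hrm : 0 ≤ rm) (hL : 0 < L) (d : ℕ) (Ω : ℝ) : IsOpen (C.ball d Ω) := by
  have h1 : ContinuousOn (fun x : Fin d → ℝ => C.redshift Ω (euclid x))
      {x | euclid x ∈ C.J} :=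
    (continuousOn_redshift hrm hL Ω).comp continuous_euclid.continuousOn fun x hx => hx
  convert h1.isOpen_inter_preimage (isOpen_shell hrm hL d) isOpen_Ioi (t := Set.Ioi 0) using 1
  ext x
  exact mem_ball_iff

/-- `f - Ω² r²` is positive on an interval of areal radii. -/
theorem ordConnected_redshift (hrm : 0 ≤ rm) (hL : 0 < L) (Ω : ℝ) :
    {s | s ∈ C.J ∧ 0 < C.redshift Ω s}.OrdConnected := by
  -- `f - Ω² r²` is again a lapse function, with a smaller radius of curvature
  set K := 1 / Real.sqrt (1 / L ^ 2 + Ω ^ 2) with hK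
  have hpos : 0 < 1 / L ^ 2 + Ω ^ 2 := by positivity
  have hK0 : 0 < K := by have := Real.sqrt_pos.2 hpos; positivity
  have hK2 : ∀ r : ℝ, r ^ 2 / K ^ 2 = r ^ 2 / L ^ 2 + Ω ^ 2 * r ^ 2 := fun r => by
    rw [hK, div_pow, Real.sq_sqrt hpos.le]
    field_simp
  have hred : ∀ s, C.redshift Ω s = fSdS n rm K (C.R s) := fun s => by
    unfold redshift fSdS; rw [hK2]; ring
  refine ⟨fun a ha b hb s hs => ?_⟩
  have hsJ := C.interval.out ha.1 hb.1 hs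
  refine ⟨hsJ, ?_⟩
  have hra := ha.2
  have hrb := hb.2
  rw [hred] at *
  rcases hs.1.lt_or_eq with h1 | h1
  · rcases hs.2.lt_or_eq with h2 | h2
    · have hRas := strictMonoOn_R ha.1 hsJ h1
      have hRsb := strictMonoOn_R hsJ hb.1 h2
      by_contra! hc
      rcases (R_nonneg ha.1).lt_or_eq with h3 | h3
      · have := fSdS_lt_of_le hrm hK0 h3 hRas hRsb (by linarith)
        linarith
      · have h0 := (R_mem ha.1).2.1 h3.symm
        have hm : fSdS n rm K (C.R b) ≤ fSdS n rm K (C.R s) := by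
          have h4 : C.R s ^ 2 / K ^ 2 ≤ C.R b ^ 2 / K ^ 2 := by
            have := R_nonneg hsJ
            gcongr
          unfold fSdS
          simp [h0]
          linarith
        linarith
    · rwa [h2]
  · rwa [← h1]

theorem isPreconnected_ball (hrm : 0 ≤ rm) (hL : 0 < L) {d : ℕ} (hd : 2 ≤ d) (Ω : ℝ) :
    IsPreconnected (C.ball d Ω) := by
  convert isPreconnected_shell hd (ordConnected_redshift (C := C) hrm hL Ω)
    (fun s hs => C.nonneg s hs.1) using 1
  ext x
  exact mem_ball_iff

end ConformalRadius

end

section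

/-! ## Calculus of partial derivatives -/

section calculus

variable {ι : Type} [Fintype ι] [DecidableEq ι]

theorem pd_congr {F G : (ι → ℝ) → ℝ} {x : ι → ℝ} (h : F =ᶠ[𝓝 x] G) (i : ι) :
    pd F i x = pd G i x := by
  unfold pd; rw [h.fderiv_eq]

theorem pd_add {F G : (ι → ℝ) → ℝ} {x : ι → ℝ} (hF : DifferentiableAt ℝ F x)
    (hG : DifferentiableAt ℝ G x) (i : ι) :
    pd (fun y => F y + G y) i x = pd F i x + pd G i x := by
  unfold pd; rw [fderiv_fun_add hF hG]; rfl

theorem pd_mul {F G : (ι → ℝ) → ℝ} {x : ι → ℝ} (hF : DifferentiableAt ℝ F x)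
    (hG : DifferentiableAt ℝ G x) (i : ι) :
    pd (fun y => F y * G y) i x = F x * pd G i x + pd F i x * G x := by
  unfold pd; rw [fderiv_fun_mul hF hG]
  simp [mul_comm]

theorem pd_sum {κ : Type} [Fintype κ] {F : κ → (ι → ℝ) → ℝ} {x : ι → ℝ}
    (hF : ∀ k, DifferentiableAt ℝ (F k) x) (i : ι) :
    pd (fun y => ∑ k, F k y) i x = ∑ k, pd (F k) i x := by
  unfold pd; rw [fderiv_fun_sum fun k _ => hF k]; simp

theorem fderiv_eq_zero_of_pd {F : (ι → ℝ) → ℝ} {x : ι → ℝ} (h : ∀ i, pd F i x = 0) :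
    fderiv ℝ F x = 0 := by
  ext m
  rw [← sum_mul_pd]
  simp [h]

theorem contDiffOn_pd {F : (ι → ℝ) → ℝ} {D : Set (ι → ℝ)} (hD : IsOpen D)
    (hF : ContDiffOn ℝ ∞ F D) (i : ι) : ContDiffOn ℝ ∞ (pd F i) D :=
  (hF.fderiv_of_isOpen hD (m := ∞) (by simp)).clm_apply contDiffOn_const

theorem pd_comm {F : (ι → ℝ) → ℝ} {x : ι → ℝ} (hF : ContDiffAt ℝ ∞ F x) (i j : ι) :
    pd (pd F i) j x = pd (pd F j) i x := by
  have hs : IsSymmSndFDerivAt ℝ F x := hF.isSymmSndFDerivAt (by simpa using ENat.LEInfty.out)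
  have hd : DifferentiableAt ℝ (fderiv ℝ F) x :=
    (hF.fderiv_right (m := ∞) (by simp)).differentiableAt (by simp)
  have key : ∀ i j, pd (pd F i) j x
      = fderiv ℝ (fderiv ℝ F) x (Pi.single j 1) (Pi.single i 1) := fun i j => by
    change fderiv ℝ (fun y => fderiv ℝ F y (Pi.single i 1)) x (Pi.single j 1) = _
    rw [fderiv_clm_apply hd (differentiableAt_const _)]
    simp
  rw [key, key, hs]

end calculus

/-! ## Killing fields -/

section killing

theorem killing_diagonal {ι : Type} [Fintype ι] [DecidableEq ι] (d : (ι → ℝ) → ι → ℝ)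
    (K : (ι → ℝ) → ι → ℝ) (x : ι → ℝ) (μ ν : ι) :
    ∑ κ, (K x κ * pd (fun y => Matrix.diagonal (d y) μ ν) κ x
      + Matrix.diagonal (d x) κ ν * pd (fun y => K y κ) μ x
      + Matrix.diagonal (d x) μ κ * pd (fun y => K y κ) ν x)
    = (if μ = ν then ∑ κ, K x κ * pd (fun y => d y μ) κ x else 0)
      + d x ν * pd (fun y => K y ν) μ x + d x μ * pd (fun y => K y μ) ν x := by
  rw [Finset.sum_add_distrib, Finset.sum_add_distrib]
  congr 1
  · congr 1
    · by_cases h : μ = ν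
      · subst h; simp
      · simp [h]
    · rw [Finset.sum_eq_single ν]
      · simp
      · intro b _ hb
        simp [Matrix.diagonal_apply_ne _ hb]
      · simp
  · rw [Finset.sum_eq_single μ]
    · simp
    · intro b _ hb
      simp [Matrix.diagonal_apply_ne _ hb.symm]
    · simp

/-- A vector field that is orthogonal to the position vector and satisfies the Euclidean Killing
equation is linear. -/
theorem exists_linear_of_killing {ι : Type} [Fintype ι] [DecidableEq ι] {D : Set (ι → ℝ)}
    (hD : IsOpen D) (hc : IsPreconnected D) {ξ : (ι → ℝ) → ι → ℝ}
    (hξ : ∀ q, ContDiffOn ℝ ∞ (fun x => ξ x q) D)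
    (horth : ∀ x ∈ D, ξ x ⬝ᵥ x = 0)
    (hk : ∀ x ∈ D, ∀ p q, pd (fun y => ξ y q) p x + pd (fun y => ξ y p) q x = 0) :
    ∃ A : ι → ι → ℝ, (∀ p q, A p q = -A q p) ∧ ∀ x ∈ D, ∀ p, ξ x p = ∑ q, A p q * x q := by
  rcases D.eq_empty_or_nonempty with rfl | ⟨x₀, hx₀⟩
  · exact ⟨0, by simp, by simp⟩
  have hat : ∀ x ∈ D, ∀ q, ContDiffAt ℝ ∞ (fun x => ξ x q) x := fun x hx q =>
    (hξ q).contDiffAt (hD.mem_nhds hx)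
  have hd : ∀ x ∈ D, ∀ q, DifferentiableAt ℝ (fun x => ξ x q) x := fun x hx q =>
    (hat x hx q).differentiableAt (by simp)
  have hd2 : ∀ p q, DifferentiableOn ℝ (pd (fun y => ξ y q) p) D := fun p q =>
    (contDiffOn_pd hD (hξ q) p).differentiableOn (by simp)
  have hanti : ∀ x ∈ D, ∀ p q r, pd (pd (fun y => ξ y q) p) r x
      = -pd (pd (fun y => ξ y p) q) r x := fun x hx p q r => by
    rw [← pd_neg]
    refine pd_congr ?_ r
    filter_upwards [hD.mem_nhds hx] with y hy
    linarith [hk y hy p q]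
  -- Second derivatives of a Killing field are antisymmetric in one pair of indices and symmetric in
  -- another; going round the cycle gives their negative.
  have hzero : ∀ x ∈ D, ∀ p q r, pd (pd (fun y => ξ y q) p) r x = 0 := fun x hx p q r => by
    have h1 := hanti x hx p q r
    have h2 := pd_comm (hat x hx p) q r
    have h3 := hanti x hx r p q
    have h4 := pd_comm (hat x hx r) p q
    have h5 := hanti x hx q r p
    have h6 := pd_comm (hat x hx q) p r
    linarith
  have hconst : ∀ x ∈ D, ∀ p q, pd (fun y => ξ y q) p x = pd (fun y => ξ y q) p x₀ :=
    fun x hx p q => hD.is_const_of_fderiv_eq_zero hc (hd2 p q)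
      (fun y hy => fderiv_eq_zero_of_pd fun r => hzero y hy p q r) hx hx₀
  refine ⟨fun p q => pd (fun y => ξ y p) q x₀, fun p q => by linarith [hk x₀ hx₀ p q],
    fun x hx p => ?_⟩
  -- Differentiating `ξ · x = 0` expresses `ξ` through its constant first derivatives, so there is
  -- no translation part.
  have h1 : pd (fun y => ∑ q, ξ y q * y q) p x = 0 := by
    rw [pd_congr (G := fun _ => 0) ?_ p, pd_const]
    filter_upwards [hD.mem_nhds hx] with y hy
    exact horth y hy
  rw [pd_sum fun q => (hd x hx q).fun_mul (by fun_prop)] at h1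
  have h2 : ∀ q, pd (fun y => ξ y q * y q) p x
      = (if q = p then ξ x q else 0) + pd (fun y => ξ y q) p x * x q := fun q => by
    rw [pd_mul (hd x hx q) (by fun_prop), pd_coord]
    simp
  simp only [h2, Finset.sum_add_distrib, Finset.sum_ite_eq', Finset.mem_univ, if_true] at h1
  have h3 : ∑ q, pd (fun y => ξ y p) q x₀ * x q = -∑ q, pd (fun y => ξ y q) p x * x q := by
    rw [← Finset.sum_neg_distrib]
    refine Finset.sum_congr rfl fun q _ => ?_
    rw [hconst x hx p q]
    linear_combination x q * hk x₀ hx₀ p q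
  rw [h3]
  linarith

end killing

/-! ### Background Killing fields are rotations -/

namespace ConformalRadius

variable {C : ConformalRadius n rm L}

/-- Lift of a point of space to space-time. -/
def liftSpace (x : Fin (n + 4) → ℝ) : STIndex n → ℝ
  | none => 0
  | some q => x q

theorem killing_time_time {ξ : (Fin (n + 4) → ℝ) → Fin (n + 4) → ℝ} (x : STIndex n → ℝ) :
    ∑ κ, (stField n ξ x κ * pd (fun y => C.metric y none none) κ x
      + C.metric x κ none * pd (fun y => stField n ξ y κ) none x
      + C.metric x none κ * pd (fun y => stField n ξ y κ) none x)
    = -fderiv ℝ C.potF (fun q => x (some q)) (ξ fun q => x (some q)) := by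
  rw [metric_eq, killing_diagonal, if_pos rfl, Fintype.sum_option]
  simp only [pd_metricDiag_none, pd_metricDiag_none_some, stField, pd_const]
  rw [← sum_mul_pd]
  simp

theorem killing_space_space {ξ : (Fin (n + 4) → ℝ) → Fin (n + 4) → ℝ} (x : STIndex n → ℝ)
    (p q : Fin (n + 4)) :
    ∑ κ, (stField n ξ x κ * pd (fun y => C.metric y (some p) (some q)) κ x
      + C.metric x κ (some q) * pd (fun y => stField n ξ y κ) (some p) x
      + C.metric x (some p) κ * pd (fun y => stField n ξ y κ) (some q) x)
    = (if p = q then fderiv ℝ C.potH (fun q => x (some q)) (ξ fun q => x (some q)) else 0)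
      + C.potH (fun q => x (some q)) * (pd (fun y => ξ y q) p (fun q => x (some q))
        + pd (fun y => ξ y p) q (fun q => x (some q))) := by
  rw [metric_eq, killing_diagonal, Fintype.sum_option]
  simp only [pd_metricDiag_none, pd_metricDiag_some_some, stField, Option.some.injEq]
  rw [← sum_mul_pd, pd_comp_some (fun z => ξ z q) p x, pd_comp_some (fun z => ξ z p) q x]
  simp only [metricDiag]
  by_cases h : p = q
  · simp [h]; ring
  · simp [h]; ring

theorem killing_time_space {ξ : (Fin (n + 4) → ℝ) → Fin (n + 4) → ℝ} (x : STIndex n → ℝ)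
    (q : Fin (n + 4)) :
    ∑ κ, (stField n ξ x κ * pd (fun y => C.metric y none (some q)) κ x
      + C.metric x κ (some q) * pd (fun y => stField n ξ y κ) none x
      + C.metric x none κ * pd (fun y => stField n ξ y κ) (some q) x) = 0 := by
  rw [metric_eq, killing_diagonal, if_neg (by simp)]
  simp only [stField, pd_const]
  rw [pd_comp_none (fun z => ξ z q) x]
  simp

theorem killing_space_time {ξ : (Fin (n + 4) → ℝ) → Fin (n + 4) → ℝ} (x : STIndex n → ℝ)
    (q : Fin (n + 4)) :
    ∑ κ, (stField n ξ x κ * pd (fun y => C.metric y (some q) none) κ x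
      + C.metric x κ none * pd (fun y => stField n ξ y κ) (some q) x
      + C.metric x (some q) κ * pd (fun y => stField n ξ y κ) none x) = 0 := by
  rw [metric_eq, killing_diagonal, if_neg (by simp)]
  simp only [stField, pd_const]
  rw [pd_comp_none (fun z => ξ z q) x]
  simp

/-- Spatial parts of background Killing fields are orthogonal to the position vector. -/
theorem killing_orthogonal (hrm : 0 ≤ rm) (hL : 0 < L)
    {ξ : (Fin (n + 4) → ℝ) → Fin (n + 4) → ℝ}
    (hξ : ∀ q, ContDiffOn ℝ ∞ (fun x => ξ x q) {x | euclid x ∈ C.J})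
    (h : ∀ x : Fin (n + 4) → ℝ, euclid x ∈ C.J → fderiv ℝ C.potF x (ξ x) = 0)
    {x : Fin (n + 4) → ℝ} (hx : euclid x ∈ C.J) : ξ x ⬝ᵥ x = 0 := by
  have hslope : ∀ y : Fin (n + 4) → ℝ, euclid y ∈ C.J → ξ y ⬝ᵥ y ≠ 0 →
      C.slope (euclid y) = 0 := fun y hy hne => by
    have hy0 : y ≠ 0 := fun h => hne (by simp [h])
    have hpos := euclid_pos hy0
    have h1 := h y hy
    rw [← sum_mul_pd] at h1
    have h2 : ∀ q, pd C.potF q y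
        = C.slope (euclid y) * C.lapse (euclid y) / euclid y * (y q / euclid y) := fun q => by
      change pd (fun z : Fin (n + 4) → ℝ => fSdS n rm L (C.R (euclid z))) q y = _
      exact pd_radial hy0 (hasDerivAt_f hrm hL hy hpos) q
    have h3 : C.slope (euclid y) * (C.lapse (euclid y) / euclid y ^ 2 * (ξ y ⬝ᵥ y)) = 0 := by
      rw [← h1, dotProduct, Finset.mul_sum, Finset.mul_sum]
      refine Finset.sum_congr rfl fun q _ => ?_
      rw [h2]; field_simp
    have := lapse_pos hy
    exact (mul_eq_zero.1 h3).resolve_right (mul_ne_zero (by positivity) hne)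
  by_contra hne
  have hx0 : x ≠ 0 := fun h => hne (by simp [h])
  have hpos := euclid_pos hx0
  have hopen := isOpen_shell (C := C) hrm hL (n + 4)
  have hcont : ContinuousAt (fun y => ξ y ⬝ᵥ y) x := by
    have h1 : ∀ q, ContinuousAt (fun y => ξ y q) x := fun q =>
      (hξ q).continuousOn.continuousAt (hopen.mem_nhds hx)
    exact tendsto_finsetSum _ fun q _ => (h1 q).mul (continuous_apply q).continuousAt
  have hev := (hcont.eventually_ne hne).and (hopen.mem_nhds hx)
  -- If `ξ · x ≠ 0`, the same holds at a nearby point of the ray through `x`. Then `slope` vanishes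
  -- at two different radii, although it is injective.
  have hline : Filter.Tendsto (fun t : ℝ => t • x) (𝓝[≠] 1) (𝓝 x) := by
    have : ContinuousAt (fun t : ℝ => t • x) 1 := by fun_prop
    have h2 := this.tendsto
    simp only [one_smul] at h2
    exact h2.mono_left nhdsWithin_le_nhds
  have hpt : ∀ᶠ t : ℝ in 𝓝[≠] 1, 0 < t :=
    nhdsWithin_le_nhds (lt_mem_nhds (show (0 : ℝ) < 1 by norm_num))
  obtain ⟨t, ⟨⟨h1, h2⟩, h3⟩, h4⟩ :=
    (((hline.eventually hev).and hpt).and self_mem_nhdsWithin).exists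
  have h2' : euclid (t • x) ∈ C.J := h2
  have het : euclid (t • x) = t * euclid x := by
    rw [euclid_eq_sqrt, euclid_eq_sqrt, smul_dotProduct, dotProduct_smul, smul_eq_mul,
      smul_eq_mul, ← mul_assoc, Real.sqrt_mul (by positivity), Real.sqrt_mul_self h3.le]
  have hs1 := hslope x hx hne
  have hs2 := hslope _ h2' h1
  have hpos2 : 0 < euclid (t • x) := by rw [het]; positivity
  have h5 := (fSlope_strictAntiOn (n := n) hrm hL).injOn (R_pos h2' hpos2) (R_pos hx hpos)
    (hs2.trans hs1.symm)
  have h6 := strictMonoOn_R.injOn h2' hx h5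
  rw [het] at h6
  exact h4 (mul_right_cancel₀ hpos.ne' (by rw [h6, one_mul]))

open Matrix in
/-- The velocity of a stationary Type I surface is a rotation of `ℝ³`. -/
theorem exists_cross_of_killing (hrm : 0 ≤ rm) (hL : 0 < L) {U : Set (Fin 2 → ℝ)}
    {Y : (Fin 2 → ℝ) → Fin 3 → ℝ} {χ : (Fin 2 → ℝ) → Fin 2 → ℝ}
    (hdom : ∀ s ∈ worldvolume U, typeI n Y s ∈ C.domain) (hK : MapsToKilling C U Y χ) :
    ∃ w : Fin 3 → ℝ, ∀ σ ∈ U,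
      χ σ 0 • tangent Y σ 0 + χ σ 1 • tangent Y σ 1 = w ⨯₃ Y σ := by
  obtain ⟨ξ, ⟨hsm, hkill⟩, hmap⟩ := hK
  have hlift : ∀ x : Fin (n + 4) → ℝ, euclid x ∈ C.J → liftSpace x ∈ C.domain := fun x hx => hx
  have hliftd : ContDiff ℝ ∞ (liftSpace : (Fin (n + 4) → ℝ) → STIndex n → ℝ) := by
    rw [contDiff_pi]
    rintro (_ | q)
    · exact contDiff_const
    · exact contDiff_apply ℝ ℝ q
  have hξ : ∀ q, ContDiffOn ℝ ∞ (fun x => ξ x q) {x | euclid x ∈ C.J} := fun q =>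
    (contDiffOn_pi.1 hsm (some q)).comp hliftd.contDiffOn hlift
  have horth : ∀ x ∈ {x : Fin (n + 4) → ℝ | euclid x ∈ C.J}, ξ x ⬝ᵥ x = 0 := fun x hx =>
    killing_orthogonal hrm hL hξ (fun y hy => by
      have := hkill _ (hlift y hy) none none
      rw [killing_time_time, neg_eq_zero] at this
      exact this) hx
  have hk : ∀ x ∈ {x : Fin (n + 4) → ℝ | euclid x ∈ C.J}, ∀ p q,
      pd (fun y => ξ y q) p x + pd (fun y => ξ y p) q x = 0 := fun x hx p q => by
    have h1 := hkill _ (hlift x hx) (some p) (some q)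
    rw [killing_space_space] at h1
    have h2 : fderiv ℝ C.potH x (ξ x) = 0 :=
      fderiv_radial_orthogonal (fun s => (C.h s)⁻¹) (horth x hx)
    change (if p = q then fderiv ℝ C.potH x (ξ x) else 0)
      + C.potH x * (pd (fun y => ξ y q) p x + pd (fun y => ξ y p) q x) = 0 at h1
    rw [h2, ite_self, zero_add] at h1
    exact (mul_eq_zero.1 h1).resolve_left (inv_pos.2 (C.h_pos _ hx)).ne'
  obtain ⟨A, hA, hA'⟩ := exists_linear_of_killing (isOpen_shell hrm hL (n + 4))
    (isPreconnected_shell (by omega) C.interval C.nonneg) hξ horth hk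
  -- The surface lies in `ℝ³` and its velocity is tangent to it, so only the antisymmetric 3 × 3
  -- block acts; such a block is a cross product.
  obtain ⟨B, hB, key⟩ : ∃ B : Fin 3 → Fin 3 → ℝ, (∀ i j, B i j = -B j i) ∧ ∀ σ ∈ U, ∀ i,
      χ σ 0 * tangent Y σ 0 i + χ σ 1 * tangent Y σ 1 i = ∑ j, B i j * Y σ j := by
    refine ⟨fun i j => A (Fin.castLE (by omega) i) (Fin.castLE (by omega) j),
      fun i j => hA _ _, fun σ hσ i => ?_⟩
    have hs : liftPoint σ ∈ worldvolume U := hσ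
    have hx : euclid (pad n (Y σ)) ∈ C.J := hdom _ hs
    have h1 := hmap _ hs (some (Fin.castLE (by omega) i))
    rw [Fintype.sum_option, Fin.sum_univ_two] at h1
    simp only [tangent_none_some, tangent_some_some, pad_castLE, zero_mul, zero_add] at h1
    change ξ (pad n (Y σ)) _ = tangent Y σ 0 i * χ σ 0 + tangent Y σ 1 i * χ σ 1 at h1
    rw [hA' _ hx, sum_mul_pad] at h1
    rw [mul_comm, mul_comm (χ σ 1), ← h1]
    rfl
  have hd : ∀ i, B i i = 0 := fun i => by linarith [hB i i]
  refine ⟨![B 2 1, B 0 2, B 1 0], fun σ hσ => ?_⟩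
  ext i
  simp only [Pi.add_apply, Pi.smul_apply, smul_eq_mul]
  rw [key σ hσ, cross_apply, Fin.sum_univ_three]
  fin_cases i <;> simp [hd]
  · rw [hB 0 1]; ring
  · rw [hB 1 2]; ring
  · rw [hB 2 0]; ring

end ConformalRadius

end

section

/-! ## Linear algebra of the moving frame of a minimal surface -/

open scoped Matrix

section vectors

/-- Cramer's rule in the dual basis; it lets vectors be identified from their products with a frame.
-/
theorem triple_smul (a b c x : Fin 3 → ℝ) : (a ⬝ᵥ b ⨯₃ c) • x
    = (x ⬝ᵥ a) • (b ⨯₃ c) + (x ⬝ᵥ b) • (c ⨯₃ a) + (x ⬝ᵥ c) • (a ⨯₃ b) := by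
  ext i
  fin_cases i <;> simp [cross_apply, dotProduct, Fin.sum_univ_three] <;> ring

theorem triple_smul' (a b c x : Fin 3 → ℝ) : (a ⬝ᵥ b ⨯₃ c) • x
    = (x ⬝ᵥ b ⨯₃ c) • a + (x ⬝ᵥ c ⨯₃ a) • b + (x ⬝ᵥ a ⨯₃ b) • c := by
  ext i
  fin_cases i <;> simp [cross_apply, dotProduct, Fin.sum_univ_three] <;> ring

theorem eq_zero_of_orthogonal {a b c x : Fin 3 → ℝ} (h : a ⬝ᵥ b ⨯₃ c ≠ 0) (ha : x ⬝ᵥ a = 0)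
    (hb : x ⬝ᵥ b = 0) (hc : x ⬝ᵥ c = 0) : x = 0 := by
  have h1 := triple_smul a b c x
  rw [ha, hb, hc] at h1
  simp only [zero_smul, add_zero] at h1
  exact (smul_eq_zero.1 h1).resolve_left h

theorem gram_cross (e w m : Fin 3 → ℝ) : (e ⬝ᵥ w ⨯₃ m) ^ 2
    = (e ⬝ᵥ e) * (w ⬝ᵥ w) * (m ⬝ᵥ m) + 2 * (e ⬝ᵥ w) * (w ⬝ᵥ m) * (e ⬝ᵥ m)
      - (e ⬝ᵥ e) * (w ⬝ᵥ m) ^ 2 - (w ⬝ᵥ w) * (e ⬝ᵥ m) ^ 2 - (m ⬝ᵥ m) * (e ⬝ᵥ w) ^ 2 := by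
  simp [cross_apply, dotProduct, Fin.sum_univ_three]; ring

theorem dot_cross_comm (a b c : Fin 3 → ℝ) : a ⬝ᵥ b ⨯₃ c = c ⬝ᵥ a ⨯₃ b := by
  simp [cross_apply, dotProduct, Fin.sum_univ_three]; ring

theorem dot_cross_cross (a w m : Fin 3 → ℝ) :
    a ⬝ᵥ w ⨯₃ m ⨯₃ m = (a ⬝ᵥ m) * (w ⬝ᵥ m) - (a ⬝ᵥ w) * (m ⬝ᵥ m) := by
  simp [cross_apply, dotProduct, Fin.sum_univ_three]; ring

end vectors

/-- Linear combination of two vectors of `ℝ³`. -/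
def comb (t : Fin 2 → Fin 3 → ℝ) (v : Fin 2 → ℝ) : Fin 3 → ℝ := v 0 • t 0 + v 1 • t 1

theorem comb_single (t : Fin 2 → Fin 3 → ℝ) (a : Fin 2) : comb t (Pi.single a 1) = t a := by
  fin_cases a <;> simp [comb]

theorem comb_add_smul (t : Fin 2 → Fin 3 → ℝ) (p q : ℝ) (v w : Fin 2 → ℝ) :
    comb t (p • v + q • w) = p • comb t v + q • comb t w := by
  ext i; simp [comb]; ring

/-- Tangent vectors `t`, unit normal `N` and derivatives `d` of the unit normal of a minimal
surface in Euclidean space at one point. -/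
structure MinimalFrame (t : Fin 2 → Fin 3 → ℝ) (N : Fin 3 → ℝ) (d : Fin 2 → Fin 3 → ℝ) :
    Prop where
  unit : N ⬝ᵥ N = 1
  cross : ∃ κ : ℝ, κ ≠ 0 ∧ t 0 ⨯₃ t 1 = κ • N
  orth : ∀ a, d a ⬝ᵥ N = 0
  symm : d 0 ⬝ᵥ t 1 = d 1 ⬝ᵥ t 0
  trace : ∀ v w, comb t v ⬝ᵥ comb t w = 0 → comb t v ⬝ᵥ comb t v = comb t w ⬝ᵥ comb t w →
    comb d v ⬝ᵥ comb t v + comb d w ⬝ᵥ comb t w = 0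

namespace MinimalFrame

variable {t d : Fin 2 → Fin 3 → ℝ} {N : Fin 3 → ℝ}

theorem tangent_normal (F : MinimalFrame t N d) (a : Fin 2) : t a ⬝ᵥ N = 0 := by
  obtain ⟨κ, hκ, h⟩ := F.cross
  have h1 : t a ⬝ᵥ (κ • N) = 0 := by
    rw [← h]
    fin_cases a
    · exact dot_self_cross _ _
    · exact dot_cross_self _ _
  rw [dotProduct_smul, smul_eq_mul] at h1
  exact (mul_eq_zero.1 h1).resolve_left hκ

theorem comb_normal (F : MinimalFrame t N d) (v : Fin 2 → ℝ) : comb t v ⬝ᵥ N = 0 := by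
  simp [comb, add_dotProduct, F.tangent_normal]

theorem dcomb_normal (F : MinimalFrame t N d) (v : Fin 2 → ℝ) : comb d v ⬝ᵥ N = 0 := by
  simp [comb, add_dotProduct, F.orth]

theorem triple_ne_zero (F : MinimalFrame t N d) : t 0 ⬝ᵥ t 1 ⨯₃ N ≠ 0 := by
  obtain ⟨κ, hκ, h⟩ := F.cross
  rw [dot_cross_comm, h, dotProduct_smul, F.unit]
  simpa using hκ

theorem eq_zero (F : MinimalFrame t N d) {x : Fin 3 → ℝ} (h : ∀ a, x ⬝ᵥ t a = 0)
    (hN : x ⬝ᵥ N = 0) : x = 0 :=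
  eq_zero_of_orthogonal F.triple_ne_zero (h 0) (h 1) hN

theorem exists_comb (F : MinimalFrame t N d) {x : Fin 3 → ℝ} (hx : x ⬝ᵥ N = 0) :
    ∃ v, comb t v = x := by
  obtain ⟨κ, hκ, h⟩ := F.cross
  have h1 := triple_smul' (t 0) (t 1) N x
  rw [h, dotProduct_smul, hx, smul_zero, zero_smul, add_zero] at h1
  refine ⟨![(t 0 ⬝ᵥ t 1 ⨯₃ N)⁻¹ * (x ⬝ᵥ t 1 ⨯₃ N), (t 0 ⬝ᵥ t 1 ⨯₃ N)⁻¹ * (x ⬝ᵥ N ⨯₃ t 0)], ?_⟩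
  have h2 := congrArg (fun y => (t 0 ⬝ᵥ t 1 ⨯₃ N)⁻¹ • y) h1
  simp only [smul_smul, inv_mul_cancel₀ F.triple_ne_zero, one_smul, smul_add] at h2
  exact h2.symm

theorem comb_injective (F : MinimalFrame t N d) {v : Fin 2 → ℝ} (h : comb t v = 0) : v = 0 := by
  have h1 : v 0 * (t 0 ⬝ᵥ t 1 ⨯₃ N) = comb t v ⬝ᵥ t 1 ⨯₃ N := by
    simp [comb, add_dotProduct, smul_dotProduct, dot_self_cross]
  have h2 : v 1 * (t 0 ⬝ᵥ t 1 ⨯₃ N) = comb t v ⬝ᵥ N ⨯₃ t 0 := by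
    simp [comb, add_dotProduct, smul_dotProduct, dot_cross_self]
    left
    simp [cross_apply, dotProduct, Fin.sum_univ_three]; ring
  rw [h, zero_dotProduct] at h1 h2
  ext i
  fin_cases i
  · exact (mul_eq_zero.1 h1).resolve_right F.triple_ne_zero
  · exact (mul_eq_zero.1 h2).resolve_right F.triple_ne_zero

theorem symm_comb (F : MinimalFrame t N d) (v w : Fin 2 → ℝ) :
    comb d v ⬝ᵥ comb t w = comb d w ⬝ᵥ comb t v := by
  simp only [comb, add_dotProduct, dotProduct_add, smul_dotProduct, dotProduct_smul, smul_eq_mul]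
  linear_combination (v 0 * w 1 - v 1 * w 0) * F.symm

/-- A tangent vector and its rotation by a right angle span the tangent plane. -/
theorem exists_span (F : MinimalFrame t N d) {v w : Fin 2 → ℝ} (h0 : comb t v ≠ 0)
    (hw : comb t w = comb t v ⨯₃ N) (x : Fin 2 → ℝ) : ∃ p q : ℝ, x = p • v + q • w := by
  have hvN := F.comb_normal v
  have hpos : comb t v ⬝ᵥ comb t v ≠ 0 := fun h => h0 (dotProduct_self_eq_zero.1 h)
  have hww : comb t w ⬝ᵥ comb t w = comb t v ⬝ᵥ comb t v := by
    rw [hw, cross_dot_cross, hvN, F.unit]; simp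
  have hvw : comb t v ⬝ᵥ comb t w = 0 := by rw [hw]; exact dot_self_cross _ _
  set p := (comb t x ⬝ᵥ comb t v) / (comb t v ⬝ᵥ comb t v) with hp
  set q := (comb t x ⬝ᵥ comb t w) / (comb t v ⬝ᵥ comb t v) with hq
  refine ⟨p, q, ?_⟩
  have h1 : comb t x - (p • comb t v + q • comb t w) = 0 := by
    refine eq_zero_of_orthogonal (a := comb t v) (b := comb t v ⨯₃ N) (c := N) ?_ ?_ ?_ ?_
    · rw [dot_cross_cross, hvN, F.unit]
      simpa using hpos
    · rw [sub_dotProduct, add_dotProduct, smul_dotProduct, smul_dotProduct,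
        dotProduct_comm (comb t w), hvw, smul_zero, add_zero, smul_eq_mul, hp,
        div_mul_cancel₀ _ hpos, sub_self]
    · rw [← hw, sub_dotProduct, add_dotProduct, smul_dotProduct, smul_dotProduct,
        hvw, smul_zero, zero_add, smul_eq_mul, hww, hq,
        div_mul_cancel₀ _ hpos, sub_self]
    · simp [sub_dotProduct, add_dotProduct, smul_dotProduct, F.comb_normal]
  have h2 : comb t (x - (p • v + q • w)) = 0 := by
    rw [← h1, ← comb_add_smul]
    ext i; simp [comb]; ring
  exact sub_eq_zero.1 (F.comb_injective h2)

/-- Rotation by a right angle gives an orthogonal tangent vector of the same length, and the trace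
over such a pair vanishes on a minimal surface. -/
theorem trace_rotate (F : MinimalFrame t N d) {v w : Fin 2 → ℝ}
    (hw : comb t w = comb t v ⨯₃ N) :
    comb d w ⬝ᵥ comb t w = -(comb d v ⬝ᵥ comb t v) := by
  have hvN := F.comb_normal v
  have hww : comb t w ⬝ᵥ comb t w = comb t v ⬝ᵥ comb t v := by
    rw [hw, cross_dot_cross, hvN, F.unit]; simp
  have hvw : comb t v ⬝ᵥ comb t w = 0 := by rw [hw]; exact dot_self_cross _ _
  linarith [F.trace v w hvw hww.symm]

theorem exists_rotate (F : MinimalFrame t N d) (x : Fin 3 → ℝ) : ∃ w, comb t w = x ⨯₃ N :=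
  F.exists_comb (by rw [dotProduct_comm]; exact dot_cross_self _ _)

/-- If a nonzero tangent vector is in the kernel of the second fundamental form, the latter
vanishes. -/
theorem flat_of_kernel (F : MinimalFrame t N d) {y : Fin 3 → ℝ} (hy : y ≠ 0) (hN : y ⬝ᵥ N = 0)
    (h : ∀ a, d a ⬝ᵥ y = 0) (a : Fin 2) : d a = 0 := by
  obtain ⟨v, rfl⟩ := F.exists_comb hN
  obtain ⟨w, hw⟩ := F.exists_rotate (comb t v)
  have h1 : comb d v = 0 := F.eq_zero (fun b => by
    rw [← comb_single t b, F.symm_comb, comb_single]; exact h b) (F.dcomb_normal v)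
  have hyy : comb t v ⬝ᵥ comb t v ≠ 0 := fun h => hy (dotProduct_self_eq_zero.1 h)
  have h2 : comb d w = 0 := by
    refine eq_zero_of_orthogonal (a := comb t v) (b := comb t v ⨯₃ N) (c := N) ?_ ?_ ?_
      (F.dcomb_normal w)
    · rw [dot_cross_cross, hN, F.unit]
      simpa using hyy
    · rw [F.symm_comb, h1, zero_dotProduct]
    · rw [← hw, F.trace_rotate hw, h1, zero_dotProduct, neg_zero]
  obtain ⟨p, q, hpq⟩ := F.exists_span hy hw (Pi.single a 1)
  rw [← comb_single d a, hpq, comb_add_smul, h1, h2]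
  simp

/-! ### Minimal surfaces tangent to a rotation field -/

section rotation

variable {e y : Fin 3 → ℝ}

/-- Derivative of the normal along an infinitesimal rotation. -/
theorem dcomb_rotation (F : MinimalFrame t N d) (hd : ∀ b, d b ⬝ᵥ e ⨯₃ y = e ⨯₃ N ⬝ᵥ t b)
    {v : Fin 2 → ℝ} (hv : comb t v = e ⨯₃ y) : comb d v = e ⨯₃ N := by
  refine sub_eq_zero.1 (F.eq_zero (fun b => ?_) ?_)
  · rw [sub_dotProduct, ← comb_single t b, F.symm_comb, comb_single, comb_single, hv, hd, sub_self]
  · rw [sub_dotProduct, F.dcomb_normal, dotProduct_comm, dot_cross_self, sub_self]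

theorem normal_acc_rotation (F : MinimalFrame t N d) (he : e ⬝ᵥ e = 1)
    (hd : ∀ b, d b ⬝ᵥ e ⨯₃ y = e ⨯₃ N ⬝ᵥ t b)
    {v : Fin 2 → ℝ} (hv : comb t v = e ⨯₃ y) :
    comb d v ⬝ᵥ comb t v = N ⬝ᵥ y - (N ⬝ᵥ e) * (y ⬝ᵥ e) := by
  rw [F.dcomb_rotation hd hv, hv, cross_dot_cross, he, dotProduct_comm e y]
  ring

theorem dot_rotate (he : e ⬝ᵥ e = 1) :
    e ⬝ᵥ e ⨯₃ y ⨯₃ N = (N ⬝ᵥ e) * (y ⬝ᵥ e) - N ⬝ᵥ y := by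
  have : e ⬝ᵥ e ⨯₃ y ⨯₃ N = (N ⬝ᵥ e) * (y ⬝ᵥ e) - (N ⬝ᵥ y) * (e ⬝ᵥ e) := by
    simp [cross_apply, dotProduct, Fin.sum_univ_three]; ring
  rw [this, he, mul_one]

/-- This is the Gram determinant of `e`, `e × y` and `N`, in which `e × y` is orthogonal to the
other two. -/
theorem radius_sq (F : MinimalFrame t N d) (he : e ⬝ᵥ e = 1) (hW : e ⨯₃ y ⬝ᵥ N = 0) :
    (e ⨯₃ y ⬝ᵥ e ⨯₃ y) * (1 - (N ⬝ᵥ e) ^ 2) = ((N ⬝ᵥ e) * (y ⬝ᵥ e) - N ⬝ᵥ y) ^ 2 := by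
  have h := gram_cross e (e ⨯₃ y) N
  rw [dot_rotate he, he, hW, F.unit, dot_self_cross, dotProduct_comm e N] at h
  linear_combination -h

/-- `α z - N ⬝ y` is stationary. -/
theorem pitch_stationary (F : MinimalFrame t N d) (he : e ⬝ᵥ e = 1) (hW : e ⨯₃ y ⬝ᵥ N = 0)
    (hW0 : e ⨯₃ y ≠ 0) (hd : ∀ b, d b ⬝ᵥ e ⨯₃ y = e ⨯₃ N ⬝ᵥ t b) (b : Fin 2) :
    d b ⬝ᵥ ((y ⬝ᵥ e) • e - y) + (N ⬝ᵥ e) * (t b ⬝ᵥ e) = 0 := by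
  obtain ⟨v, hv⟩ := F.exists_comb hW
  obtain ⟨w, hw⟩ := F.exists_rotate (comb t v)
  have hWW : e ⨯₃ y ⬝ᵥ e ⨯₃ y ≠ 0 := fun h => hW0 (dotProduct_self_eq_zero.1 h)
  set c := (N ⬝ᵥ e) * (y ⬝ᵥ e) - N ⬝ᵥ y with hc
  have hew : e ⬝ᵥ comb t w = c := by rw [hw, hv, dot_rotate he]
  have hz : (y ⬝ᵥ e) • e - y = e ⨯₃ (e ⨯₃ y) := by
    have : e ⨯₃ (e ⨯₃ y) = (y ⬝ᵥ e) • e - (e ⬝ᵥ e) • y := by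
      ext i
      fin_cases i <;> simp [cross_apply, dotProduct, Fin.sum_univ_three] <;> ring
    rw [this, he, one_smul]
  -- Minus the horizontal part of the position is orthogonal to the rotation direction, so it
  -- expands in the rotated tangent vector and the normal alone. The claim is then checked along the
  -- rotation field and its right-angle rotate.
  have hexp : (y ⬝ᵥ e) • e - y = -(N ⬝ᵥ e) • comb t w + c • N := by
    refine sub_eq_zero.1 (eq_zero_of_orthogonal (a := e ⨯₃ y) (b := e ⨯₃ y ⨯₃ N) (c := N)
      ?_ ?_ ?_ ?_)
    · rw [dot_cross_cross, hW, F.unit]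
      simpa using hWW
    · rw [sub_dotProduct, add_dotProduct, smul_dotProduct, smul_dotProduct, hz, hw, hv,
        dotProduct_comm N (e ⨯₃ y), hW, dotProduct_comm (e ⨯₃ y ⨯₃ N), dot_self_cross,
        dotProduct_comm (e ⨯₃ (e ⨯₃ y)), dot_cross_self]
      simp
    · rw [sub_dotProduct, add_dotProduct, smul_dotProduct, smul_dotProduct, hz, hw, hv,
        cross_dot_cross (e ⨯₃ y) N (e ⨯₃ y) N, cross_dot_cross e (e ⨯₃ y) (e ⨯₃ y) N, hW, F.unit,
        dot_self_cross, dotProduct_comm N (e ⨯₃ y), hW, dotProduct_comm e N, dot_cross_self]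
      simp
    · rw [sub_dotProduct, add_dotProduct, smul_dotProduct, smul_dotProduct, F.comb_normal,
        F.unit, sub_dotProduct, smul_dotProduct, dotProduct_comm e N, dotProduct_comm y N]
      simp [hc]; ring
  have hdv := F.dcomb_rotation hd hv
  have hvd := F.normal_acc_rotation he hd hv
  have h1 : comb d v ⬝ᵥ ((y ⬝ᵥ e) • e - y) + (N ⬝ᵥ e) * (comb t v ⬝ᵥ e) = 0 := by
    rw [hdv, hv, dotProduct_sub, dotProduct_smul, dotProduct_comm (e ⨯₃ y) e, dot_self_cross,
      dotProduct_comm (e ⨯₃ N) e, dot_self_cross]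
    have : e ⨯₃ N ⬝ᵥ y = -(e ⨯₃ y ⬝ᵥ N) := by
      simp [cross_apply, dotProduct, Fin.sum_univ_three]; ring
    rw [this, hW]; simp
  have h2 : comb d w ⬝ᵥ ((y ⬝ᵥ e) • e - y) + (N ⬝ᵥ e) * (comb t w ⬝ᵥ e) = 0 := by
    rw [hexp, dotProduct_add, dotProduct_smul, dotProduct_smul, F.dcomb_normal,
      F.trace_rotate hw, hvd, dotProduct_comm (comb t w) e, hew]
    simp only [smul_eq_mul, hc]; ring
  obtain ⟨p, q, hpq⟩ := F.exists_span (by rwa [hv]) hw (Pi.single b 1)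
  rw [← comb_single d b, ← comb_single t b, hpq, comb_add_smul, comb_add_smul]
  simp only [add_dotProduct, smul_dotProduct, smul_eq_mul]
  linear_combination p * h1 + q * h2

/-- The angle between the axis and the normal changes with the height as on a catenoid. -/
theorem angle_height (F : MinimalFrame t N d) (he : e ⬝ᵥ e = 1) (hW : e ⨯₃ y ⬝ᵥ N = 0)
    (hW0 : e ⨯₃ y ≠ 0) (hd : ∀ b, d b ⬝ᵥ e ⨯₃ y = e ⨯₃ N ⬝ᵥ t b) (b : Fin 2) :
    ((N ⬝ᵥ e) * (y ⬝ᵥ e) - N ⬝ᵥ y) * (d b ⬝ᵥ e) = (1 - (N ⬝ᵥ e) ^ 2) * (t b ⬝ᵥ e) := by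
  obtain ⟨v, hv⟩ := F.exists_comb hW
  obtain ⟨w, hw⟩ := F.exists_rotate (comb t v)
  have hWW : e ⨯₃ y ⬝ᵥ e ⨯₃ y ≠ 0 := fun h => hW0 (dotProduct_self_eq_zero.1 h)
  have hrad := F.radius_sq he hW
  set c := (N ⬝ᵥ e) * (y ⬝ᵥ e) - N ⬝ᵥ y with hc
  have hew : e ⬝ᵥ comb t w = c := by rw [hw, hv, dot_rotate he]
  have hww : comb t w ⬝ᵥ comb t w = e ⨯₃ y ⬝ᵥ e ⨯₃ y := by
    rw [hw, hv, cross_dot_cross, hW, F.unit]; simp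
  have hexp : (e ⨯₃ y ⬝ᵥ e ⨯₃ y) • e
      = c • comb t w + ((e ⨯₃ y ⬝ᵥ e ⨯₃ y) * (N ⬝ᵥ e)) • N := by
    refine sub_eq_zero.1 (eq_zero_of_orthogonal (a := e ⨯₃ y) (b := e ⨯₃ y ⨯₃ N) (c := N)
      ?_ ?_ ?_ ?_)
    · rw [dot_cross_cross, hW, F.unit]
      simpa using hWW
    · rw [sub_dotProduct, add_dotProduct, smul_dotProduct, smul_dotProduct, smul_dotProduct, hw,
        hv, dotProduct_comm N (e ⨯₃ y), hW, dotProduct_comm (e ⨯₃ y ⨯₃ N), dot_self_cross,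
        dot_self_cross]
      simp
    · rw [← hv, ← hw, sub_dotProduct, add_dotProduct, smul_dotProduct, smul_dotProduct,
        smul_dotProduct, hww, hew, dotProduct_comm N (comb t w), F.comb_normal, hv]
      simp only [smul_eq_mul]; ring
    · rw [sub_dotProduct, add_dotProduct, smul_dotProduct, smul_dotProduct, smul_dotProduct,
        F.comb_normal, F.unit, dotProduct_comm e N]
      simp
  have hvd := F.normal_acc_rotation he hd hv
  have h1 : c * (comb d v ⬝ᵥ e) = (1 - (N ⬝ᵥ e) ^ 2) * (comb t v ⬝ᵥ e) := by
    rw [F.dcomb_rotation hd hv, hv, dotProduct_comm (e ⨯₃ N) e, dot_self_cross,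
      dotProduct_comm (e ⨯₃ y) e, dot_self_cross]
    simp
  have h2 : c * (comb d w ⬝ᵥ e) = (1 - (N ⬝ᵥ e) ^ 2) * (comb t w ⬝ᵥ e) := by
    refine mul_left_cancel₀ hWW ?_
    have h3 : (e ⨯₃ y ⬝ᵥ e ⨯₃ y) * (comb d w ⬝ᵥ e) = c * c := by
      rw [← smul_eq_mul, ← dotProduct_smul, hexp, dotProduct_add, dotProduct_smul,
        dotProduct_smul, F.dcomb_normal, F.trace_rotate hw, hvd]
      simp only [smul_eq_mul, hc]; ring
    rw [dotProduct_comm (comb t w), hew]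
    linear_combination c * h3 - c * hrad
  obtain ⟨p, q, hpq⟩ := F.exists_span (by rwa [hv]) hw (Pi.single b 1)
  rw [← comb_single d b, ← comb_single t b, hpq, comb_add_smul, comb_add_smul]
  simp only [add_dotProduct, smul_dotProduct, smul_eq_mul]
  linear_combination p * h1 + q * h2

/-- The axis of rotation is not orthogonal to the tangent plane unless it is the normal. -/
theorem exists_height_ne_zero (F : MinimalFrame t N d) (he : e ⬝ᵥ e = 1)
    (hN : (N ⬝ᵥ e) ^ 2 ≠ 1) : ∃ b, t b ⬝ᵥ e ≠ 0 := by
  by_contra! h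
  apply hN
  have h1 : e - (N ⬝ᵥ e) • N = 0 := F.eq_zero (fun a => by
    rw [sub_dotProduct, smul_dotProduct, dotProduct_comm e (t a), h, dotProduct_comm N (t a),
      F.tangent_normal]
    simp) (by
    rw [sub_dotProduct, smul_dotProduct, F.unit, dotProduct_comm]; simp)
  have h2 := congrArg (fun x => x ⬝ᵥ e) h1
  simp only [sub_dotProduct, smul_dotProduct, zero_dotProduct, he, smul_eq_mul] at h2
  linarith

end rotation

end MinimalFrame

end

section

/-! ## Moving frames of surfaces -/

open scoped Matrix

section vectorCalculus

theorem differentiableAt_cross {ι : Type} [Fintype ι] (e : Fin 3 → ℝ) {x : ι → ℝ}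
    {V : (ι → ℝ) → Fin 3 → ℝ}
    (hV : DifferentiableAt ℝ V x) : DifferentiableAt ℝ (fun y => e ⨯₃ V y) x :=
  (LinearMap.toContinuousLinearMap (crossProduct e)).differentiableAt.comp x hV

theorem contDiffOn_dotProduct {ι κ : Type} [Fintype ι] [Fintype κ]
    {V W : (ι → ℝ) → κ → ℝ} {U : Set (ι → ℝ)} (hV : ContDiffOn ℝ ∞ V U)
    (hW : ContDiffOn ℝ ∞ W U) : ContDiffOn ℝ ∞ (fun y => V y ⬝ᵥ W y) U :=
  ContDiffOn.sum fun k _ => (contDiffOn_pi.1 hV k).mul (contDiffOn_pi.1 hW k)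

variable {ι κ : Type} [Fintype ι] [DecidableEq ι] [Fintype κ] {V W : (ι → ℝ) → κ → ℝ} {x : ι → ℝ}

theorem pd_dotProduct (hV : DifferentiableAt ℝ V x) (hW : DifferentiableAt ℝ W x) (i : ι) :
    pd (fun y => V y ⬝ᵥ W y) i x = V x ⬝ᵥ tangent W x i + tangent V x i ⬝ᵥ W x := by
  rw [differentiableAt_pi] at hV hW
  unfold dotProduct
  rw [pd_sum fun k => (hV k).fun_mul (hW k), ← Finset.sum_add_distrib]
  exact Finset.sum_congr rfl fun k _ => pd_mul (hV k) (hW k) i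

theorem pd_dotProduct_const (hV : DifferentiableAt ℝ V x) (e : κ → ℝ) (i : ι) :
    pd (fun y => V y ⬝ᵥ e) i x = tangent V x i ⬝ᵥ e := by
  rw [pd_dotProduct hV (differentiableAt_const e)]
  have : tangent (fun _ : ι → ℝ => e) x i = 0 := by ext k; simp [tangent]
  rw [this, dotProduct_zero, zero_add]

theorem tangent_cross (e : Fin 3 → ℝ) {V : (ι → ℝ) → Fin 3 → ℝ} (hV : DifferentiableAt ℝ V x)
    (i : ι) : tangent (fun y => e ⨯₃ V y) x i = e ⨯₃ tangent V x i := by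
  have h : ∀ k, (e ⨯₃ tangent V x i) k = tangent V x i ⬝ᵥ (Pi.single k 1 ⨯₃ e) := fun k => by
    fin_cases k <;> simp [cross_apply, dotProduct, Fin.sum_univ_three] <;> ring
  ext k
  rw [h, ← pd_dotProduct_const hV]
  unfold tangent
  congr 1
  ext y
  fin_cases k <;> simp [cross_apply, dotProduct, Fin.sum_univ_three] <;> ring

theorem contDiffOn_tangent {U : Set (ι → ℝ)} (hU : IsOpen U) (hV : ContDiffOn ℝ ∞ V U) (i : ι) :
    ContDiffOn ℝ ∞ (fun y => tangent V y i) U :=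
  contDiffOn_pi.2 fun k => contDiffOn_pd hU (contDiffOn_pi.1 hV k) i

/-- The values of a submersion cover a neighbourhood. -/
theorem eventually_of_pd_ne_zero {g : (ι → ℝ) → ℝ} (hg : ContDiffAt ℝ ∞ g x) {i : ι}
    (hi : pd g i x ≠ 0) {P : ℝ → Prop} (h : ∀ᶠ y in 𝓝 x, P (g y)) : ∀ᶠ S in 𝓝 (g x), P S := by
  have hst := hg.hasStrictFDerivAt (by simp)
  rw [← hst.map_nhds_eq_of_surj ?_, Filter.eventually_map]
  · exact h
  · rw [LinearMap.range_eq_top]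
    intro c
    refine ⟨(c / pd g i x) • Pi.single i 1, ?_⟩
    change fderiv ℝ g x _ = c
    rw [map_smul, smul_eq_mul]
    exact div_mul_cancel₀ c hi

theorem eventually_const_of_pd {g : (ι → ℝ) → ℝ}
    (h : ∀ᶠ y in 𝓝 x, DifferentiableAt ℝ g y ∧ ∀ i, pd g i y = 0) : ∀ᶠ y in 𝓝 x, g y = g x := by
  obtain ⟨r, hr, hb⟩ := Metric.eventually_nhds_iff_ball.1 h
  filter_upwards [Metric.ball_mem_nhds x hr] with y hy
  exact Metric.isOpen_ball.is_const_of_fderiv_eq_zero (convex_ball x r).isPreconnected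
    (fun z hz => (hb z hz).1.differentiableWithinAt)
    (fun z hz => fderiv_eq_zero_of_pd (hb z hz).2) hy (Metric.mem_ball_self hr)

end vectorCalculus

/-- A smooth unit normal field of a surface. -/
structure IsUnitNormal (U : Set (Fin 2 → ℝ)) (Y N : (Fin 2 → ℝ) → Fin 3 → ℝ) : Prop where
  smooth : ContDiffOn ℝ ∞ N U
  unit : ∀ σ ∈ U, N σ ⬝ᵥ N σ = 1
  cross : ∀ σ ∈ U, ∃ κ : ℝ, κ ≠ 0 ∧ tangent Y σ 0 ⨯₃ tangent Y σ 1 = κ • N σ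

section surface

variable {U : Set (Fin 2 → ℝ)} {Y N : (Fin 2 → ℝ) → Fin 3 → ℝ} {σ : Fin 2 → ℝ}

theorem IsUnitNormal.neg (h : IsUnitNormal U Y N) : IsUnitNormal U Y (fun σ => -N σ) :=
  ⟨h.smooth.neg, fun σ hσ => by simp [h.unit σ hσ], fun σ hσ => by
    obtain ⟨κ, h1, h2⟩ := h.cross σ hσ
    exact ⟨-κ, neg_ne_zero.2 h1, by rw [h2]; simp⟩⟩

theorem cross_ne_zero_of_linearIndependent (h : LinearIndependent ℝ (tangent Y σ)) :
    tangent Y σ 0 ⨯₃ tangent Y σ 1 ≠ 0 := by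
  intro h0
  refine firstForm_det_ne_zero h ?_
  rw [Matrix.det_fin_two]
  have h1 := cross_dot_cross (tangent Y σ 0) (tangent Y σ 1) (tangent Y σ 0) (tangent Y σ 1)
  rw [h0, zero_dotProduct] at h1
  simp only [firstForm, Matrix.of_apply]
  linarith

theorem exists_unitNormal (hU : IsOpen U) (hY : ContDiffOn ℝ ∞ Y U)
    (hli : ∀ σ ∈ U, LinearIndependent ℝ (tangent Y σ)) : ∃ N, IsUnitNormal U Y N := by
  set m : (Fin 2 → ℝ) → Fin 3 → ℝ := fun σ => tangent Y σ 0 ⨯₃ tangent Y σ 1 with hm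
  have hpos : ∀ σ ∈ U, 0 < m σ ⬝ᵥ m σ := fun σ hσ => by
    have := euclid_pos (cross_ne_zero_of_linearIndependent (hli σ hσ))
    rw [← euclid_sq]
    positivity
  have hms : ContDiffOn ℝ ∞ m U := by
    have h0 := contDiffOn_pi.1 (contDiffOn_tangent hU hY 0)
    have h1 := contDiffOn_pi.1 (contDiffOn_tangent hU hY 1)
    rw [contDiffOn_pi]
    intro i
    simp only [hm, cross_apply]
    fin_cases i
    · exact ((h0 1).mul (h1 2)).sub ((h0 2).mul (h1 1))
    · exact ((h0 2).mul (h1 0)).sub ((h0 0).mul (h1 2))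
    · exact ((h0 0).mul (h1 1)).sub ((h0 1).mul (h1 0))
  have hsq : ContDiffOn ℝ ∞ (fun σ => (Real.sqrt (m σ ⬝ᵥ m σ))⁻¹) U :=
    ((contDiffOn_dotProduct hms hms).sqrt fun σ hσ => (hpos σ hσ).ne').inv
      fun σ hσ => (Real.sqrt_pos.2 (hpos σ hσ)).ne'
  refine ⟨fun σ => (Real.sqrt (m σ ⬝ᵥ m σ))⁻¹ • m σ, hsq.smul hms, fun σ hσ => ?_,
    fun σ hσ => ⟨Real.sqrt (m σ ⬝ᵥ m σ), (Real.sqrt_pos.2 (hpos σ hσ)).ne', ?_⟩⟩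
  · have := Real.sq_sqrt (hpos σ hσ).le
    have h1 := (Real.sqrt_pos.2 (hpos σ hσ)).ne'
    rw [smul_dotProduct, dotProduct_smul, smul_eq_mul, smul_eq_mul]
    nth_rewrite 3 [← this]
    field_simp
  · rw [smul_smul, mul_inv_cancel₀ (Real.sqrt_pos.2 (hpos σ hσ)).ne', one_smul]

theorem differentiableAt_of_contDiffOn {κ : Type} [Fintype κ] {V : (Fin 2 → ℝ) → κ → ℝ}
    (hU : IsOpen U) (hV : ContDiffOn ℝ ∞ V U) (hσ : σ ∈ U) : DifferentiableAt ℝ V σ :=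
  (hV.contDiffAt (hU.mem_nhds hσ)).differentiableAt (by simp)

theorem hess_symm (hU : IsOpen U) (hY : ContDiffOn ℝ ∞ Y U) (hσ : σ ∈ U) (a b : Fin 2) :
    hess Y σ a b = hess Y σ b a := by
  ext i
  exact pd_comm ((contDiffOn_pi.1 hY i).contDiffAt (hU.mem_nhds hσ)) b a

namespace IsUnitNormal

theorem dot_tangent (h : IsUnitNormal U Y N) (hσ : σ ∈ U) (a : Fin 2) :
    N σ ⬝ᵥ tangent Y σ a = 0 := by
  obtain ⟨κ, hκ, h⟩ := h.cross σ hσ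
  have h1 : (κ • N σ) ⬝ᵥ tangent Y σ a = 0 := by
    rw [← h, dotProduct_comm]
    fin_cases a
    · exact dot_self_cross _ _
    · exact dot_cross_self _ _
  rw [smul_dotProduct, smul_eq_mul] at h1
  exact (mul_eq_zero.1 h1).resolve_left hκ

/-- The Weingarten relation. -/
theorem weingarten (h : IsUnitNormal U Y N) (hU : IsOpen U) (hY : ContDiffOn ℝ ∞ Y U)
    (hσ : σ ∈ U) (a b : Fin 2) :
    N σ ⬝ᵥ hess Y σ a b = -(tangent N σ a ⬝ᵥ tangent Y σ b) := by
  have h1 : pd (fun y => N y ⬝ᵥ tangent Y y b) a σ = 0 := by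
    rw [pd_congr (G := fun _ => 0) ?_ a, pd_const]
    filter_upwards [hU.mem_nhds hσ] with y hy
    exact h.dot_tangent hy b
  rw [pd_dotProduct (differentiableAt_of_contDiffOn hU h.smooth hσ)
    (differentiableAt_of_contDiffOn hU (contDiffOn_tangent hU hY b) hσ)] at h1
  have h2 : N σ ⬝ᵥ hess Y σ a b + tangent N σ a ⬝ᵥ tangent Y σ b = 0 := h1
  linarith

theorem frame (h : IsUnitNormal U Y N) (hU : IsOpen U) (hY : ContDiffOn ℝ ∞ Y U) (hσ : σ ∈ U)
    (hdet : (firstForm Y σ).det ≠ 0) (hmin : euclMean Y σ (N σ) = 0) :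
    MinimalFrame (tangent Y σ) (N σ) (tangent N σ) where
  unit := h.unit σ hσ
  cross := h.cross σ hσ
  orth a := by
    have hd := differentiableAt_of_contDiffOn hU h.smooth hσ
    have h1 : pd (fun y => N y ⬝ᵥ N y) a σ = 0 := by
      rw [pd_congr (G := fun _ => 1) ?_ a, pd_const]
      filter_upwards [hU.mem_nhds hσ] with y hy
      exact h.unit y hy
    rw [pd_dotProduct hd hd, dotProduct_comm] at h1
    linarith
  symm := by
    have h1 := h.weingarten hU hY hσ 0 1
    rw [hess_symm hU hY hσ, h.weingarten hU hY hσ] at h1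
    linarith
  trace v w h0 h1 := by
    rcases eq_or_ne (comb (tangent Y σ) v ⬝ᵥ comb (tangent Y σ) v) 0 with h2 | h2
    · rw [h2] at h1
      rw [dotProduct_self_eq_zero.1 h2, dotProduct_self_eq_zero.1 h1.symm]
      simp
    set ρ := comb (tangent Y σ) v ⬝ᵥ comb (tangent Y σ) v with hρ
    -- An orthogonal pair of equal length satisfies `Mᵀ I M = ρ`, hence `M Mᵀ = ρ I⁻¹`, where `I` is
    -- the first fundamental form. The sum over the pair is thus a multiple of the mean curvature.
    set M : Matrix (Fin 2) (Fin 2) ℝ := !![v 0, w 0; v 1, w 1] with hM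
    have hMEM : (ρ⁻¹ • (Mᵀ * firstForm Y σ)) * M = 1 := by
      rw [Matrix.smul_mul]
      have h3 : Mᵀ * firstForm Y σ * M = ρ • (1 : Matrix (Fin 2) (Fin 2) ℝ) := by
        simp only [comb, add_dotProduct, dotProduct_add, smul_dotProduct, dotProduct_smul,
          smul_eq_mul] at h0 h1 hρ
        ext i j
        fin_cases i <;> fin_cases j <;>
          simp [hM, Matrix.mul_apply, Fin.sum_univ_two, firstForm]
        · rw [hρ]; ring
        · rw [dotProduct_comm (tangent Y σ 1) (tangent Y σ 0)] at h0 ⊢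
          linear_combination h0
        · rw [dotProduct_comm (tangent Y σ 1) (tangent Y σ 0)] at h0 ⊢
          linear_combination h0
        · rw [h1]; ring
      rw [h3, smul_smul, inv_mul_cancel₀ h2, one_smul]
    have hMM : M * Mᵀ = ρ • (firstForm Y σ)⁻¹ := by
      have h3 := mul_eq_one_comm.1 hMEM
      rw [Matrix.mul_smul, ← Matrix.mul_assoc] at h3
      have h4 : M * Mᵀ * firstForm Y σ = ρ • (1 : Matrix (Fin 2) (Fin 2) ℝ) := by
        rw [← h3, smul_smul, mul_inv_cancel₀ h2, one_smul]
      rw [← Matrix.mul_nonsing_inv_cancel_right (firstForm Y σ) (M * Mᵀ) (Ne.isUnit hdet), h4]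
      simp
    have h5 : ∑ a, ∑ b, (M * Mᵀ) a b * (N σ ⬝ᵥ hess Y σ a b) = 0 := by
      rw [hMM]
      simp only [Matrix.smul_apply, smul_eq_mul, mul_assoc, ← Finset.mul_sum]
      rw [show ∑ a, ∑ b, (firstForm Y σ)⁻¹ a b * (N σ ⬝ᵥ hess Y σ a b) = 0 from hmin, mul_zero]
    simp only [h.weingarten hU hY hσ, hM, Matrix.mul_apply, Fin.sum_univ_two,
      Matrix.transpose_apply] at h5
    simp at h5
    simp only [comb, add_dotProduct, dotProduct_add, smul_dotProduct, dotProduct_smul,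
      smul_eq_mul]
    linear_combination -h5

end IsUnitNormal

/-- A minimal surface does not lie in a sphere about the origin, even locally. -/
theorem exists_radial_ne_zero {O : Set (Fin 2 → ℝ)} (hO : IsOpen O) (hne : O.Nonempty)
    (hY : ContDiffOn ℝ ∞ Y O) (hdet : ∀ σ ∈ O, (firstForm Y σ).det ≠ 0)
    (hmin : ∀ σ ∈ O, ∀ m, (∀ a, m ⬝ᵥ tangent Y σ a = 0) → euclMean Y σ m = 0) :
    ∃ σ ∈ O, ∃ a, pd (fun y => Y y ⬝ᵥ Y y) a σ ≠ 0 := by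
  by_contra! hc
  have hYt : ∀ σ ∈ O, ∀ a, Y σ ⬝ᵥ tangent Y σ a = 0 := fun σ hσ a => by
    have hd := differentiableAt_of_contDiffOn hO hY hσ
    have h1 := hc σ hσ a
    rw [pd_dotProduct hd hd, dotProduct_comm (tangent Y σ a)] at h1
    linarith
  obtain ⟨σ, hσ⟩ := hne
  -- On a sphere the position vector is a normal whose second fundamental form is minus the first,
  -- so the mean curvature would be `-2`.
  have hh : ∀ a b, Y σ ⬝ᵥ hess Y σ a b = -firstForm Y σ a b := fun a b => by
    have h1 : pd (fun y => Y y ⬝ᵥ tangent Y y b) a σ = 0 := by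
      rw [pd_congr (G := fun _ => 0) ?_ a, pd_const]
      filter_upwards [hO.mem_nhds hσ] with y hy
      exact hYt y hy b
    rw [pd_dotProduct (differentiableAt_of_contDiffOn hO hY hσ)
      (differentiableAt_of_contDiffOn hO (contDiffOn_tangent hO hY b) hσ)] at h1
    have h2 : Y σ ⬝ᵥ hess Y σ a b + tangent Y σ a ⬝ᵥ tangent Y σ b = 0 := h1
    simp only [firstForm, Matrix.of_apply]
    linarith
  have h2 := hmin σ hσ (Y σ) (hYt σ hσ)
  unfold euclMean at h2
  simp only [hh, mul_neg, Finset.sum_neg_distrib, sum_inv_firstForm (hdet σ hσ)] at h2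
  norm_num at h2

theorem speedSq_eq {χ : (Fin 2 → ℝ) → Fin 2 → ℝ} :
    speedSq Y χ σ = comb (tangent Y σ) (χ σ) ⬝ᵥ comb (tangent Y σ) (χ σ) := by
  simp only [speedSq, comb, Fin.sum_univ_two, add_dotProduct, dotProduct_add, smul_dotProduct,
    dotProduct_smul, smul_eq_mul]
  ring

theorem normalAcc_eq {χ : (Fin 2 → ℝ) → Fin 2 → ℝ} (h : IsUnitNormal U Y N) (hU : IsOpen U)
    (hY : ContDiffOn ℝ ∞ Y U) (hσ : σ ∈ U) :
    normalAcc Y χ σ (N σ) = -(comb (tangent N σ) (χ σ) ⬝ᵥ comb (tangent Y σ) (χ σ)) := by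
  simp only [normalAcc, h.weingarten hU hY hσ, comb, Fin.sum_univ_two, add_dotProduct,
    dotProduct_add, smul_dotProduct, dotProduct_smul, smul_eq_mul]
  ring

/-- If the velocity is a rotation, the derivative of the normal along the rotation field is a
rotation as well. -/
theorem dnormal_rotation (h : IsUnitNormal U Y N) (hU : IsOpen U) (hY : ContDiffOn ℝ ∞ Y U)
    {e : Fin 3 → ℝ} (hW : ∀ σ ∈ U, e ⨯₃ Y σ ⬝ᵥ N σ = 0) (hσ : σ ∈ U) (b : Fin 2) :
    tangent N σ b ⬝ᵥ e ⨯₃ Y σ = e ⨯₃ N σ ⬝ᵥ tangent Y σ b := by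
  have hYd := differentiableAt_of_contDiffOn hU hY hσ
  have h1 : pd (fun y => e ⨯₃ Y y ⬝ᵥ N y) b σ = 0 := by
    rw [pd_congr (G := fun _ => 0) ?_ b, pd_const]
    filter_upwards [hU.mem_nhds hσ] with y hy
    exact hW y hy
  rw [pd_dotProduct (differentiableAt_cross e hYd) (differentiableAt_of_contDiffOn hU h.smooth hσ),
    tangent_cross e hYd, dotProduct_comm] at h1
  have h2 : e ⨯₃ tangent Y σ b ⬝ᵥ N σ = -(e ⨯₃ N σ ⬝ᵥ tangent Y σ b) := by
    simp [cross_apply, dotProduct, Fin.sum_univ_three]; ring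
  linarith

/-- If the position vector is tangent to a connected minimal surface, then the surface lies in a
plane. -/
theorem plane_of_tangent (h : IsUnitNormal U Y N) (hU : IsOpen U) (hc : IsConnected U)
    (hY : ContDiffOn ℝ ∞ Y U) (hdet : ∀ σ ∈ U, (firstForm Y σ).det ≠ 0)
    (hmin : ∀ σ ∈ U, euclMean Y σ (N σ) = 0) (hQ : ∀ σ ∈ U, N σ ⬝ᵥ Y σ = 0) :
    ∃ w : Fin 3 → ℝ, w ≠ 0 ∧ ∀ σ ∈ U, w ⬝ᵥ Y σ = 0 := by
  have hNY : ∀ σ ∈ U, ∀ a, tangent N σ a ⬝ᵥ Y σ = 0 := fun σ hσ a => by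
    have h1 : pd (fun y => N y ⬝ᵥ Y y) a σ = 0 := by
      rw [pd_congr (G := fun _ => 0) ?_ a, pd_const]
      filter_upwards [hU.mem_nhds hσ] with y hy
      exact hQ y hy
    rw [pd_dotProduct (differentiableAt_of_contDiffOn hU h.smooth hσ)
      (differentiableAt_of_contDiffOn hU hY hσ), h.dot_tangent hσ, zero_add] at h1
    exact h1
  have hzero : ∀ σ ∈ U, ∀ a, tangent N σ a = 0 := fun σ hσ a => by
    have F := h.frame hU hY hσ (hdet σ hσ) (hmin σ hσ)
    rcases eq_or_ne (Y σ) 0 with h0 | h0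
    -- At the origin the kernel argument is empty. Differentiating `∂_a N · Y = 0` once more gives
    -- `∂_a N · ∂_b Y = 0` there.
    · refine F.eq_zero (fun b => ?_) (F.orth a)
      have h1 : pd (fun y => tangent N y a ⬝ᵥ Y y) b σ = 0 := by
        rw [pd_congr (G := fun _ => 0) ?_ b, pd_const]
        filter_upwards [hU.mem_nhds hσ] with y hy
        exact hNY y hy a
      rw [pd_dotProduct (differentiableAt_of_contDiffOn hU (contDiffOn_tangent hU h.smooth a) hσ)
        (differentiableAt_of_contDiffOn hU hY hσ), h0, dotProduct_zero, add_zero] at h1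
      exact h1
    · exact F.flat_of_kernel h0 (by rw [dotProduct_comm]; exact hQ σ hσ) (hNY σ hσ) a
  obtain ⟨σ₀, h0⟩ := hc.nonempty
  have hconst : ∀ σ ∈ U, N σ = N σ₀ := fun σ hσ => by
    ext i
    exact hU.is_const_of_fderiv_eq_zero hc.isPreconnected (f := fun y => N y i)
      ((contDiffOn_pi.1 h.smooth i).differentiableOn (by simp))
      (fun y hy => fderiv_eq_zero_of_pd fun a => congrFun (hzero y hy a) i) hσ h0
  refine ⟨N σ₀, fun hN => ?_, fun σ hσ => by rw [← hconst σ hσ]; exact hQ σ hσ⟩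
  have := h.unit σ₀ h0
  rw [hN] at this
  simp at this

end surface

end

section

/-! ## Stationary surfaces solving the extrinsic equation are planar -/

open scoped Matrix

theorem contDiffAt_artanh {x : ℝ} (h1 : -1 < x) (h2 : x < 1) : ContDiffAt ℝ ∞ Real.artanh x := by
  have h3 : 0 < (1 + x) / (1 - x) := div_pos (by linarith) (by linarith)
  have h4 : 1 - x ≠ 0 := by linarith
  unfold Real.artanh
  have h5 : ContDiffAt ℝ ∞ (fun x : ℝ => (1 + x) / (1 - x)) x :=
    (contDiffAt_const.add contDiffAt_id).div (contDiffAt_const.sub contDiffAt_id) h4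
  exact (h5.sqrt h3.ne').log (Real.sqrt_pos.2 h3).ne'

theorem hasDerivAt_artanh {x : ℝ} (h1 : -1 < x) (h2 : x < 1) :
    HasDerivAt Real.artanh (1 - x ^ 2)⁻¹ x := by
  have h3 : 1 + x ≠ 0 := by linarith
  have h4 : 1 - x ≠ 0 := by linarith
  have h5 : 1 - x ^ 2 ≠ 0 := by
    rw [show 1 - x ^ 2 = (1 + x) * (1 - x) by ring]; exact mul_ne_zero h3 h4
  have hd : HasDerivAt (fun y : ℝ => 1 / 2 * Real.log ((1 + y) / (1 - y))) (1 - x ^ 2)⁻¹ x := by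
    refine (((((hasDerivAt_id x).const_add 1).div ((hasDerivAt_id x).const_sub 1) h4).log
      (div_ne_zero h3 h4)).const_mul (1 / 2)).congr_deriv ?_
    simp only [id, Pi.div_apply]
    field_simp
    ring
  refine hd.congr_of_eventuallyEq ?_
  filter_upwards [Ioo_mem_nhds h1 h2] with y hy
  exact Real.artanh_eq_half_log ⟨hy.1.le, hy.2.le⟩

theorem pd_artanh {ι : Type} [Fintype ι] [DecidableEq ι] {α : (ι → ℝ) → ℝ} {x : ι → ℝ}
    (hα : DifferentiableAt ℝ α x) (h1 : -1 < α x) (h2 : α x < 1) (i : ι) :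
    pd (fun y => Real.artanh (α y)) i x = (1 - α x ^ 2)⁻¹ * pd α i x := by
  have h := (hasDerivAt_artanh h1 h2).comp_hasFDerivAt x hα.hasFDerivAt
  unfold pd
  rw [show (fun y => Real.artanh (α y)) = Real.artanh ∘ α from rfl, h.fderiv]
  simp

theorem dotProduct_self_cross {e : Fin 3 → ℝ} (he : e ⬝ᵥ e = 1) (y : Fin 3 → ℝ) :
    e ⨯₃ y ⬝ᵥ e ⨯₃ y = y ⬝ᵥ y - (y ⬝ᵥ e) ^ 2 := by
  rw [cross_dot_cross, he, dotProduct_comm e y]; ring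

namespace ConformalRadius

variable {C : ConformalRadius n rm L}

/-! ### Exclusion of static and rotating solutions with nonzero support function -/

/-- Data of a minimal surface solving the extrinsic equation on an open set. -/
structure SolvesLocally (C : ConformalRadius n rm L) (U : Set (Fin 2 → ℝ))
    (Y N : (Fin 2 → ℝ) → Fin 3 → ℝ) (χ : (Fin 2 → ℝ) → Fin 2 → ℝ) : Prop where
  isOpen : IsOpen U
  smooth : ContDiffOn ℝ ∞ Y U
  det : ∀ σ ∈ U, (firstForm Y σ).det ≠ 0
  minimal : ∀ σ ∈ U, ∀ m, (∀ a, m ⬝ᵥ tangent Y σ a = 0) → euclMean Y σ m = 0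
  normal : IsUnitNormal U Y N
  domain : ∀ σ ∈ U, euclid (Y σ) ∈ C.J
  timelike : ∀ σ ∈ U, (C.h (euclid (Y σ)))⁻¹ * speedSq Y χ σ < fSdS n rm L (C.R (euclid (Y σ)))
  extrinsic : ∀ σ ∈ U, Y σ ≠ 0 →
    C.bf (euclid (Y σ)) (speedSq Y χ σ) (N σ ⬝ᵥ Y σ) (normalAcc Y χ σ (N σ)) = 0

namespace SolvesLocally

variable {U O : Set (Fin 2 → ℝ)} {Y N : (Fin 2 → ℝ) → Fin 3 → ℝ} {χ : (Fin 2 → ℝ) → Fin 2 → ℝ}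
  {σ₀ σ : Fin 2 → ℝ} {e : Fin 3 → ℝ} {Ω : ℝ}

theorem mono (S : SolvesLocally C U Y N χ) (hO : IsOpen O) (h : O ⊆ U) :
    SolvesLocally C O Y N χ :=
  ⟨hO, S.smooth.mono h, fun σ hσ => S.det σ (h hσ), fun σ hσ => S.minimal σ (h hσ),
    ⟨S.normal.smooth.mono h, fun σ hσ => S.normal.unit σ (h hσ),
      fun σ hσ => S.normal.cross σ (h hσ)⟩,
    fun σ hσ => S.domain σ (h hσ), fun σ hσ => S.timelike σ (h hσ),
    fun σ hσ => S.extrinsic σ (h hσ)⟩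

theorem neg (S : SolvesLocally C U Y N χ) : SolvesLocally C U Y (fun σ => -N σ) χ :=
  { S with
    normal := S.normal.neg
    extrinsic := fun σ hσ h0 => by
      have h1 := bf_mul (C := C) (euclid (Y σ)) (speedSq Y χ σ) (N σ ⬝ᵥ Y σ)
        (normalAcc Y χ σ (N σ)) (-1)
      rw [S.extrinsic σ hσ h0, mul_zero] at h1
      rw [← h1]
      congr 1
      · simp
      · simp [normalAcc]; ring }

theorem frame (S : SolvesLocally C U Y N χ) (hσ : σ ∈ U) :
    MinimalFrame (tangent Y σ) (N σ) (tangent N σ) :=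
  S.normal.frame S.isOpen S.smooth hσ (S.det σ hσ)
    (S.minimal σ hσ _ fun a => S.normal.dot_tangent hσ a)

theorem exists_radial (S : SolvesLocally C U Y N χ) (hne : U.Nonempty) :
    ∃ σ ∈ U, ∃ a, pd (fun y => Y y ⬝ᵥ Y y) a σ ≠ 0 :=
  exists_radial_ne_zero S.isOpen hne S.smooth S.det S.minimal

theorem continuousOn_support (S : SolvesLocally C U Y N χ) :
    ContinuousOn (fun σ => N σ ⬝ᵥ Y σ) U :=
  (contDiffOn_dotProduct S.normal.smooth S.smooth).continuousOn

/-- The set where the support function does not vanish. -/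
theorem isOpen_support (S : SolvesLocally C U Y N χ) : IsOpen {σ ∈ U | N σ ⬝ᵥ Y σ ≠ 0} :=
  S.continuousOn_support.isOpen_inter_preimage S.isOpen isOpen_ne (t := {x | x ≠ 0})

/-- A minimal surface is not contained in a sphere about the origin, so its points cover an open set
of radii on which the static equation would hold. -/
theorem not_static (S : SolvesLocally C U Y N χ) (hrm : 0 ≤ rm) (hL : 0 < L)
    (hχ : ∀ σ ∈ U, χ σ = 0) (h0 : σ₀ ∈ U) (hQ : N σ₀ ⬝ᵥ Y σ₀ ≠ 0) : False := by
  have S' := S.mono S.isOpen_support fun σ hσ => hσ.1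
  obtain ⟨σ₁, h1, a, ha⟩ := S'.exists_radial ⟨σ₀, h0, hQ⟩
  have hY1 : Y σ₁ ≠ 0 := fun h => h1.2 (by simp [h])
  have hsm : ContDiffAt ℝ ∞ (fun y => Y y ⬝ᵥ Y y) σ₁ :=
    (contDiffOn_dotProduct S.smooth S.smooth).contDiffAt (S.isOpen.mem_nhds h1.1)
  have h2 := eventually_of_pd_ne_zero hsm ha (P := fun T => (n + 1) * C.slope (Real.sqrt T)
      + 4 * C.lapse (Real.sqrt T) ^ 2 - 4 * C.lapse (Real.sqrt T) = 0) (by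
    filter_upwards [S'.isOpen.mem_nhds h1] with σ hσ
    rw [← euclid_eq_sqrt]
    refine bf_static (S.domain σ hσ.1) hσ.2 ?_
    have h3 := S.extrinsic σ hσ.1 fun h => hσ.2 (by simp [h])
    simpa [speedSq, normalAcc, hχ σ hσ.1] using h3)
  have hpos := euclid_pos hY1
  refine not_eventually_static_radius (C := C) hrm hL (S.domain σ₁ h1.1) hpos ?_
  have hc : ContinuousAt (fun s : ℝ => s ^ 2) (euclid (Y σ₁)) := by fun_prop
  rw [← euclid_sq] at h2
  filter_upwards [hc.eventually h2, lt_mem_nhds hpos] with s hs hs0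
  rwa [Real.sqrt_sq hs0.le] at hs

theorem cross_normal (S : SolvesLocally C U Y N χ) (hΩ : Ω ≠ 0)
    (hχ : ∀ σ ∈ U, comb (tangent Y σ) (χ σ) = Ω • (e ⨯₃ Y σ)) (hσ : σ ∈ U) :
    e ⨯₃ Y σ ⬝ᵥ N σ = 0 := by
  have h1 := (S.frame hσ).comb_normal (χ σ)
  rw [hχ σ hσ, smul_dotProduct, smul_eq_mul] at h1
  exact (mul_eq_zero.1 h1).resolve_left hΩ

theorem comb_inv_smul (hΩ : Ω ≠ 0)
    (hχ : comb (tangent Y σ) (χ σ) = Ω • (e ⨯₃ Y σ)) :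
    comb (tangent Y σ) (Ω⁻¹ • χ σ) = e ⨯₃ Y σ := by
  have : comb (tangent Y σ) (Ω⁻¹ • χ σ) = Ω⁻¹ • comb (tangent Y σ) (χ σ) := by
    ext i; simp [comb]; ring
  rw [this, hχ, smul_smul, inv_mul_cancel₀ hΩ, one_smul]

theorem speedSq_rotating
    (hχ : comb (tangent Y σ) (χ σ) = Ω • (e ⨯₃ Y σ)) :
    speedSq Y χ σ = Ω ^ 2 * (e ⨯₃ Y σ ⬝ᵥ e ⨯₃ Y σ) := by
  rw [speedSq_eq, hχ, smul_dotProduct, dotProduct_smul]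
  simp only [smul_eq_mul]; ring

theorem normalAcc_rotating (S : SolvesLocally C U Y N χ) (hΩ : Ω ≠ 0) (he : e ⬝ᵥ e = 1)
    (hχ : ∀ σ ∈ U, comb (tangent Y σ) (χ σ) = Ω • (e ⨯₃ Y σ)) (hσ : σ ∈ U) :
    normalAcc Y χ σ (N σ) = Ω ^ 2 * ((N σ ⬝ᵥ e) * (Y σ ⬝ᵥ e) - N σ ⬝ᵥ Y σ) := by
  have hd := dnormal_rotation S.normal S.isOpen S.smooth
    (fun σ hσ => S.cross_normal hΩ hχ hσ) hσ
  have h1 := (S.frame hσ).normal_acc_rotation he hd (comb_inv_smul hΩ (hχ σ hσ))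
  have h2 : ∀ T : Fin 2 → Fin 3 → ℝ, comb T (χ σ) = Ω • comb T (Ω⁻¹ • χ σ) := fun T => by
    ext i; simp [comb]; field_simp
  rw [normalAcc_eq S.normal S.isOpen S.smooth hσ, h2 (tangent N σ), h2 (tangent Y σ),
    smul_dotProduct, dotProduct_smul, h1]
  simp only [smul_eq_mul]; ring

/-- Were the surface inside the axis, both tangent vectors would be parallel to `e`, which an
immersion forbids. -/
theorem exists_cross_ne_zero (S : SolvesLocally C U Y N χ) (he : e ⬝ᵥ e = 1)
    (hne : U.Nonempty) : ∃ σ ∈ U, e ⨯₃ Y σ ≠ 0 := by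
  by_contra! hc
  obtain ⟨σ, hσ⟩ := hne
  have h1 : ∀ a, e ⨯₃ tangent Y σ a = 0 := fun a => by
    rw [← tangent_cross e (differentiableAt_of_contDiffOn S.isOpen S.smooth hσ)]
    ext i
    unfold tangent
    rw [pd_congr (G := fun _ => 0) ?_ a, pd_const, Pi.zero_apply]
    filter_upwards [S.isOpen.mem_nhds hσ] with y hy
    rw [hc y hy, Pi.zero_apply]
  have h2 : ∀ a, tangent Y σ a = (e ⬝ᵥ tangent Y σ a) • e := fun a => by
    have h3 : e ⨯₃ (e ⨯₃ tangent Y σ a)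
        = (e ⬝ᵥ tangent Y σ a) • e - (e ⬝ᵥ e) • tangent Y σ a := by
      ext i
      fin_cases i <;> simp [cross_apply, dotProduct, Fin.sum_univ_three] <;> ring
    rw [h1, he, one_smul, map_zero] at h3
    exact (sub_eq_zero.1 h3.symm).symm
  apply (S.frame hσ).triple_ne_zero
  rw [dot_cross_comm]
  rw [h2 0, h2 1]
  simp

theorem differentiableAt_pitch (S : SolvesLocally C U Y N χ) (hσ : σ ∈ U) :
    DifferentiableAt ℝ (fun y => (N y ⬝ᵥ e) * (Y y ⬝ᵥ e) - N y ⬝ᵥ Y y) σ :=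
  ((((contDiffOn_dotProduct S.normal.smooth contDiffOn_const).mul
    (contDiffOn_dotProduct S.smooth contDiffOn_const)).sub
    (contDiffOn_dotProduct S.normal.smooth S.smooth)).contDiffAt
      (S.isOpen.mem_nhds hσ)).differentiableAt (by simp)

theorem pd_pitch (S : SolvesLocally C U Y N χ) (hΩ : Ω ≠ 0) (he : e ⬝ᵥ e = 1)
    (hχ : ∀ σ ∈ U, comb (tangent Y σ) (χ σ) = Ω • (e ⨯₃ Y σ)) (hσ : σ ∈ U)
    (hW : e ⨯₃ Y σ ≠ 0) (b : Fin 2) :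
    pd (fun y => (N y ⬝ᵥ e) * (Y y ⬝ᵥ e) - N y ⬝ᵥ Y y) b σ = 0 := by
  have hN := differentiableAt_of_contDiffOn S.isOpen S.normal.smooth hσ
  have hY := differentiableAt_of_contDiffOn S.isOpen S.smooth hσ
  have hNe := differentiableAt_of_contDiffOn (κ := Fin 1) S.isOpen
    (contDiffOn_pi.2 fun _ => contDiffOn_dotProduct S.normal.smooth (contDiffOn_const (c := e))) hσ
  have hYe := differentiableAt_of_contDiffOn (κ := Fin 1) S.isOpen
    (contDiffOn_pi.2 fun _ => contDiffOn_dotProduct S.smooth (contDiffOn_const (c := e))) hσ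
  have hNY := differentiableAt_of_contDiffOn (κ := Fin 1) S.isOpen
    (contDiffOn_pi.2 fun _ => contDiffOn_dotProduct S.normal.smooth S.smooth) hσ
  replace hNe := differentiableAt_pi.1 hNe 0
  replace hYe := differentiableAt_pi.1 hYe 0
  replace hNY := differentiableAt_pi.1 hNY 0
  have hneg : ∀ y, (N y ⬝ᵥ e) * (Y y ⬝ᵥ e) - N y ⬝ᵥ Y y
      = (N y ⬝ᵥ e) * (Y y ⬝ᵥ e) + -(N y ⬝ᵥ Y y) := fun y => sub_eq_add_neg _ _
  simp only [hneg]
  rw [pd_add (hNe.fun_mul hYe) hNY.fun_neg, pd_mul hNe hYe, pd_neg, pd_dotProduct hN hY,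
    pd_dotProduct_const hN, pd_dotProduct_const hY, S.normal.dot_tangent hσ]
  have hd := dnormal_rotation S.normal S.isOpen S.smooth
    (fun σ hσ => S.cross_normal hΩ hχ hσ) hσ
  have h1 := (S.frame hσ).pitch_stationary he (S.cross_normal hΩ hχ hσ) hW hd b
  rw [dotProduct_sub, dotProduct_smul, smul_eq_mul] at h1
  linarith

theorem eventually_pitch (S : SolvesLocally C U Y N χ) (hΩ : Ω ≠ 0) (he : e ⬝ᵥ e = 1)
    (hχ : ∀ σ ∈ U, comb (tangent Y σ) (χ σ) = Ω • (e ⨯₃ Y σ))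
    (hW : ∀ σ ∈ U, e ⨯₃ Y σ ≠ 0) (hσ : σ ∈ U) :
    ∀ᶠ y in 𝓝 σ, (N y ⬝ᵥ e) * (Y y ⬝ᵥ e) - N y ⬝ᵥ Y y
      = (N σ ⬝ᵥ e) * (Y σ ⬝ᵥ e) - N σ ⬝ᵥ Y σ :=
  eventually_const_of_pd (g := fun y => (N y ⬝ᵥ e) * (Y y ⬝ᵥ e) - N y ⬝ᵥ Y y) (by
    filter_upwards [S.isOpen.mem_nhds hσ] with y hy
    exact ⟨S.differentiableAt_pitch hy, fun b => S.pd_pitch hΩ he hχ hy (hW y hy) b⟩)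

/-- The case in which the axis of rotation is normal to the surface. -/
theorem not_rotating_plane (S : SolvesLocally C U Y N χ) (hrm : 0 ≤ rm) (hL : 0 < L)
    (hΩ : Ω ≠ 0) (he : e ⬝ᵥ e = 1)
    (hχ : ∀ σ ∈ U, comb (tangent Y σ) (χ σ) = Ω • (e ⨯₃ Y σ))
    (hW : ∀ σ ∈ U, e ⨯₃ Y σ ≠ 0) (hQ : ∀ σ ∈ U, N σ ⬝ᵥ Y σ ≠ 0)
    (hc : ∀ σ ∈ U, (N σ ⬝ᵥ e) * (Y σ ⬝ᵥ e) - N σ ⬝ᵥ Y σ = 0) (hne : U.Nonempty) : False := by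
  obtain ⟨σ₁, h1, a, ha⟩ := S.exists_radial hne
  -- Vanishing of the constant makes `radius_sq` say that the normal is parallel to the axis; hence
  -- the height is constant.
  have hα : ∀ σ ∈ U, (N σ ⬝ᵥ e) ^ 2 = 1 := fun σ hσ => by
    have h2 := (S.frame hσ).radius_sq he (S.cross_normal hΩ hχ hσ)
    rw [hc σ hσ] at h2
    have h3 : e ⨯₃ Y σ ⬝ᵥ e ⨯₃ Y σ ≠ 0 := fun h => hW σ hσ (dotProduct_self_eq_zero.1 h)
    have := (mul_eq_zero.1 (h2.trans (by norm_num))).resolve_left h3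
    linarith
  have hz : ∀ᶠ σ in 𝓝 σ₁, Y σ ⬝ᵥ e = Y σ₁ ⬝ᵥ e := by
    refine eventually_const_of_pd ?_
    filter_upwards [S.isOpen.mem_nhds h1] with σ hσ
    have hY := differentiableAt_of_contDiffOn S.isOpen S.smooth hσ
    refine ⟨((contDiffOn_dotProduct S.smooth contDiffOn_const).contDiffAt
      (S.isOpen.mem_nhds hσ)).differentiableAt (by simp), fun b => ?_⟩
    rw [pd_dotProduct_const hY]
    have h2 : e - (N σ ⬝ᵥ e) • N σ = 0 := by
      rw [← dotProduct_self_eq_zero]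
      simp only [sub_dotProduct, dotProduct_sub, smul_dotProduct, dotProduct_smul, he,
        S.normal.unit σ hσ, smul_eq_mul, dotProduct_comm e (N σ)]
      linear_combination -(hα σ hσ)
    rw [sub_eq_zero.1 h2, dotProduct_smul, dotProduct_comm (tangent Y σ b), S.normal.dot_tangent hσ, smul_zero]
  set z := Y σ₁ ⬝ᵥ e with hzdef
  have hz0 : z ≠ 0 := fun h => hQ σ₁ h1 (by have := hc σ₁ h1; rw [← hzdef, h] at this; linarith)
  have hsm : ContDiffAt ℝ ∞ (fun y => Y y ⬝ᵥ Y y) σ₁ :=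
    (contDiffOn_dotProduct S.smooth S.smooth).contDiffAt (S.isOpen.mem_nhds h1)
  have h2 := eventually_of_pd_ne_zero hsm ha
    (P := fun T => C.bf (Real.sqrt T) (Ω ^ 2 * (T - z ^ 2)) z 0 = 0) (by
    filter_upwards [S.isOpen.mem_nhds h1, hz] with σ hσ hzσ
    have h3 := S.extrinsic σ hσ fun h => hQ σ hσ (by simp [h])
    have h4 : N σ ⬝ᵥ Y σ = (N σ ⬝ᵥ e) * z := by rw [← hzσ]; linarith [hc σ hσ]
    rw [S.normalAcc_rotating hΩ he hχ hσ, hc σ hσ, speedSq_rotating (hχ σ hσ),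
      dotProduct_self_cross he, hzσ, h4,
      show Ω ^ 2 * 0 = (N σ ⬝ᵥ e) * 0 by ring, bf_mul, euclid_eq_sqrt] at h3
    refine (mul_eq_zero.1 h3).resolve_left fun h => ?_
    have := hα σ hσ
    rw [h] at this
    norm_num at this)
  have hp : 0 < Y σ₁ ⬝ᵥ Y σ₁ - z ^ 2 := by
    rw [← dotProduct_self_cross he, ← euclid_sq]
    have := euclid_pos (hW σ₁ h1)
    positivity
  set p := Real.sqrt (Y σ₁ ⬝ᵥ Y σ₁ - z ^ 2) with hpdef
  have hp2 : p ^ 2 + z ^ 2 = Y σ₁ ⬝ᵥ Y σ₁ := by rw [hpdef, Real.sq_sqrt hp.le]; ring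
  refine not_eventually_plane (C := C) hrm hL hz0 hΩ (Real.sqrt_pos.2 hp) ?_ ?_
  · rw [← hpdef, hp2, ← euclid_eq_sqrt]
    exact S.domain σ₁ h1
  · have hcont : ContinuousAt (fun q : ℝ => q ^ 2 + z ^ 2) p := by fun_prop
    rw [← hp2] at h2
    filter_upwards [hcont.eventually h2] with q hq
    rwa [show q ^ 2 + z ^ 2 - z ^ 2 = q ^ 2 by ring] at hq

/-- The case in which the surface is a catenoid about the axis of rotation. -/
theorem not_rotating_catenoid (S : SolvesLocally C U Y N χ) (hn : 1 ≤ n) (hrm : 0 ≤ rm)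
    (hL : 0 < L) (hΩ : Ω ≠ 0) (he : e ⬝ᵥ e = 1)
    (hχ : ∀ σ ∈ U, comb (tangent Y σ) (χ σ) = Ω • (e ⨯₃ Y σ))
    (hW : ∀ σ ∈ U, e ⨯₃ Y σ ≠ 0) {c : ℝ} (hc0 : 0 < c)
    (hc : ∀ σ ∈ U, (N σ ⬝ᵥ e) * (Y σ ⬝ᵥ e) - N σ ⬝ᵥ Y σ = c) (h0 : σ₀ ∈ U) : False := by
  have hp : ∀ σ ∈ U, 0 < e ⨯₃ Y σ ⬝ᵥ e ⨯₃ Y σ := fun σ hσ => by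
    rw [← euclid_sq]
    have := euclid_pos (hW σ hσ)
    positivity
  have hrad : ∀ σ ∈ U, (e ⨯₃ Y σ ⬝ᵥ e ⨯₃ Y σ) * (1 - (N σ ⬝ᵥ e) ^ 2) = c ^ 2 := fun σ hσ => by
    rw [(S.frame hσ).radius_sq he (S.cross_normal hΩ hχ hσ), hc σ hσ]
  have hα : ∀ σ ∈ U, 0 < 1 - (N σ ⬝ᵥ e) ^ 2 := fun σ hσ => by
    have h2 := hrad σ hσ
    exact pos_of_mul_pos_right (by rw [h2]; positivity) (hp σ hσ).le
  have hIoo : ∀ σ ∈ U, N σ ⬝ᵥ e ∈ Set.Ioo (-1) 1 := fun σ hσ =>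
    abs_lt.1 (by rw [← sq_lt_one_iff_abs_lt_one]; linarith [hα σ hσ])
  have hNe : ContDiffOn ℝ ∞ (fun σ => N σ ⬝ᵥ e) U :=
    contDiffOn_dotProduct S.normal.smooth contDiffOn_const
  have hYe : ContDiffOn ℝ ∞ (fun σ => Y σ ⬝ᵥ e) U :=
    contDiffOn_dotProduct S.smooth contDiffOn_const
  -- On a catenoid `N · e = tanh u`, so `artanh` recovers the profile parameter; `angle_height` then
  -- says that the height is `c u` plus a constant.
  set u : (Fin 2 → ℝ) → ℝ := fun σ => Real.artanh (N σ ⬝ᵥ e) with hu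
  have husm : ∀ σ ∈ U, ContDiffAt ℝ ∞ u σ := fun σ hσ =>
    ContDiffAt.comp (g := Real.artanh) σ (contDiffAt_artanh (hIoo σ hσ).1 (hIoo σ hσ).2)
      (hNe.contDiffAt (S.isOpen.mem_nhds hσ))
  have hpdu : ∀ σ ∈ U, ∀ b, c * pd u b σ = tangent Y σ b ⬝ᵥ e := fun σ hσ b => by
    rw [hu, pd_artanh ((hNe.contDiffAt (S.isOpen.mem_nhds hσ)).differentiableAt (by simp))
      (hIoo σ hσ).1 (hIoo σ hσ).2,
      pd_dotProduct_const (differentiableAt_of_contDiffOn S.isOpen S.normal.smooth hσ)]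
    have hd := dnormal_rotation S.normal S.isOpen S.smooth
      (fun σ hσ => S.cross_normal hΩ hχ hσ) hσ
    have h1 := (S.frame hσ).angle_height he (S.cross_normal hΩ hχ hσ) (hW σ hσ) hd b
    rw [hc σ hσ] at h1
    have := (hα σ hσ).ne'
    field_simp
    linarith
  have hzu : ∀ᶠ σ in 𝓝 σ₀, Y σ ⬝ᵥ e + -c * u σ = Y σ₀ ⬝ᵥ e + -c * u σ₀ := by
    refine eventually_const_of_pd (g := fun σ => Y σ ⬝ᵥ e + -c * u σ) ?_
    filter_upwards [S.isOpen.mem_nhds h0] with σ hσ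
    have h1 : DifferentiableAt ℝ (fun σ => Y σ ⬝ᵥ e) σ :=
      (hYe.contDiffAt (S.isOpen.mem_nhds hσ)).differentiableAt (by simp)
    have h2 : DifferentiableAt ℝ u σ := (husm σ hσ).differentiableAt (by simp)
    refine ⟨h1.add (h2.const_mul _), fun b => ?_⟩
    rw [pd_add h1 (h2.const_mul _), pd_mul (differentiableAt_const _) h2, pd_const,
      pd_dotProduct_const (differentiableAt_of_contDiffOn S.isOpen S.smooth hσ), ← hpdu σ hσ b]
    ring
  set z := Y σ₀ ⬝ᵥ e + -c * u σ₀ with hz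
  have hcosh : ∀ σ ∈ U, c ^ 2 * Real.cosh (u σ) ^ 2 = e ⨯₃ Y σ ⬝ᵥ e ⨯₃ Y σ := fun σ hσ => by
    rw [hu, Real.cosh_artanh (hIoo σ hσ), div_pow, Real.sq_sqrt (hα σ hσ).le, ← hrad σ hσ]
    have := (hα σ hσ).ne'
    field_simp
  have hS : ∀ σ ∈ U, Y σ ⬝ᵥ e + -c * u σ = z → catS c z (u σ) = Y σ ⬝ᵥ Y σ :=
    fun σ hσ h => by
      unfold catS
      rw [hcosh σ hσ, dotProduct_self_cross he, ← h]
      ring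
  have hne0 : ∀ σ ∈ U, Y σ ≠ 0 := fun σ hσ h => hW σ hσ (by simp [h])
  obtain ⟨b, hb⟩ := (S.frame h0).exists_height_ne_zero he (by linarith [hα σ₀ h0])
  have hub : pd u b σ₀ ≠ 0 := fun h => hb (by rw [← hpdu σ₀ h0, h, mul_zero])
  have hS0 := hS σ₀ h0 rfl
  refine not_eventually_cat (C := C) (u₀ := u σ₀) hn hrm hL hc0 hΩ (z := z) ?_ ?_
    (eventually_of_pd_ne_zero (husm σ₀ h0) hub (P := fun t => catEq C c z Ω t = 0) ?_)
  · rw [hS0, ← euclid_eq_sqrt]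
    exact S.domain σ₀ h0
  · rw [hS0, ← euclid_eq_sqrt, hcosh σ₀ h0]
    have h1 := S.timelike σ₀ h0
    rw [speedSq_rotating (hχ σ₀ h0), h_inv (S.domain σ₀ h0) (euclid_pos (hne0 σ₀ h0))] at h1
    convert h1 using 1
    ring
  · filter_upwards [S.isOpen.mem_nhds h0, hzu] with σ hσ hzσ
    have h1 := S.extrinsic σ hσ (hne0 σ hσ)
    rw [S.normalAcc_rotating hΩ he hχ hσ, hc σ hσ, speedSq_rotating (hχ σ hσ),
      euclid_eq_sqrt, ← hcosh σ hσ, ← hS σ hσ hzσ] at h1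
    have h2 : catQ c z (u σ) = N σ ⬝ᵥ Y σ := by
      unfold catQ
      rw [← Real.tanh_eq_sinh_div_cosh, hu, Real.tanh_artanh (hIoo σ hσ)]
      have h3 := hc σ hσ
      rw [← hzσ, hu]
      linear_combination h3
    unfold catEq
    rw [h2]
    exact h1

/-- The open set is shrunk until the support function is nonzero, the axis is avoided and the
catenoid constant is really constant. Its sign is adjusted by reversing the normal. -/
theorem not_rotating (S : SolvesLocally C U Y N χ) (hn : 1 ≤ n) (hrm : 0 ≤ rm) (hL : 0 < L)
    (hΩ : Ω ≠ 0) (he : e ⬝ᵥ e = 1)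
    (hχ : ∀ σ ∈ U, comb (tangent Y σ) (χ σ) = Ω • (e ⨯₃ Y σ)) (h0 : σ₀ ∈ U)
    (hQ : N σ₀ ⬝ᵥ Y σ₀ ≠ 0) : False := by
  have S₁ := S.mono S.isOpen_support fun σ hσ => hσ.1
  obtain ⟨σ₁, h1, hW1⟩ := S₁.exists_cross_ne_zero he ⟨σ₀, h0, hQ⟩
  have hcross : ContinuousOn (fun σ => e ⨯₃ Y σ) {σ ∈ U | N σ ⬝ᵥ Y σ ≠ 0} := fun σ hσ =>
    (differentiableAt_cross e
      (differentiableAt_of_contDiffOn S.isOpen S.smooth hσ.1)).continuousAt.continuousWithinAt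
  have hO₂ : IsOpen ({σ ∈ U | N σ ⬝ᵥ Y σ ≠ 0} ∩ (fun σ => e ⨯₃ Y σ) ⁻¹' {x | x ≠ 0}) :=
    hcross.isOpen_inter_preimage S₁.isOpen isOpen_ne
  have S₂ := S₁.mono hO₂ Set.inter_subset_left
  obtain ⟨V, hV, hVo, h1V⟩ := mem_nhds_iff.1 (Filter.inter_mem (hO₂.mem_nhds ⟨h1, hW1⟩)
    (S₂.eventually_pitch hΩ he (fun σ hσ => hχ σ hσ.1.1) (fun σ hσ => hσ.2) ⟨h1, hW1⟩))
  have S₃ := S₂.mono hVo fun σ hσ => (hV hσ).1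
  have hχ₃ : ∀ σ ∈ V, comb (tangent Y σ) (χ σ) = Ω • (e ⨯₃ Y σ) := fun σ hσ =>
    hχ σ (hV hσ).1.1.1
  have hW₃ : ∀ σ ∈ V, e ⨯₃ Y σ ≠ 0 := fun σ hσ => (hV hσ).1.2
  have hc₃ : ∀ σ ∈ V, _ = _ := fun σ hσ => (hV hσ).2
  rcases lt_trichotomy ((N σ₁ ⬝ᵥ e) * (Y σ₁ ⬝ᵥ e) - N σ₁ ⬝ᵥ Y σ₁) 0 with h | h | h
  · refine S₃.neg.not_rotating_catenoid hn hrm hL hΩ he hχ₃ hW₃ (neg_pos.2 h) (fun σ hσ => ?_) h1V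
    rw [← hc₃ σ hσ]
    simp only [neg_dotProduct]
    ring
  · exact S₃.not_rotating_plane hrm hL hΩ he hχ₃ hW₃ (fun σ hσ => (hV hσ).1.1.2)
      (fun σ hσ => by rw [hc₃ σ hσ, h]) ⟨σ₁, h1V⟩
  · exact S₃.not_rotating_catenoid hn hrm hL hΩ he hχ₃ hW₃ h hc₃ h1V

end SolvesLocally

end ConformalRadius

end

section

/-! ## The extrinsic equation for stationary minimal surfaces -/

open scoped Matrix

section surface

variable {U : Set (Fin 2 → ℝ)} {Y : (Fin 2 → ℝ) → Fin 3 → ℝ} {σ : Fin 2 → ℝ} {w : Fin 3 → ℝ}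

theorem dot_tangent_of_plane (hU : IsOpen U) (hY : ContDiffOn ℝ ∞ Y U)
    (h : ∀ σ ∈ U, w ⬝ᵥ Y σ = 0) (hσ : σ ∈ U) (a : Fin 2) : w ⬝ᵥ tangent Y σ a = 0 := by
  rw [dotProduct_comm, ← pd_dotProduct_const (differentiableAt_of_contDiffOn hU hY hσ),
    pd_congr (G := fun _ => 0) ?_ a, pd_const]
  filter_upwards [hU.mem_nhds hσ] with y hy
  rw [dotProduct_comm]
  exact h y hy

theorem dot_hess_of_plane (hU : IsOpen U) (hY : ContDiffOn ℝ ∞ Y U)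
    (h : ∀ σ ∈ U, w ⬝ᵥ Y σ = 0) (hσ : σ ∈ U) (a b : Fin 2) : w ⬝ᵥ hess Y σ a b = 0 :=
  dot_tangent_of_plane hU (contDiffOn_tangent hU hY b)
    (fun _ h' => dot_tangent_of_plane hU hY h h' b) hσ a

/-- All normals of a surface in a plane are parallel to the normal of the plane. -/
theorem normal_parallel {N : (Fin 2 → ℝ) → Fin 3 → ℝ} (hN : IsUnitNormal U Y N) (hσ : σ ∈ U)
    {m : Fin 3 → ℝ} (hm : ∀ a, m ⬝ᵥ tangent Y σ a = 0) : m = (m ⬝ᵥ N σ) • N σ := by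
  obtain ⟨κ, hκ, h⟩ := hN.cross σ hσ
  refine sub_eq_zero.1 (eq_zero_of_orthogonal (a := tangent Y σ 0) (b := tangent Y σ 1)
    (c := N σ) ?_ ?_ ?_ ?_)
  · rw [dot_cross_comm, h, dotProduct_smul, hN.unit σ hσ]
    simpa using hκ
  · rw [sub_dotProduct, smul_dotProduct, hm, hN.dot_tangent hσ]; simp
  · rw [sub_dotProduct, smul_dotProduct, hm, hN.dot_tangent hσ]; simp
  · rw [sub_dotProduct, smul_dotProduct, hN.unit σ hσ]; simp

end surface

namespace ConformalRadius

variable {C : ConformalRadius n rm L} {U : Set (Fin 2 → ℝ)} {Y : (Fin 2 → ℝ) → Fin 3 → ℝ}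
  {χ : (Fin 2 → ℝ) → Fin 2 → ℝ} {σ : Fin 2 → ℝ}

theorem kSq_eq_speedSq (s : WVIndex → ℝ) : kSq C.metric (typeI n Y) (wvField χ) s
    = fSdS n rm L (C.R (euclid (Y fun a => s (some a))))
      - (C.h (euclid (Y fun a => s (some a))))⁻¹ * speedSq Y χ (fun a => s (some a)) := by
  rw [kSq_typeI, potF_pad, potH_pad]

end ConformalRadius

namespace IsStationaryTypeI

open ConformalRadius

variable {C : ConformalRadius n rm L} {U : Set (Fin 2 → ℝ)} {Y : (Fin 2 → ℝ) → Fin 3 → ℝ}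
  {χ : (Fin 2 → ℝ) → Fin 2 → ℝ} {σ : Fin 2 → ℝ}

theorem euclid_mem (S : IsStationaryTypeI C U Y χ) (hσ : σ ∈ U) : euclid (Y σ) ∈ C.J :=
  euclid_of_mem_domain (s := liftPoint σ) (S.mem_domain (liftPoint σ) hσ)

theorem euclMean_eq_zero (S : IsStationaryTypeI C U Y χ) (hσ : σ ∈ U) {m : Fin 3 → ℝ}
    (hm : ∀ a, m ⬝ᵥ tangent Y σ a = 0) : euclMean Y σ m = 0 := by
  rw [← meanCurv_one]
  exact S.minimal σ hσ m hm

theorem det_ne_zero (S : IsStationaryTypeI C U Y χ) (hσ : σ ∈ U) : (firstForm Y σ).det ≠ 0 :=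
  firstForm_det_ne_zero (S.immersion σ hσ)

theorem exists_normal (S : IsStationaryTypeI C U Y χ) : ∃ N, IsUnitNormal U Y N :=
  exists_unitNormal S.isOpen S.smooth S.immersion

theorem solvesLocally (S : IsStationaryTypeI C U Y χ) (hrm : 0 ≤ rm) (hL : 0 < L)
    {N : (Fin 2 → ℝ) → Fin 3 → ℝ} (hN : IsUnitNormal U Y N)
    (hE : ExtrinsicEquation n C.metric (typeI n Y) (worldvolume U) (wvField χ)) :
    SolvesLocally C U Y N χ where
  isOpen := S.isOpen
  smooth := S.smooth
  det σ hσ := S.det_ne_zero hσ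
  minimal σ hσ m hm := S.euclMean_eq_zero hσ hm
  normal := hN
  domain σ hσ := S.euclid_mem hσ
  timelike σ hσ := by
    have h := S.timelike (liftPoint σ) hσ
    rw [kSq_eq_speedSq] at h
    exact sub_pos.1 h
  extrinsic σ hσ h0 := bf_eq_zero hrm hL S.mem_domain S.timelike hE hσ
    (fun a => hN.dot_tangent hσ a) h0 (S.det_ne_zero hσ)
    (S.euclMean_eq_zero hσ fun a => hN.dot_tangent hσ a)

/-- Either the support function vanishes identically and the position vector is tangent, or it is
nonzero somewhere and the velocity, being zero or a rotation, is excluded near that point. -/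
theorem exists_plane (S : IsStationaryTypeI C U Y χ) (hn : 1 ≤ n) (hrm : 0 ≤ rm) (hL : 0 < L)
    (hE : ExtrinsicEquation n C.metric (typeI n Y) (worldvolume U) (wvField χ)) :
    ∃ w : Fin 3 → ℝ, w ≠ 0 ∧ ∀ σ ∈ U, w ⬝ᵥ Y σ = 0 := by
  obtain ⟨N, hN⟩ := S.exists_normal
  have T := S.solvesLocally hrm hL hN hE
  by_cases hQ : ∀ σ ∈ U, N σ ⬝ᵥ Y σ = 0
  · exact plane_of_tangent hN S.isOpen S.connected S.smooth T.det
      (fun σ hσ => T.minimal σ hσ _ fun a => hN.dot_tangent hσ a) hQ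
  push Not at hQ
  obtain ⟨σ₀, h0, hQ0⟩ := hQ
  exfalso
  obtain ⟨w, hw⟩ := exists_cross_of_killing hrm hL S.mem_domain S.killing
  rcases eq_or_ne w 0 with rfl | hw0
  · refine T.not_static hrm hL (fun σ hσ => (T.frame hσ).comb_injective ?_) h0 hQ0
    have := hw σ hσ
    rw [map_zero, LinearMap.zero_apply] at this
    exact this
  · have hpos := euclid_pos hw0
    refine T.not_rotating (e := (euclid w)⁻¹ • w) hn hrm hL hpos.ne' ?_ (fun σ hσ => ?_) h0 hQ0
    · rw [smul_dotProduct, dotProduct_smul, ← euclid_sq, smul_eq_mul, smul_eq_mul]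
      field_simp
    · rw [map_smul, LinearMap.smul_apply, smul_smul, mul_inv_cancel₀ hpos.ne', one_smul]
      exact hw σ hσ

theorem extrinsicEquation_of_plane (S : IsStationaryTypeI C U Y χ) {w : Fin 3 → ℝ} (hw0 : w ≠ 0)
    (hw : ∀ σ ∈ U, w ⬝ᵥ Y σ = 0) :
    ExtrinsicEquation n C.metric (typeI n Y) (worldvolume U) (wvField χ) := by
  intro s hs m hm
  obtain ⟨N, hN⟩ := S.exists_normal
  have hJ := S.euclid_mem hs
  have hm' := normal_parallel hN hs (isNormal_typeI.1 hm).2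
  have hw' := normal_parallel hN hs (dot_tangent_of_plane S.isOpen S.smooth hw hs)
  set σ : Fin 2 → ℝ := fun a => s (some a) with hσ
  have hwN : w ⬝ᵥ N σ ≠ 0 := fun h => hw0 (by rw [hw', h, zero_smul])
  have hzero : ∀ x : Fin 3 → ℝ, w ⬝ᵥ x = 0 → (trunc fun q => m (some q)) ⬝ᵥ x = 0 := fun x hx => by
    rw [hw', smul_dotProduct, smul_eq_mul] at hx
    rw [hm', smul_dotProduct, (mul_eq_zero.1 hx).resolve_left hwN, smul_zero]
  refine extrinsic_eq_of_flat hm ?_ ?_ (S.det_ne_zero hs) (S.timelike s hs) (hzero _ (hw σ hs))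
    fun a b => hzero _ (dot_hess_of_plane S.isOpen S.smooth hw hs a b)
  · rw [potF_pad]; exact (f_pos hJ).ne'
  · rw [potH_pad]; exact (inv_pos.2 (C.h_pos _ hJ)).ne'

/-- In a plane through the origin the velocity is a rotation of the plane. -/
theorem exists_redshift (S : IsStationaryTypeI C U Y χ) (hrm : 0 ≤ rm) (hL : 0 < L)
    {w : Fin 3 → ℝ} (hw0 : w ≠ 0) (hw : ∀ σ ∈ U, w ⬝ᵥ Y σ = 0) :
    ∃ Ω : ℝ, ∀ s ∈ worldvolume U, kSq C.metric (typeI n Y) (wvField χ) s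
      = C.redshift Ω (euclid (Y fun a => s (some a))) := by
  obtain ⟨v, hv⟩ := exists_cross_of_killing hrm hL S.mem_domain S.killing
  obtain ⟨N, hN⟩ := S.exists_normal
  -- The velocity `v × Y` is tangent to the plane, so `w × v` is orthogonal to every position as
  -- well and must be parallel to `w`. Being also orthogonal to `w`, it vanishes.
  have hperp : ∀ σ ∈ U, (w ⨯₃ v) ⬝ᵥ Y σ = 0 := fun σ hσ => by
    have h1 : w ⬝ᵥ v ⨯₃ Y σ = 0 := by
      rw [← hv σ hσ, dotProduct_add, dotProduct_smul, dotProduct_smul,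
        dot_tangent_of_plane S.isOpen S.smooth hw hσ, dot_tangent_of_plane S.isOpen S.smooth hw hσ]
      simp
    rw [dotProduct_comm, ← dot_cross_comm]
    exact h1
  obtain ⟨σ₀, h0⟩ := S.connected.nonempty
  have h1 := normal_parallel hN h0 (dot_tangent_of_plane S.isOpen S.smooth hperp h0)
  have h2 := normal_parallel hN h0 (dot_tangent_of_plane S.isOpen S.smooth hw h0)
  have hwN : w ⬝ᵥ N σ₀ ≠ 0 := fun h => hw0 (by rw [h2, h, zero_smul])
  have h3 : w ⨯₃ v ⬝ᵥ N σ₀ = 0 := by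
    have h4 := congrArg (fun x => x ⬝ᵥ w ⨯₃ v) h2
    simp only [dot_self_cross, smul_dotProduct, smul_eq_mul] at h4
    rw [dotProduct_comm]
    exact (mul_eq_zero.1 h4.symm).resolve_left hwN
  have hpar : w ⨯₃ v = 0 := by rw [h1, h3, zero_smul]
  have hww : w ⬝ᵥ w ≠ 0 := fun h => hw0 (dotProduct_self_eq_zero.1 h)
  have hvY : ∀ σ ∈ U, v ⬝ᵥ Y σ = 0 := fun σ hσ => by
    have h4 := cross_dot_cross w v w (Y σ)
    rw [hpar, zero_dotProduct, hw σ hσ, zero_mul, sub_zero] at h4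
    exact (mul_eq_zero.1 h4.symm).resolve_left hww
  -- The sense of rotation is lost here, harmlessly, since only `Ω²` enters.
  refine ⟨euclid v, fun s hs => ?_⟩
  rw [kSq_eq_speedSq]
  set σ : Fin 2 → ℝ := fun a => s (some a) with hσ
  have hcomb : comb (tangent Y σ) (χ σ) = v ⨯₃ Y σ := hv σ hs
  have hJ := S.euclid_mem hs
  rw [speedSq_eq, hcomb, cross_dot_cross, hvY σ hs, ← euclid_sq, ← euclid_sq]
  unfold redshift
  have := C.sq_eq _ hJ
  rw [← hσ] at this
  rw [this]
  ring

end IsStationaryTypeI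

end

section

/-! ## Planes through the origin -/

open scoped Matrix

section plane

variable {e : Fin 2 → Fin 3 → ℝ}

theorem planeMap_eq_comb (e : Fin 2 → Fin 3 → ℝ) : planeMap e = comb e := rfl

theorem planeMap_dotProduct (he : ∀ a b, e a ⬝ᵥ e b = if a = b then 1 else 0) (σ : Fin 2 → ℝ)
    (a : Fin 2) : planeMap e σ ⬝ᵥ e a = σ a := by
  rw [planeMap_eq_comb, comb, add_dotProduct, smul_dotProduct, smul_dotProduct, he, he]
  fin_cases a <;> simp

theorem planeMap_dotProduct_self (he : ∀ a b, e a ⬝ᵥ e b = if a = b then 1 else 0)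
    (σ : Fin 2 → ℝ) : planeMap e σ ⬝ᵥ planeMap e σ = σ ⬝ᵥ σ := by
  conv_lhs =>
    arg 2
    rw [planeMap_eq_comb, comb]
  rw [dotProduct_add, dotProduct_smul, dotProduct_smul, planeMap_dotProduct he,
    planeMap_dotProduct he]
  simp [dotProduct, Fin.sum_univ_two]

theorem euclid_planeMap (he : ∀ a b, e a ⬝ᵥ e b = if a = b then 1 else 0) (σ : Fin 2 → ℝ) :
    euclid (planeMap e σ) = euclid σ := by
  rw [euclid_eq_sqrt, euclid_eq_sqrt, planeMap_dotProduct_self he]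

theorem cross_dotProduct_planeMap (σ : Fin 2 → ℝ) : (e 0 ⨯₃ e 1) ⬝ᵥ planeMap e σ = 0 := by
  rw [dotProduct_comm, planeMap_eq_comb, comb, add_dotProduct, smul_dotProduct, smul_dotProduct,
    dot_self_cross, dot_cross_self]
  simp

theorem cross_dotProduct_self (he : ∀ a b, e a ⬝ᵥ e b = if a = b then 1 else 0) :
    (e 0 ⨯₃ e 1) ⬝ᵥ (e 0 ⨯₃ e 1) = 1 := by
  rw [cross_dot_cross]
  simp [he]

/-- A vector orthogonal to the normal is in the range of `planeMap`. -/
theorem planeMap_of_orthogonal (he : ∀ a b, e a ⬝ᵥ e b = if a = b then 1 else 0)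
    {w x : Fin 3 → ℝ} (hw0 : w ≠ 0) (hw : ∀ a, e a ⬝ᵥ w = 0) (hx : x ⬝ᵥ w = 0) :
    planeMap e ![x ⬝ᵥ e 0, x ⬝ᵥ e 1] = x := by
  have hww : w ⬝ᵥ w ≠ 0 := fun h => hw0 (dotProduct_self_eq_zero.1 h)
  have ht := gram_cross (e 0) (e 1) w
  rw [he, he, he, hw, hw] at ht
  refine sub_eq_zero.1 (eq_zero_of_orthogonal (a := e 0) (b := e 1) (c := w) (fun h => ?_)
    ?_ ?_ ?_)
  · rw [h] at ht
    simp at ht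
    exact hww ht.symm
  · rw [sub_dotProduct, planeMap_dotProduct he]; simp
  · rw [sub_dotProduct, planeMap_dotProduct he]; simp
  · rw [sub_dotProduct, hx, planeMap_eq_comb, comb, add_dotProduct, smul_dotProduct,
      smul_dotProduct, hw, hw]
    simp

theorem exists_orthonormal {w t : Fin 3 → ℝ} (hw0 : w ≠ 0) (ht0 : t ≠ 0) (ht : t ⬝ᵥ w = 0) :
    ∃ e : Fin 2 → Fin 3 → ℝ, (∀ a b, e a ⬝ᵥ e b = if a = b then 1 else 0) ∧
      ∀ a, e a ⬝ᵥ w = 0 := by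
  have h1 := (euclid_pos hw0).ne'
  have h2 := (euclid_pos ht0).ne'
  have ht' : w ⬝ᵥ t = 0 := by rw [dotProduct_comm]; exact ht
  refine ⟨![(euclid t)⁻¹ • t, ((euclid w)⁻¹ * (euclid t)⁻¹) • (w ⨯₃ t)], fun a b => ?_,
    fun a => ?_⟩
  · fin_cases a <;> fin_cases b
    · simp [← euclid_sq]; field_simp
    · simp [dot_cross_self]
    · simp [dotProduct_comm _ t, dot_cross_self]
    · simp [← euclid_sq]
      field_simp
      rw [euclid_sq, euclid_sq, euclid_sq, cross_dot_cross, ht, ht']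
      ring
  · fin_cases a
    · simp [ht]
    · simp [dotProduct_comm _ w, dot_self_cross]

end plane

/-! ### The boundary condition and the extent of a planar solution -/

namespace IsStationaryTypeI

open ConformalRadius

variable {C : ConformalRadius n rm L} {U : Set (Fin 2 → ℝ)} {Y : (Fin 2 → ℝ) → Fin 3 → ℝ}
  {χ : (Fin 2 → ℝ) → Fin 2 → ℝ}

/-- A surface in a plane is an open subset of the plane. -/
theorem isOpen_preimage_plane (S : IsStationaryTypeI C U Y χ) {e : Fin 2 → Fin 3 → ℝ}
    (he : ∀ a b, e a ⬝ᵥ e b = if a = b then 1 else 0) {w : Fin 3 → ℝ} (hw0 : w ≠ 0)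
    (hew : ∀ a, e a ⬝ᵥ w = 0) (hw : ∀ σ ∈ U, w ⬝ᵥ Y σ = 0) :
    IsOpen (planeMap e ⁻¹' (Y '' U)) := by
  -- Cartesian coordinates of the surface within the plane. Being an immersion between equal
  -- dimensions, this map is open.
  set G : (Fin 2 → ℝ) → Fin 2 → ℝ := fun σ a => Y σ ⬝ᵥ e a with hG
  have hGY : ∀ σ ∈ U, planeMap e (G σ) = Y σ := fun σ hσ => by
    have h1 := planeMap_of_orthogonal he hw0 hew (x := Y σ) (by rw [dotProduct_comm]; exact hw σ hσ)
    have h2 : G σ = ![Y σ ⬝ᵥ e 0, Y σ ⬝ᵥ e 1] := by ext a; fin_cases a <;> rfl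
    rw [h2, h1]
  have himg : planeMap e ⁻¹' (Y '' U) = G '' U := by
    ext x
    constructor
    · rintro ⟨σ, hσ, h⟩
      refine ⟨σ, hσ, ?_⟩
      ext a
      rw [← planeMap_dotProduct he x a, ← h]
    · rintro ⟨σ, hσ, rfl⟩
      exact ⟨σ, hσ, (hGY σ hσ).symm⟩
  rw [himg, isOpen_iff_mem_nhds]
  rintro _ ⟨σ, hσ, rfl⟩
  have hGs : ∀ a, ContDiffOn ℝ ∞ (fun σ => Y σ ⬝ᵥ e a) U := fun a =>
    contDiffOn_dotProduct S.smooth contDiffOn_const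
  have hGc : ContDiffAt ℝ ∞ G σ :=
    (contDiffOn_pi.2 hGs).contDiffAt (S.isOpen.mem_nhds hσ)
  have hst := hGc.hasStrictFDerivAt (by simp)
  have hGd : DifferentiableAt ℝ G σ := hGc.differentiableAt (by simp)
  have hfd : ∀ v a, fderiv ℝ G σ v a = comb (tangent Y σ) v ⬝ᵥ e a := fun v a => by
    have h1 : fderiv ℝ G σ v a = fderiv ℝ (fun y => Y y ⬝ᵥ e a) σ v := by
      rw [fderiv_pi (differentiableAt_pi.1 hGd)]; rfl
    rw [h1, ← sum_mul_pd, Fin.sum_univ_two,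
      pd_dotProduct_const (differentiableAt_of_contDiffOn S.isOpen S.smooth hσ),
      pd_dotProduct_const (differentiableAt_of_contDiffOn S.isOpen S.smooth hσ)]
    simp [comb, add_dotProduct, smul_dotProduct]
  obtain ⟨N, hN⟩ := S.exists_normal
  have F := hN.frame S.isOpen S.smooth hσ (S.det_ne_zero hσ)
    (S.euclMean_eq_zero hσ fun a => hN.dot_tangent hσ a)
  have hinj : Function.Injective (fderiv ℝ G σ).toLinearMap := by
    rw [← LinearMap.ker_eq_bot, LinearMap.ker_eq_bot']
    intro v hv
    have hv' : ∀ a, comb (tangent Y σ) v ⬝ᵥ e a = 0 := fun a => by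
      rw [← hfd]; exact congrFun hv a
    refine F.comb_injective ?_
    have h1 : comb (tangent Y σ) v ⬝ᵥ w = 0 := by
      simp [comb, dotProduct_comm _ w,
        dot_tangent_of_plane S.isOpen S.smooth hw hσ]
    rw [← planeMap_of_orthogonal he hw0 hew h1, hv', hv']
    ext i
    simp [planeMap]
  have hsurj : (fderiv ℝ G σ).range = ⊤ :=
    LinearMap.range_eq_top.2 (LinearMap.injective_iff_surjective.1 hinj)
  rw [← hst.map_nhds_eq_of_surj hsurj]
  exact Filter.image_mem_map (S.isOpen.mem_nhds hσ)

theorem comap_neBot {X : (WVIndex → ℝ) → STIndex n → ℝ} {W : Set (WVIndex → ℝ)}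
    {p : STIndex n → ℝ} (hp : p ∈ closure (X '' W)) :
    (Filter.comap X (𝓝 p) ⊓ Filter.principal W).NeBot := by
  rw [Filter.inf_principal_neBot_iff]
  rintro T ⟨V, hV, hVT⟩
  obtain ⟨_, hxV, s, hs, rfl⟩ := mem_closure_iff_nhds.1 hp V hV
  exact ⟨s, hVT hxV, hs⟩

theorem tendsto_radius {X : (WVIndex → ℝ) → STIndex n → ℝ} {W : Set (WVIndex → ℝ)}
    {p : STIndex n → ℝ} :
    Filter.Tendsto (fun s => euclid fun q => X s (some q))
      (Filter.comap X (𝓝 p) ⊓ Filter.principal W) (𝓝 (euclid fun q => p (some q))) := by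
  have hc : Continuous fun x : STIndex n → ℝ => euclid fun q => x (some q) :=
    continuous_euclid.comp (continuous_pi fun q => continuous_apply (some q))
  exact (hc.tendsto p).comp (Filter.tendsto_comap.mono_left inf_le_left)

/-- Inside the connected ball the surface is open, and it is relatively closed: at a missing limit
point `𝐤²` would tend both to the positive redshift there and to zero. -/
theorem image_eq_ball (S : IsStationaryTypeI C U Y χ) (hrm : 0 ≤ rm) (hL : 0 < L)
    (hB : BoundaryCondition C.metric (typeI n Y) (worldvolume U) (wvField χ))
    {w : Fin 3 → ℝ} (hw0 : w ≠ 0) (hw : ∀ σ ∈ U, w ⬝ᵥ Y σ = 0) :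
    ∃ Ω : ℝ, Y '' U = {x | w ⬝ᵥ x = 0} ∩ C.ball 3 Ω := by
  obtain ⟨Ω, hΩ⟩ := S.exists_redshift hrm hL hw0 hw
  obtain ⟨σ₀, h0⟩ := S.connected.nonempty
  obtain ⟨e, he, hew⟩ := exists_orthonormal hw0 ((S.immersion σ₀ h0).ne_zero 0)
    (by rw [dotProduct_comm]; exact dot_tangent_of_plane S.isOpen S.smooth hw h0 0)
  have hsub : ∀ σ ∈ U, Y σ ∈ C.ball 3 Ω := fun σ hσ => by
    refine mem_ball_iff.2 ⟨S.euclid_mem hσ, ?_⟩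
    have h1 := S.timelike (liftPoint σ) hσ
    rw [hΩ _ hσ] at h1
    exact h1
  have hopen := S.isOpen_preimage_plane he hw0 hew hw
  have hclosed : ∀ x ∈ C.ball 2 Ω, x ∈ closure (planeMap e ⁻¹' (Y '' U)) →
      x ∈ planeMap e ⁻¹' (Y '' U) := fun x hx hcl => by
    by_contra hnot
    obtain ⟨hxJ, hxr⟩ := mem_ball_iff.1 hx
    set p : STIndex n → ℝ := liftSpace (pad n (planeMap e x)) with hp
    have hpsp : (fun q => p (some q)) = pad n (planeMap e x) := rfl
    have hpcl : p ∈ closure (typeI n Y '' worldvolume U) := by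
      have hcont : Continuous fun x : Fin 2 → ℝ => (liftSpace (pad n (planeMap e x))
          : STIndex n → ℝ) := by
        refine continuous_pi fun μ => ?_
        rcases μ with _ | q
        · exact continuous_const
        · change Continuous fun x => pad n (planeMap e x) q
          unfold pad planeMap
          by_cases hq : q.val < 3 <;> simp only [hq, dite_true, dite_false] <;> fun_prop
      refine map_mem_closure hcont hcl ?_
      rintro y ⟨σ, hσ, hy⟩
      refine ⟨liftPoint σ, hσ, ?_⟩
      ext μ
      rcases μ with _ | q
      · rfl
      · change pad n (Y σ) q = pad n (planeMap e y) q
        rw [hy]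
    have hpnot : p ∉ typeI n Y '' worldvolume U := by
      rintro ⟨s, hs, h⟩
      refine hnot ⟨fun a => s (some a), hs, ?_⟩
      have h1 : pad n (Y fun a => s (some a)) = pad n (planeMap e x) := by
        rw [← hpsp, ← h]; rfl
      rw [← trunc_pad (n := n) (Y _), h1, trunc_pad]
    have hlim := hB p ⟨hpcl, hpnot⟩
    have hne := comap_neBot hpcl
    have hrad : Filter.Tendsto (fun s : WVIndex → ℝ => euclid (Y fun a => s (some a)))
        (Filter.comap (typeI n Y) (𝓝 p) ⊓ Filter.principal (worldvolume U)) (𝓝 (euclid x)) := by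
      have h1 := tendsto_radius (X := typeI n Y) (W := worldvolume U) (p := p)
      rw [hpsp, euclid_pad, euclid_planeMap he] at h1
      refine h1.congr fun s => ?_
      exact euclid_pad _
    have hradJ : Filter.Tendsto (fun s : WVIndex → ℝ => euclid (Y fun a => s (some a)))
        (Filter.comap (typeI n Y) (𝓝 p) ⊓ Filter.principal (worldvolume U))
        (𝓝[C.J] (euclid x)) := by
      refine tendsto_nhdsWithin_iff.2 ⟨hrad, ?_⟩
      filter_upwards [Filter.mem_inf_of_right (Filter.mem_principal_self _)] with s hs
      exact S.euclid_mem hs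
    have hred := ((continuousOn_redshift hrm hL Ω) _ hxJ).tendsto.comp hradJ
    have hlim2 := hred.congr' (f₂ := kSq C.metric (typeI n Y) (wvField χ)) (by
      filter_upwards [Filter.mem_inf_of_right (Filter.mem_principal_self _)] with s hs
      exact (hΩ s hs).symm)
    exact hxr.ne' (tendsto_nhds_unique hlim2 hlim)
  have hall : C.ball 2 Ω ⊆ planeMap e ⁻¹' (Y '' U) := by
    refine (isPreconnected_ball hrm hL le_rfl Ω).subset_left_of_subset_union hopen
      isClosed_closure.isOpen_compl (v := (closure (planeMap e ⁻¹' (Y '' U)))ᶜ)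
      (Set.disjoint_compl_right_iff_subset.2 subset_closure) (fun x hx => ?_) ?_
    · by_cases h : x ∈ closure (planeMap e ⁻¹' (Y '' U))
      · exact Or.inl (hclosed x hx h)
      · exact Or.inr h
    · have h1 := planeMap_of_orthogonal he hw0 hew (x := Y σ₀)
        (by rw [dotProduct_comm]; exact hw σ₀ h0)
      refine ⟨![Y σ₀ ⬝ᵥ e 0, Y σ₀ ⬝ᵥ e 1], ?_, σ₀, h0, h1.symm⟩
      rw [mem_ball_iff, ← euclid_planeMap he, h1]
      exact mem_ball_iff.1 (hsub σ₀ h0)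
  refine ⟨Ω, Set.Subset.antisymm ?_ ?_⟩
  · rintro _ ⟨σ, hσ, rfl⟩
    exact ⟨hw σ hσ, hsub σ hσ⟩
  · rintro x ⟨hx, hxb⟩
    have h1 := planeMap_of_orthogonal he hw0 hew (x := x) (by rw [dotProduct_comm]; exact hx)
    rw [← h1]
    refine hall ?_
    rw [mem_ball_iff, ← euclid_planeMap he, h1]
    exact mem_ball_iff.1 hxb

end IsStationaryTypeI

end

section

/-! ## Rotating planes solve the blackfold equations -/

open scoped Matrix

/-- The rotation of `ℝ³` about `w`, extended to space by zero. -/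
def rotation (n : ℕ) (w : Fin 3 → ℝ) : (Fin (n + 4) → ℝ) →ₗ[ℝ] (Fin (n + 4) → ℝ) where
  toFun x := pad n (w ⨯₃ trunc x)
  map_add' x y := by
    have h : trunc (x + y) = trunc x + trunc y := rfl
    rw [h, map_add]
    ext q
    by_cases hq : q.val < 3 <;> simp [pad, hq]
  map_smul' c x := by
    have h : trunc (c • x) = c • trunc x := rfl
    rw [h, map_smul]
    ext q
    by_cases hq : q.val < 3 <;> simp [pad, hq]

theorem rotation_pad (w v : Fin 3 → ℝ) : rotation n w (pad n v) = pad n (w ⨯₃ v) := by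
  change pad n (w ⨯₃ trunc (pad n v)) = _
  rw [trunc_pad]

theorem rotation_dotProduct (w : Fin 3 → ℝ) (x : Fin (n + 4) → ℝ) : rotation n w x ⬝ᵥ x = 0 := by
  rw [dotProduct_comm]
  exact (sum_mul_pad x (w ⨯₃ trunc x)).trans (dot_cross_self _ _)

theorem pd_rotation (w : Fin 3 → ℝ) (x : Fin (n + 4) → ℝ) (p q : Fin (n + 4)) :
    pd (fun y => rotation n w y q) p x = rotation n w (Pi.single p 1) q := by
  have h : HasFDerivAt (fun y => rotation n w y q)
      ((ContinuousLinearMap.proj q).comp (LinearMap.toContinuousLinearMap (rotation n w))) x :=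
    ((ContinuousLinearMap.proj (R := ℝ) (φ := fun _ : Fin (n + 4) => ℝ) q).comp
      (LinearMap.toContinuousLinearMap (rotation n w))).hasFDerivAt
  unfold pd
  rw [h.fderiv]
  rfl

theorem rotation_antisymm (w : Fin 3 → ℝ) (p q : Fin (n + 4)) :
    rotation n w (Pi.single p 1) q + rotation n w (Pi.single q 1) p = 0 := by
  have h := rotation_dotProduct w (Pi.single p 1 + Pi.single q 1)
  have hp := rotation_dotProduct w (Pi.single p 1)
  have hq := rotation_dotProduct w (Pi.single q 1)
  rw [map_add, add_dotProduct, dotProduct_add, dotProduct_add] at h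
  simp only [dotProduct_single, mul_one] at h hp hq
  linarith

/-! ### Planes through the origin: Killing field, stationarity and boundary condition -/

namespace ConformalRadius

variable {C : ConformalRadius n rm L}

theorem isKilling_rotation (w : Fin 3 → ℝ) :
    IsKilling C.metric C.domain (stField n (rotation n w)) := by
  refine ⟨contDiffOn_pi.2 fun μ => ?_, fun x hx μ ν => ?_⟩
  · rcases μ with _ | q
    · exact contDiffOn_const
    · have h : ContDiff ℝ ∞ fun x : STIndex n → ℝ => (fun r => x (some r) : Fin (n + 4) → ℝ) :=
        contDiff_pi.2 fun r => contDiff_apply ℝ ℝ (some r)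
      have h2 : ContDiff ℝ ∞ (rotation n w) :=
        (LinearMap.toContinuousLinearMap (rotation n w)).contDiff
      exact ((contDiff_pi.1 h2 q).comp h).contDiffOn
  · have hF : ∀ y, fderiv ℝ C.potF y (rotation n w y) = 0 := fun y =>
      fderiv_radial_orthogonal (fun s => fSdS n rm L (C.R s)) (rotation_dotProduct w y)
    have hH : ∀ y, fderiv ℝ C.potH y (rotation n w y) = 0 := fun y =>
      fderiv_radial_orthogonal (fun s => (C.h s)⁻¹) (rotation_dotProduct w y)
    rcases μ with _ | p <;> rcases ν with _ | q
    · rw [killing_time_time, hF, neg_zero]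
    · exact killing_time_space x q
    · exact killing_space_time x p
    · rw [killing_space_space, hH, ite_self, pd_rotation, pd_rotation, rotation_antisymm]
      simp

variable {e : Fin 2 → Fin 3 → ℝ}

theorem tangent_planeMap (e : Fin 2 → Fin 3 → ℝ) (σ : Fin 2 → ℝ) (a : Fin 2) :
    tangent (planeMap e) σ a = e a := by
  ext i
  unfold tangent planeMap
  rw [pd_add (by fun_prop) (by fun_prop), pd_mul (by fun_prop) (by fun_prop),
    pd_mul (by fun_prop) (by fun_prop), pd_coord, pd_coord, pd_const, pd_const]
  fin_cases a <;> simp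

theorem hess_planeMap (e : Fin 2 → Fin 3 → ℝ) (σ : Fin 2 → ℝ) (a b : Fin 2) :
    hess (planeMap e) σ a b = 0 := by
  ext i
  unfold hess
  simp only [tangent_planeMap, pd_const, Pi.zero_apply]

theorem comb_rotField (he : ∀ a b, e a ⬝ᵥ e b = if a = b then 1 else 0) (Ω : ℝ) (σ : Fin 2 → ℝ) :
    comb e (rotField Ω σ) = Ω • ((e 0 ⨯₃ e 1) ⨯₃ planeMap e σ) := by
  rw [planeMap_eq_comb, comb, comb, map_add, map_smul, map_smul, cross_cross_eq_smul_sub_smul,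
    cross_cross_eq_smul_sub_smul]
  simp [he, rotField]
  module

theorem kSq_planeMap (he : ∀ a b, e a ⬝ᵥ e b = if a = b then 1 else 0) {Ω : ℝ}
    {s : WVIndex → ℝ} (hs : euclid (fun a => s (some a)) ∈ C.J) :
    kSq C.metric (typeI n (planeMap e)) (wvField (rotField Ω)) s
      = C.redshift Ω (euclid fun a => s (some a)) := by
  have h : tangent (planeMap e) (fun a => s (some a)) = e := by
    ext a i; rw [tangent_planeMap]
  rw [kSq_eq_speedSq, euclid_planeMap he, speedSq_eq, h, ← planeMap_eq_comb,
    planeMap_dotProduct_self he]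
  have h2 : rotField Ω (fun a => s (some a)) ⬝ᵥ rotField Ω (fun a => s (some a))
      = Ω ^ 2 * euclid (fun a => s (some a)) ^ 2 := by
    rw [euclid_sq]
    simp [rotField, dotProduct, Fin.sum_univ_two]
    ring
  rw [h2]
  unfold redshift
  rw [C.sq_eq _ hs]
  ring

theorem isStationaryTypeI_planeMap (hrm : 0 ≤ rm) (hL : 0 < L)
    (he : ∀ a b, e a ⬝ᵥ e b = if a = b then 1 else 0) {Ω : ℝ} (hne : (C.ball 2 Ω).Nonempty) :
    IsStationaryTypeI C (C.ball 2 Ω) (planeMap e) (rotField Ω) where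
  isOpen := isOpen_ball hrm hL 2 Ω
  connected := ⟨hne, isPreconnected_ball hrm hL le_rfl Ω⟩
  smooth := by
    refine contDiffOn_pi.2 fun i => ?_
    unfold planeMap
    fun_prop
  immersion σ _ := by
    have h : tangent (planeMap e) σ = e := by ext a i; rw [tangent_planeMap]
    rw [h, Fintype.linearIndependent_iff]
    intro g hg a
    rw [Fin.sum_univ_two] at hg
    rw [← planeMap_dotProduct he g a]
    change comb e g ⬝ᵥ e a = 0
    rw [comb, hg, zero_dotProduct]
  minimal σ _ m _ := by
    rw [meanCurv_one]
    simp [euclMean, hess_planeMap]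
  mem_domain s hs := by
    change euclid (pad n (planeMap e fun a => s (some a))) ∈ C.J
    rw [euclid_pad, euclid_planeMap he]
    exact (mem_ball_iff.1 hs).1
  killing := by
    refine ⟨rotation n (Ω • (e 0 ⨯₃ e 1)), isKilling_rotation _, fun s _ μ => ?_⟩
    rw [Fintype.sum_option, Fin.sum_univ_two]
    rcases μ with _ | q
    · simp [tangent_none_none, tangent_some_none, stField, wvField]
    · rw [tangent_none_some, tangent_some_some, tangent_some_some, tangent_planeMap,
        tangent_planeMap]
      change rotation n (Ω • (e 0 ⨯₃ e 1)) (pad n (planeMap e fun a => s (some a))) q = _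
      rw [rotation_pad, map_smul, LinearMap.smul_apply, ← comb_rotField he]
      by_cases hq : q.val < 3
      · simp [pad, hq, comb, wvField]; ring
      · simp [pad, hq]
  timelike s hs := by
    obtain ⟨h1, h2⟩ := mem_ball_iff.1 hs
    rwa [kSq_planeMap he h1]

/-- There are two kinds of limit point. At a radius in `J` the redshift is nonnegative by
continuity, and were it positive the point would belong to the worldvolume. At a radius outside `J`
one is at a horizon, and `0 < 𝐤² ≤ f → 0`. -/
theorem boundaryCondition_planeMap (hrm : 0 ≤ rm) (hL : 0 < L)
    (he : ∀ a b, e a ⬝ᵥ e b = if a = b then 1 else 0) (Ω : ℝ) :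
    BoundaryCondition C.metric (typeI n (planeMap e)) (worldvolume (C.ball 2 Ω))
      (wvField (rotField Ω)) := by
  intro p hp
  have hne := IsStationaryTypeI.comap_neBot hp.1
  set l := Filter.comap (typeI n (planeMap e)) (𝓝 p) ⊓
    Filter.principal (worldvolume (C.ball 2 Ω)) with hl
  have hmem : ∀ᶠ s in l, s ∈ worldvolume (C.ball 2 Ω) :=
    Filter.mem_inf_of_right (Filter.mem_principal_self _)
  set ρ := euclid fun q => p (some q) with hρ
  have hrad : Filter.Tendsto (fun s : WVIndex → ℝ => euclid fun a => s (some a)) l (𝓝[C.J] ρ) := by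
    refine tendsto_nhdsWithin_iff.2 ⟨?_, ?_⟩
    · refine (IsStationaryTypeI.tendsto_radius (X := typeI n (planeMap e))).congr fun s => ?_
      exact (euclid_pad _).trans (euclid_planeMap he _)
    · filter_upwards [hmem] with s hs
      exact (mem_ball_iff.1 hs).1
  have hk : ∀ᶠ s in l, C.redshift Ω (euclid fun a => s (some a))
      = kSq C.metric (typeI n (planeMap e)) (wvField (rotField Ω)) s := by
    filter_upwards [hmem] with s hs
    exact (kSq_planeMap he (mem_ball_iff.1 hs).1).symm
  have hpos : ∀ᶠ s in l, 0 < C.redshift Ω (euclid fun a => s (some a)) := by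
    filter_upwards [hmem] with s hs
    exact (mem_ball_iff.1 hs).2
  refine Filter.Tendsto.congr' hk ?_
  by_cases hJ : ρ ∈ C.J
  · have hlim := ((continuousOn_redshift (C := C) hrm hL Ω) ρ hJ).tendsto.comp hrad
    have h0 : 0 ≤ C.redshift Ω ρ := ge_of_tendsto hlim (hpos.mono fun s hs => hs.le)
    rcases h0.eq_or_lt with h1 | h1
    · rw [← h1] at hlim
      exact hlim
    exfalso
    refine hp.2 ?_
    set x : Fin 3 → ℝ := trunc fun q => p (some q) with hx
    -- The embedded plane is closed, so a limit point stays on it and is determined by its two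
    -- Cartesian coordinates and its time.
    have hclosed : IsClosed {y : STIndex n → ℝ | ∀ q, y (some q)
        = pad n (planeMap e ![(trunc fun q => y (some q)) ⬝ᵥ e 0,
          (trunc fun q => y (some q)) ⬝ᵥ e 1]) q} := by
      simp only [Set.ofPred_forall]
      refine isClosed_iInter fun q => isClosed_eq (continuous_apply _) ?_
      unfold pad planeMap trunc dotProduct
      by_cases hq : q.val < 3 <;> simp only [hq, dite_true, dite_false, Fin.sum_univ_three,
        Matrix.cons_val_zero, Matrix.cons_val_one] <;> fun_prop
    have hpad := closure_minimal (t := {y : STIndex n → ℝ | ∀ q, y (some q)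
        = pad n (planeMap e ![(trunc fun q => y (some q)) ⬝ᵥ e 0,
          (trunc fun q => y (some q)) ⬝ᵥ e 1]) q}) (by
      rintro _ ⟨s, -, rfl⟩ q
      have h2 : (trunc fun q => typeI n (planeMap e) s (some q))
          = planeMap e fun a => s (some a) := trunc_pad _
      rw [h2, planeMap_dotProduct he, planeMap_dotProduct he, typeI_some]
      congr 2
      ext a
      fin_cases a <;> rfl) hclosed hp.1
    have hpad' : (fun q => p (some q)) = pad n (planeMap e ![x ⬝ᵥ e 0, x ⬝ᵥ e 1]) :=
      funext hpad
    have hρ' : ρ = euclid ![x ⬝ᵥ e 0, x ⬝ᵥ e 1] := by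
      rw [hρ, hpad', euclid_pad, euclid_planeMap he]
    refine ⟨fun o => match o with
      | none => p none
      | some a => ![x ⬝ᵥ e 0, x ⬝ᵥ e 1] a, ?_, ?_⟩
    · refine mem_ball_iff.2 ?_
      change euclid ![x ⬝ᵥ e 0, x ⬝ᵥ e 1] ∈ C.J ∧ 0 < C.redshift Ω (euclid ![x ⬝ᵥ e 0, x ⬝ᵥ e 1])
      rw [← hρ']
      exact ⟨hJ, h1⟩
    · ext μ
      rcases μ with _ | q
      · rfl
      · exact (hpad q).symm
  · have hcl : ρ ∈ closure C.J :=
      mem_closure_iff_nhdsWithin_neBot.2 (hrad.neBot)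
    refine tendsto_of_tendsto_of_tendsto_of_le_of_le' tendsto_const_nhds
      ((tendsto_f_zero hrm hL hcl hJ).comp hrad) (hpos.mono fun s hs => hs.le)
      (Filter.Eventually.of_forall fun s => ?_)
    simp only [redshift, Function.comp]
    have : 0 ≤ Ω ^ 2 * C.R (euclid fun a => s (some a)) ^ 2 := by positivity
    linarith

theorem solvesBlackfold_planeMap (hrm : 0 ≤ rm) (hL : 0 < L)
    (he : ∀ a b, e a ⬝ᵥ e b = if a = b then 1 else 0) {Ω : ℝ} (hne : (C.ball 2 Ω).Nonempty) :
    SolvesBlackfold n C.metric (typeI n (planeMap e)) (worldvolume (C.ball 2 Ω))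
      (wvField (rotField Ω)) := by
  refine ⟨(isStationaryTypeI_planeMap hrm hL he hne).extrinsicEquation_of_plane
    (w := e 0 ⨯₃ e 1) (fun h => ?_) (fun σ _ => cross_dotProduct_planeMap σ),
    boundaryCondition_planeMap hrm hL he Ω⟩
  have := cross_dotProduct_self he
  rw [h, zero_dotProduct] at this
  exact zero_ne_one this

end ConformalRadius

end

end Blackfold

end

/-! ### Assembly of the four statements -/

theorem mainTheorem5 (n : ℕ) (hn : 1 ≤ n) (rm L : ℝ) (hrm : 0 ≤ rm) (hL : 0 < L)
    (hrange : (Blackfold.staticRange n rm L).Nonempty) :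
    -- conformally flat coordinates exist, and in any such coordinates:
    Nonempty (Blackfold.ConformalRadius n rm L) ∧
    ∀ C : Blackfold.ConformalRadius n rm L,
      -- a stationary Type I surface solves the extrinsic equation iff it lies in a plane through 0
      (∀ U Y χ, Blackfold.IsStationaryTypeI C U Y χ →
        (Blackfold.ExtrinsicEquation n C.metric (Blackfold.typeI n Y) (Blackfold.worldvolume U)
            (Blackfold.wvField χ) ↔
          ∃ w : Fin 3 → ℝ, w ≠ 0 ∧ ∀ σ ∈ U, w ⬝ᵥ Y σ = 0)) ∧
      -- with the boundary condition, it is the whole plane up to its limiting surface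
      (∀ U Y χ, Blackfold.IsStationaryTypeI C U Y χ →
        Blackfold.SolvesBlackfold n C.metric (Blackfold.typeI n Y) (Blackfold.worldvolume U)
            (Blackfold.wvField χ) →
          ∃ w : Fin 3 → ℝ, w ≠ 0 ∧ ∃ Ω : ℝ, Y '' U = {x | w ⬝ᵥ x = 0} ∩ C.ball 3 Ω) ∧
      -- every plane through 0, static or rotating, solves all the blackfold equations
      (∀ (e : Fin 2 → Fin 3 → ℝ) (Ω : ℝ), (∀ a b, e a ⬝ᵥ e b = if a = b then 1 else 0) →
        (C.ball 2 Ω).Nonempty →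
          Blackfold.IsStationaryTypeI C (C.ball 2 Ω) (Blackfold.planeMap e)
            (Blackfold.rotField Ω) ∧
          Blackfold.SolvesBlackfold n C.metric (Blackfold.typeI n (Blackfold.planeMap e))
            (Blackfold.worldvolume (C.ball 2 Ω)) (Blackfold.wvField (Blackfold.rotField Ω))) ∧
      -- helicoids, catenoids and Scherk surfaces fail, whatever the velocity along `∂_φ`
      (∀ a c l Ω : ℝ, a ≠ 0 → 0 < c → 0 ≤ l → l ≤ 1 → ∀ U : Set (Fin 2 → ℝ),
        IsOpen U → U.Nonempty →
        (∀ s ∈ Blackfold.worldvolume U, Blackfold.typeI n (Blackfold.scherk a c l) s ∈ C.domain) →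
        (∀ s ∈ Blackfold.worldvolume U,
          0 < Blackfold.kSq C.metric (Blackfold.typeI n (Blackfold.scherk a c l))
            (Blackfold.wvField fun _ => ![0, Ω]) s) →
        ¬ Blackfold.ExtrinsicEquation n C.metric (Blackfold.typeI n (Blackfold.scherk a c l))
            (Blackfold.worldvolume U) (Blackfold.wvField fun _ => ![0, Ω])) := by
  refine ⟨Blackfold.nonempty_conformalRadius hrm hL hrange, fun C => ⟨fun U Y χ S => ⟨fun hE =>
    S.exists_plane hn hrm hL hE, fun ⟨w, hw0, hw⟩ => S.extrinsicEquation_of_plane hw0 hw⟩,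
    fun U Y χ S hE => ?_, fun e Ω he hne =>
      ⟨Blackfold.ConformalRadius.isStationaryTypeI_planeMap hrm hL he hne,
        Blackfold.ConformalRadius.solvesBlackfold_planeMap hrm hL he hne⟩,
    fun a c l Ω ha hc hl0 hl1 U hU hne hdom hk hE => ?_⟩⟩
  · obtain ⟨w, hw0, hw⟩ := S.exists_plane hn hrm hL hE.1
    exact ⟨w, hw0, S.image_eq_ball hrm hL hE.2 hw0 hw⟩
  · rcases hl0.eq_or_lt with rfl | hl
    · exact Blackfold.ConformalRadius.not_extrinsic_catenoid hn hrm hL ha hc hU hne hdom hk hE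
    · exact Blackfold.ConformalRadius.not_extrinsic_scherk hrm hL ha hc hl hl1 hU hne hdom hk hE
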